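/- For a compact Riemannian manifold $(M,g)$ of dimension $m\ge 4$ let $\mathrm{Gr}_2TM=\{(p,\Sigma): p\in M,\ \Sigma\subset T_pM \text{ a linear subspace},\ \dim\Sigma=2\}$, with the volume obtained by integrating over each fibre $\mathrm{Gr}_2T_pM$ against its Fubini--Study volume and then over $M$ against the Riemannian volume of $g$. Here the Fubini--Study metric of $\mathrm{Gr}_2V$ is the one induced by $\Sigma\mapsto\mathrm{pr}_\Sigma$ from the scalar product $h(A,B)=\frac12\mathrm{tr}(AB)$ on symmetric endomorphisms of $V$. Let $\mathrm{sec}:\mathrm{Gr}_2TM\to\mathbb R$ be the sectional curvature. For $x\in\mathbb R$ and $k\in\mathbb N_0$ put $\binom xk=\frac1{k!}x(x-1)\cdots(x-k+1)$. Let $M$ be one of $\mathbb CP^n$, $\mathbb HP^n$ ($n\ge2$) or the Cayley plane $\mathbb OP^2$, realized as the set of Hermitian matrices $P$ with $P^2=P$ and $\mathrm{tr}\,P=1$, of size $n+1$ over $\mathbb C$ or $\mathbb H$, respectively of size $3$ over the octonions, with the Fubini--Study metric $\frac12\mathrm{Re}\,\mathrm{tr}(dP\,dP)$. Then $M$ is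 a compact Riemannian symmetric space of dimension $2n$, $4n$, $16$ respectively, and $\mathrm{sec}$ has image exactly $[1,4]$. The distribution of $\mathrm{sec}$ with respect to the normalized volume of $\mathrm{Gr}_2TM$ is as follows: for every $F:\mathbb R\to\mathbb R$ such that the integrand on the right-hand side is integrable on $[1,4]$, the function $F(\mathrm{sec})$ is integrable on $\mathrm{Gr}_2TM$ and $$\frac1{\mathrm{Vol}\,\mathrm{Gr}_2T\mathbb CP^n}\int_{\mathrm{Gr}_2T\mathbb CP^n}F(\mathrm{sec})\,\mathrm{vol}=\frac16\binom{n-\frac32}{n-2}\int_1^4\sqrt{\tfrac{s-1}3}^{\,-1}\Big(\frac{4-s}3\Big)^{n-2}F(s)\,ds,$$ $$\frac1{\mathrm{Vol}\,\mathrm{Gr}_2T\mathbb HP^n}\int_{\mathrm{Gr}_2T\mathbb HP^n}F(\mathrm{sec})\,\mathrm{vol}=\frac36\binom{2n-\frac32}{2n-3}\int_1^4\sqrt{\tfrac{s-1}3}\,\Big(\frac{4-s}3\Big)^{2n-3}F(s)\,ds,$$ $$\frac1{\mathrm{Vol}\,\mathrm{Gr}_2T\mathbb OP^2}\int_{\mathrm{Gr}_2T\mathbb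 OP^2}F(\mathrm{sec})\,\mathrm{vol}=\frac76\binom{\frac{13}2}{3}\int_1^4\sqrt{\tfrac{s-1}3}^{\,5}\Big(\frac{4-s}3\Big)^{3}F(s)\,ds.$$ Moreover, for every $k\in\mathbb N_0$ the $k$-th moment $\frac1{\mathrm{Vol}\,\mathrm{Gr}_2TM}\int_{\mathrm{Gr}_2TM}\mathrm{sec}^k\,\mathrm{vol}$ equals $$\sum_{r=0}^k4^r\,\frac{\binom{-\frac12}{r}\binom{-\frac{2n-2}2}{k-r}}{\binom{-\frac{2n-1}2}{k}},\qquad \sum_{r=0}^k4^r\,\frac{\binom{-\frac32}{r}\binom{-\frac{4n-4}2}{k-r}}{\binom{-\frac{4n-1}2}{k}},\qquad \sum_{r=0}^k4^r\,\frac{\binom{-\frac72}{r}\binom{-\frac82}{k-r}}{\binom{-\frac{15}2}{k}}$$ for $M=\mathbb CP^n$, $\mathbb HP^n$, $\mathbb OP^2$ respectively. -/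

import Mathlib

open MeasureTheory Set
open scoped ContDiff Quaternion RealInnerProductSpace

noncomputable section

/-! ### Curvature of a Riemannian metric in coordinates -/

/-- The partial derivative of `f` in the direction of the `i`-th coordinate at the point `x`. -/
def partialDeriv {m : ℕ} (i : Fin m) (f : (Fin m → ℝ) → ℝ) (x : Fin m → ℝ) : ℝ :=
  fderiv ℝ f x (Pi.single i 1)

/-- The Christoffel symbols `Γ^k_{ij}` of the metric with coefficients `g x i j`. -/
def christoffel {m : ℕ} (g : (Fin m → ℝ) → Matrix (Fin m) (Fin m) ℝ)
    (k i j : Fin m) (x : Fin m → ℝ) : ℝ :=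
  (1 / 2) * ∑ l, (g x)⁻¹ k l *
    (partialDeriv i (fun y => g y j l) x + partialDeriv j (fun y => g y i l) x
      - partialDeriv l (fun y => g y i j) x)

/-- The coefficients `R^l_{kij}` of the curvature tensor, `R(∂_i, ∂_j) ∂_k = ∑ l, R^l_{kij} ∂_l`,
with the convention `R(X, Y) Z = ∇_X ∇_Y Z - ∇_Y ∇_X Z - ∇_{[X, Y]} Z`. -/
def riemannTensor {m : ℕ} (g : (Fin m → ℝ) → Matrix (Fin m) (Fin m) ℝ)
    (l k i j : Fin m) (x : Fin m → ℝ) : ℝ :=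
  partialDeriv i (christoffel g l j k) x - partialDeriv j (christoffel g l i k) x
    + ∑ s, (christoffel g l i s x * christoffel g s j k x
      - christoffel g l j s x * christoffel g s i k x)

/-- The scalar product `g_x(u, v)`. -/
def metricApply {m : ℕ} (g : (Fin m → ℝ) → Matrix (Fin m) (Fin m) ℝ) (x u v : Fin m → ℝ) : ℝ :=
  ∑ i, ∑ j, g x i j * u i * v j

/-- The sectional curvature `g(R(u, v) v, u) / (g(u, u) g(v, v) - g(u, v)^2)` at `x` of the plane
spanned by the linearly independent coordinate vectors `u` and `v`. -/
def coordSectionalCurvature {m : ℕ} (g : (Fin m → ℝ) → Matrix (Fin m) (Fin m) ℝ)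
    (x u v : Fin m → ℝ) : ℝ :=
  metricApply g x (fun l => ∑ k, ∑ i, ∑ j, riemannTensor g l k i j x * u i * v j * v k) u /
    (metricApply g x u u * metricApply g x v v - metricApply g x u v ^ 2)

/-! ### Two-dimensional subspaces of a Euclidean vector space -/

/-- The two-dimensional linear subspaces of `E`. -/
def TwoPlane (E : Type*) [NormedAddCommGroup E] [InnerProductSpace ℝ E] : Type _ :=
  {S : Submodule ℝ E // Module.finrank ℝ S = 2}

section Euclidean

variable {E : Type*} [NormedAddCommGroup E] [InnerProductSpace ℝ E] [FiniteDimensional ℝ E]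

/-- The matrix, in an orthonormal basis of `E`, of the orthogonal projection onto a plane, divided
by `√2`. The Euclidean norm on the target corresponds to the scalar product
`h(A, B) = tr(A B) / 2` of symmetric endomorphisms of `E`. -/
def TwoPlane.projMatrix (S : TwoPlane E) :
    EuclideanSpace ℝ (Fin (Module.finrank ℝ E) × Fin (Module.finrank ℝ E)) :=
  WithLp.toLp 2 fun ij => (√2)⁻¹ *
    ⟪stdOrthonormalBasis ℝ E ij.1, S.1.starProjection (stdOrthonormalBasis ℝ E ij.2)⟫

theorem TwoPlane.projMatrix_injective :
    Function.Injective (TwoPlane.projMatrix : TwoPlane E → _) := by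
  intro S T h
  have h2 : (√2 : ℝ)⁻¹ ≠ 0 := by positivity
  have key : S.1.starProjection = T.1.starProjection := by
    have : (S.1.starProjection : E →ₗ[ℝ] E) = T.1.starProjection := by
      refine (stdOrthonormalBasis ℝ E).toBasis.ext fun j => ?_
      refine InnerProductSpace.ext_inner_left_basis (𝕜 := ℝ)
        (stdOrthonormalBasis ℝ E).toBasis fun i => ?_
      have := congrArg (fun f => f (i, j)) h
      simpa [TwoPlane.projMatrix, h2] using this
    exact ContinuousLinearMap.coe_injective this
  apply Subtype.ext
  rw [← Submodule.range_starProjection S.1, ← Submodule.range_starProjection T.1, key]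

/-- The Grassmannian of planes with the metric induced by its embedding, by orthogonal projections,
into the symmetric endomorphisms with the scalar product `h(A, B) = tr(A B) / 2`. -/
instance : MetricSpace (TwoPlane E) :=
  MetricSpace.induced TwoPlane.projMatrix TwoPlane.projMatrix_injective inferInstance

instance : MeasurableSpace (TwoPlane E) := borel _

instance : BorelSpace (TwoPlane E) := ⟨rfl⟩

/-! ### Riemannian submanifolds of a Euclidean vector space -/

/-- `φ`, restricted to the open neighbourhood `U` of `0` in `ℝ^m`, is a smooth local
parametrization of `M ⊆ E` centred at `p`: an immersion and a homeomorphism onto a relatively open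
subset of `M`. -/
structure IsLocalParametrization (m : ℕ) (M : Set E) (p : E) (U : Set (Fin m → ℝ))
    (φ : (Fin m → ℝ) → E) : Prop where
  isOpen : IsOpen U
  zero_mem : 0 ∈ U
  map_zero : φ 0 = p
  contDiffOn : ContDiffOn ℝ ∞ φ U
  injective_fderiv : ∀ x ∈ U, Function.Injective (fderiv ℝ φ x)
  isEmbedding : Topology.IsEmbedding fun x : U => φ x
  image_eq : ∃ O : Set E, IsOpen O ∧ φ '' U = M ∩ O

/-- `M ⊆ E` is a compact smooth embedded submanifold of dimension `m` (without boundary). -/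
def IsCompactSubmanifold (m : ℕ) (M : Set E) : Prop :=
  IsCompact M ∧ M.Nonempty ∧ ∀ p ∈ M, ∃ U φ, IsLocalParametrization m M p U φ

/-- The tangent space of `M` at `p`: the span of the velocities of smooth curves in `M` through
`p`. -/
def tangentSpaceOf (M : Set E) (p : E) : Submodule ℝ E :=
  Submodule.span ℝ {v | ∃ γ : ℝ → E, ContDiff ℝ ∞ γ ∧ (∀ t, γ t ∈ M) ∧ γ 0 = p ∧ deriv γ 0 = v}

/-- The coefficients `⟪∂_i φ, ∂_j φ⟫` of the induced Riemannian metric in the parametrization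
`φ`. -/
def inducedMetric {m : ℕ} (φ : (Fin m → ℝ) → E) (x : Fin m → ℝ) : Matrix (Fin m) (Fin m) ℝ :=
  Matrix.of fun i j => ⟪fderiv ℝ φ x (Pi.single i 1), fderiv ℝ φ x (Pi.single j 1)⟫

/-- The Grassmann bundle `Gr₂TM` of planes tangent to `M`. -/
def grassmannBundle (M : Set E) : Set (E × TwoPlane E) :=
  {q | q.1 ∈ M ∧ q.2.1 ≤ tangentSpaceOf M q.1}

open Classical in
/-- The sectional curvature `sec : Gr₂TM → ℝ` of the `m`-dimensional submanifold `M` with the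
induced Riemannian metric, computed in a local parametrization centred at the base point; it does
not depend on the parametrization nor on the vectors spanning the plane. -/
def sectionalCurvature (m : ℕ) (M : Set E) (q : E × TwoPlane E) : ℝ :=
  if h : ∃ c : Set (Fin m → ℝ) × ((Fin m → ℝ) → E) × (Fin m → ℝ) × (Fin m → ℝ),
      IsLocalParametrization m M q.1 c.1 c.2.1 ∧
      Submodule.span ℝ {fderiv ℝ c.2.1 0 c.2.2.1, fderiv ℝ c.2.1 0 c.2.2.2} = q.2.1
  then coordSectionalCurvature (inducedMetric h.choose.2.1) 0 h.choose.2.2.1 h.choose.2.2.2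
  else 0

/-- `M` with the induced metric is a symmetric space: every point `p` is fixed by an isometry of
`M` with differential `-id` on the tangent space at `p`. The isometry is required to be the
restriction of a linear isometry of the ambient space. -/
def IsSymmetricSubmanifold (M : Set E) : Prop :=
  ∀ p ∈ M, ∃ σ : E ≃ₗᵢ[ℝ] E, σ '' M = M ∧ σ p = p ∧ ∀ v ∈ tangentSpaceOf M p, σ v = -v

/-- The Fubini--Study volume on the planes contained in an `m`-dimensional subspace `V` of `E`:
the Hausdorff measure of dimension `dim Gr₂V = 2 (m - 2)`. -/
def fubiniStudyVolume (m : ℕ) (V : Submodule ℝ E) : Measure (TwoPlane E) :=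
  (Measure.hausdorffMeasure (2 * ((m : ℝ) - 2))).restrict {S | S.1 ≤ V}

/-- The volume on `Gr₂TM`, for a Riemannian metric that makes the projection to `M` a Riemannian
submersion with fibres carrying the Fubini--Study metric: integration over the fibres
`Gr₂(T_pM)` followed by integration over `M` against its Riemannian volume, which is the
Hausdorff measure of dimension `m` on `M`. -/
def grassmannVolume [MeasurableSpace E] [BorelSpace E] (m : ℕ) (M : Set E) :
    Measure (E × TwoPlane E) :=
  ((Measure.hausdorffMeasure (m : ℝ)).restrict M).bind fun p =>
    (fubiniStudyVolume m (tangentSpaceOf M p)).map (Prod.mk p)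

/-- The average `(1 / Vol Gr₂TM) ∫ F(sec) dvol` over the Grassmann bundle of `M`. -/
def sectionalAverage [MeasurableSpace E] [BorelSpace E] (m : ℕ) (M : Set E) (F : ℝ → ℝ) : ℝ :=
  1 / (grassmannVolume m M).real univ * ∫ q, F (sectionalCurvature m M q) ∂(grassmannVolume m M)

end Euclidean

/-! ### The octonions -/

/-- The octonions as pairs of quaternions, with the Euclidean norm of `ℝ⁸`. -/
def Octonion : Type := WithLp 2 (ℍ[ℝ] × ℍ[ℝ])

namespace Octonion

instance : NormedAddCommGroup Octonion := inferInstanceAs (NormedAddCommGroup (WithLp 2 (_ × _)))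

instance : InnerProductSpace ℝ Octonion :=
  inferInstanceAs (InnerProductSpace ℝ (WithLp 2 (ℍ[ℝ] × ℍ[ℝ])))

instance : FiniteDimensional ℝ Octonion :=
  inferInstanceAs (FiniteDimensional ℝ (WithLp 2 (ℍ[ℝ] × ℍ[ℝ])))

/-- The octonion `a + b ℓ`. -/
def mk (a b : ℍ[ℝ]) : Octonion := WithLp.toLp 2 (a, b)

/-- The first quaternionic component. -/
def fst (x : Octonion) : ℍ[ℝ] := WithLp.fst (p := 2) (α := ℍ[ℝ]) (β := ℍ[ℝ]) x

/-- The second quaternionic component. -/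
def snd (x : Octonion) : ℍ[ℝ] := WithLp.snd (p := 2) (α := ℍ[ℝ]) (β := ℍ[ℝ]) x

instance : One Octonion := ⟨mk 1 0⟩

/-- The Cayley--Dickson product. -/
instance : Mul Octonion :=
  ⟨fun x y => mk (x.fst * y.fst - star y.snd * x.snd) (y.snd * x.fst + x.snd * star y.fst)⟩

instance : Star Octonion := ⟨fun x => mk (star x.fst) (-x.snd)⟩

end Octonion

/-! ### Projective spaces -/

instance : MeasurableSpace ℍ[ℝ] := borel _

instance : BorelSpace ℍ[ℝ] := ⟨rfl⟩

instance : MeasurableSpace Octonion := borel _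

instance : BorelSpace Octonion := ⟨rfl⟩

/-- The `N × N`-matrices with coefficients in `K` and the norm `‖A‖² = ∑ |A_{ij}|² = Re tr(A A^*)`.
-/
abbrev MatrixSpace (K : Type) (N : ℕ) : Type := PiLp 2 fun _ : Fin N × Fin N => K

/-- The Hermitian idempotent `N × N`-matrices of trace one. For `K = ℂ` and `K = ℍ` these are the
orthogonal projections onto the lines in `K^N`, the points of the projective space over `K` of
dimension `N - 1`; for the octonions and `N = 3` these are the points of the Cayley plane. -/
def rankOneProjections (K : Type) [NormedAddCommGroup K] [Mul K] [One K] [Star K] (N : ℕ) :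
    Set (MatrixSpace K N) :=
  {P | (∀ i j, star (P (i, j)) = P (j, i)) ∧ (∀ i j, ∑ k, P (i, k) * P (k, j) = P (i, j)) ∧
    ∑ i, P (i, i) = 1}

/-- The projective space over `K` of dimension `N - 1` with the Fubini--Study metric
`Re tr(dP dP) / 2`, which is the metric induced by the embedding `P ↦ P / √2` into the Euclidean
space of matrices. -/
def projectiveModel (K : Type) [NormedAddCommGroup K] [InnerProductSpace ℝ K] [Mul K] [One K]
    [Star K] (N : ℕ) : Set (MatrixSpace K N) :=
  (fun P => (√2 : ℝ)⁻¹ • P) '' rankOneProjections K N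

/-- The complex projective space `ℂPⁿ` with its Fubini--Study metric. -/
def complexProjectiveSpace (n : ℕ) : Set (MatrixSpace ℂ (n + 1)) := projectiveModel ℂ (n + 1)

/-- The quaternionic projective space `ℍPⁿ` with its Fubini--Study metric. -/
def quaternionicProjectiveSpace (n : ℕ) : Set (MatrixSpace ℍ[ℝ] (n + 1)) :=
  projectiveModel ℍ[ℝ] (n + 1)

/-- The Cayley projective plane `𝕆P²` with its Fubini--Study metric. -/
def cayleyPlane : Set (MatrixSpace Octonion 3) := projectiveModel Octonion 3

end

/-!
All three spaces are treated at once, over a composition algebra `K` with a Euclidean norm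
(`EuclideanComposition`), as sets of matrices that are orbits of linear isometries.

*Reduction to one tangent space.* The affine chart `y ↦ (1, y) (1, y)^* / (1 + ‖y‖²)` parametrizes
a neighbourhood of a base point by `W = Kⁿ`, its differential at the origin is an isometry after the
scaling of the matrices by `1 / √2`, and its second differential is normal to the space. Together
with transitivity these data form a `HomogeneousChart`. Every plane tangent to the space is carried
by an isometry to a plane in `W`, and the volume of the Grassmann bundle is the product of the volume of the base
with the volume of the fibre, so only the distribution of the curvature on the Grassmannian of `W`
matters (`HomogeneousChart.lintegral_sectionalCurvature`).

*The curvature.* The Gauss equation (`coordSectionalCurvature_inducedMetric`), in the form that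
computes the coordinate expression of the curvature from second derivatives, gives
`(‖x‖² ‖y‖² - ⟪x, y⟫²) sec(x, y) = ‖x‖² (‖y‖² + 3 ‖pr_D y‖²) - 4 ⟪x, y⟫²` with `D` the `K`-line of
`x` (`EuclideanComposition.isQuarterPinchedBy`). Hence `sec = 1 + 3 t`, with `t` the share, in the
component of `y` orthogonal to `x`, of its projection to the complement of `x` in `D`, a space of
dimension `a = dim K - 1`. The only associativity needed is
`EuclideanComposition.IsTripleAssociative`, which for `n = 2` follows from alternativity.

*The law of the curvature.* The Fubini--Study volume of the Grassmannian is its Hausdorff measure,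
which is finite, nonzero and gives all balls of the same radius the same measure. Measures with
these properties are unique up to a factor (`exists_eq_smul_of_uniform`), and the law of the span
of two independent Gaussian vectors is another one. For Gaussian `y` the share `t` has the beta
distribution with parameters `a / 2` and `b / 2`, where `1 + a + b = dim W`
(`lintegral_gaussianWeight_of_orthogonal`, `lintegral_hausdorffMeasure_curvature`). This gives the
densities; the moments come from the expansion of `1 + 3 t = 4 t + (1 - t)`
(`ProbabilityTheory.integral_one_add_pow_betaMeasure`).

*Transitivity.* Diagonal unitary matrices make the entries of a column real, and a real orthogonal
matrix then moves it to the first basis vector (`EuclideanComposition.isCongruent_of_assoc`). For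
the octonions, conjugation by diagonal matrices is replaced by maps that multiply the entries by a
unit octonion from suitable sides; the Moufang identities take the place of associativity
(`EuclideanComposition.phaseLin_mem`, `EuclideanComposition.isCongruent_of_three`).
-/

noncomputable section

/-! ### The Gauss equation in coordinates -/

section Gauss

variable {E : Type*} [NormedAddCommGroup E] [InnerProductSpace ℝ E]

/-- Second derivatives in constant directions commute. -/
theorem fderiv_fderiv_apply_comm {V : Type*} [NormedAddCommGroup V] [NormedSpace ℝ V]
    {F : Type*} [NormedAddCommGroup F] [NormedSpace ℝ F] {f : V → F} {x : V}
    (hf : ContDiffAt ℝ 2 f x) (u v : V) :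
    fderiv ℝ (fun y => fderiv ℝ f y v) x u = fderiv ℝ (fun y => fderiv ℝ f y u) x v := by
  have hd : DifferentiableAt ℝ (fderiv ℝ f) x :=
    (hf.fderiv_right (m := 1) (by norm_num)).differentiableAt (by norm_num)
  have hs := hf.isSymmSndFDerivAt (by simp)
  have key : ∀ w, fderiv ℝ (fun y => fderiv ℝ f y w) x = (fderiv ℝ (fderiv ℝ f) x).flip w := by
    intro w
    have := (hd.hasFDerivAt.clm_apply (hasFDerivAt_const w x)).fderiv
    rw [this]; ext; simp
  rw [key, key]
  exact hs u v

theorem contDiffAt_fderiv_apply {V : Type*} [NormedAddCommGroup V] [NormedSpace ℝ V]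
    {F : Type*} [NormedAddCommGroup F] [NormedSpace ℝ F] {f : V → F} {x : V}
    (hf : ContDiffAt ℝ ∞ f x) (u : V) : ContDiffAt ℝ ∞ (fun y => fderiv ℝ f y u) x :=
  (hf.fderiv_right (m := ∞) (by simp)).clm_apply contDiffAt_const

variable {m : ℕ}

/-- The entries of the inverse of a differentiable family of invertible matrices are
differentiable. -/
theorem differentiableAt_matrix_inv_apply {V : Type*} [NormedAddCommGroup V] [NormedSpace ℝ V]
    {A : V → Matrix (Fin m) (Fin m) ℝ}
    {x : V} (hA : ∀ i j, DifferentiableAt ℝ (fun y => A y i j) x) (h : (A x).det ≠ 0)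
    (k l : Fin m) : DifferentiableAt ℝ (fun y => (A y)⁻¹ k l) x := by
  have hdet : ∀ B : V → Matrix (Fin m) (Fin m) ℝ,
      (∀ i j, DifferentiableAt ℝ (fun y => B y i j) x) →
      DifferentiableAt ℝ (fun y => (B y).det) x := by
    intro B hB
    simp only [Matrix.det_apply']
    refine DifferentiableAt.fun_sum fun σ _ => DifferentiableAt.const_mul ?_ _
    exact (HasFDerivAt.finsetProd fun i _ => (hB (σ i) i).hasFDerivAt).differentiableAt
  have : (fun y => (A y)⁻¹ k l) =
      fun y => ((A y).det)⁻¹ * ((A y).updateRow l (Pi.single k 1)).det := by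
    ext y
    rw [Matrix.inv_def, Ring.inverse_eq_inv', Matrix.smul_apply, Matrix.adjugate_apply, smul_eq_mul]
  rw [this]
  refine ((hdet A hA).inv h).mul (hdet _ fun i j => ?_)
  by_cases hi : i = l
  · subst hi
    simp
  · simpa [Matrix.updateRow_ne hi] using hA i j

variable {ψ : (Fin m → ℝ) → E} {U : Set (Fin m → ℝ)}

/-- The Gram matrix of the coordinate vector fields of an immersion is invertible. -/
theorem det_inducedMetric_ne_zero {x : Fin m → ℝ} (h : Function.Injective (fderiv ℝ ψ x)) :
    (inducedMetric ψ x).det ≠ 0 := by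
  intro h0
  obtain ⟨c, hc, hmul⟩ := Matrix.exists_mulVec_eq_zero_iff.2 h0
  apply hc
  apply h
  rw [map_zero]
  have hexp : fderiv ℝ ψ x c = ∑ i, c i • fderiv ℝ ψ x (Pi.single i 1) := by
    conv_lhs => rw [pi_eq_sum_univ' c]
    simp [map_sum]
  have h1 : ∀ i, ⟪fderiv ℝ ψ x (Pi.single i 1), fderiv ℝ ψ x c⟫ = 0 := by
    intro i
    have := congrFun hmul i
    simp only [Matrix.mulVec, dotProduct, inducedMetric, Matrix.of_apply, Pi.zero_apply] at this
    rw [hexp, inner_sum]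
    simp only [inner_smul_right]
    rw [← this]
    exact Finset.sum_congr rfl fun j _ => mul_comm _ _
  rw [← inner_self_eq_zero (𝕜 := ℝ)]
  conv_lhs => rw [hexp, sum_inner]
  simp [inner_smul_left, ← hexp, h1]

theorem partialDeriv_inner {i : Fin m} {a b : (Fin m → ℝ) → E} {x : Fin m → ℝ}
    (ha : DifferentiableAt ℝ a x) (hb : DifferentiableAt ℝ b x) :
    partialDeriv i (fun y => ⟪a y, b y⟫) x =
      ⟪a x, fderiv ℝ b x (Pi.single i 1)⟫ + ⟪fderiv ℝ a x (Pi.single i 1), b x⟫ := by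
  rw [partialDeriv, fderiv_inner_apply ℝ ha hb]

theorem christoffel_inducedMetric {x : Fin m → ℝ} (hψ : ContDiffAt ℝ ∞ ψ x) (k i j : Fin m) :
    christoffel (inducedMetric ψ) k i j x = ∑ l, (inducedMetric ψ x)⁻¹ k l *
      ⟪fderiv ℝ (fun y => fderiv ℝ ψ y (Pi.single j 1)) x (Pi.single i 1),
        fderiv ℝ ψ x (Pi.single l 1)⟫ := by
  have hd : ∀ i : Fin m, DifferentiableAt ℝ (fun y => fderiv ℝ ψ y (Pi.single i 1)) x :=
    fun i => (contDiffAt_fderiv_apply hψ _).differentiableAt (by simp)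
  have h2 : ContDiffAt ℝ 2 ψ x := hψ.of_le (WithTop.coe_le_coe.2 (le_top : (2 : ℕ∞) ≤ ⊤))
  unfold christoffel
  rw [Finset.mul_sum]
  refine Finset.sum_congr rfl fun l _ => ?_
  simp only [inducedMetric, Matrix.of_apply]
  rw [partialDeriv_inner (hd _) (hd _), partialDeriv_inner (hd _) (hd _),
    partialDeriv_inner (hd _) (hd _), fderiv_fderiv_apply_comm h2 (Pi.single j 1) (Pi.single i 1),
    fderiv_fderiv_apply_comm h2 (Pi.single l 1) (Pi.single i 1),
    fderiv_fderiv_apply_comm h2 (Pi.single l 1) (Pi.single j 1)]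
  simp only [real_inner_comm]
  ring_nf

theorem sum_inducedMetric_mul_christoffel {x : Fin m → ℝ} (hψ : ContDiffAt ℝ ∞ ψ x)
    (hinj : Function.Injective (fderiv ℝ ψ x)) (r i j : Fin m) :
    ∑ k, inducedMetric ψ x r k * christoffel (inducedMetric ψ) k i j x =
      ⟪fderiv ℝ (fun y => fderiv ℝ ψ y (Pi.single j 1)) x (Pi.single i 1),
        fderiv ℝ ψ x (Pi.single r 1)⟫ := by
  have hinv : inducedMetric ψ x * (inducedMetric ψ x)⁻¹ = 1 :=
    Matrix.mul_nonsing_inv _ (isUnit_iff_ne_zero.2 (det_inducedMetric_ne_zero hinj))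
  simp only [christoffel_inducedMetric hψ, Finset.mul_sum]
  rw [Finset.sum_comm]
  have : ∀ l, ∑ k, inducedMetric ψ x r k * ((inducedMetric ψ x)⁻¹ k l *
      ⟪fderiv ℝ (fun y => fderiv ℝ ψ y (Pi.single j 1)) x (Pi.single i 1),
        fderiv ℝ ψ x (Pi.single l 1)⟫) = (1 : Matrix (Fin m) (Fin m) ℝ) r l *
      ⟪fderiv ℝ (fun y => fderiv ℝ ψ y (Pi.single j 1)) x (Pi.single i 1),
        fderiv ℝ ψ x (Pi.single l 1)⟫ := by
    intro l
    rw [← hinv, Matrix.mul_apply, Finset.sum_mul]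
    exact Finset.sum_congr rfl fun k _ => by ring
  simp only [this, Matrix.one_apply]
  simp

theorem differentiableAt_inducedMetric {x : Fin m → ℝ} (hψ : ContDiffAt ℝ ∞ ψ x) (i j : Fin m) :
    DifferentiableAt ℝ (fun y => inducedMetric ψ y i j) x :=
  ((contDiffAt_fderiv_apply hψ _).differentiableAt (by simp)).inner ℝ
    ((contDiffAt_fderiv_apply hψ _).differentiableAt (by simp))

theorem differentiableAt_christoffel (hU : IsOpen U) (hψ : ∀ x ∈ U, ContDiffAt ℝ ∞ ψ x)
    (hinj : ∀ x ∈ U, Function.Injective (fderiv ℝ ψ x)) {x : Fin m → ℝ} (hx : x ∈ U)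
    (k i j : Fin m) : DifferentiableAt ℝ (christoffel (inducedMetric ψ) k i j) x := by
  have : christoffel (inducedMetric ψ) k i j =ᶠ[nhds x] fun x => ∑ l, (inducedMetric ψ x)⁻¹ k l *
      ⟪fderiv ℝ (fun y => fderiv ℝ ψ y (Pi.single j 1)) x (Pi.single i 1),
        fderiv ℝ ψ x (Pi.single l 1)⟫ := by
    filter_upwards [hU.mem_nhds hx] with y hy
    exact christoffel_inducedMetric (hψ y hy) k i j
  refine DifferentiableAt.congr_of_eventuallyEq ?_ this
  refine DifferentiableAt.fun_sum fun l _ => DifferentiableAt.mul ?_ ?_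
  · exact differentiableAt_matrix_inv_apply (differentiableAt_inducedMetric (hψ x hx))
      (det_inducedMetric_ne_zero (hinj x hx)) k l
  · exact ((contDiffAt_fderiv_apply (contDiffAt_fderiv_apply (hψ x hx) _) _).differentiableAt
      (by simp)).inner ℝ ((contDiffAt_fderiv_apply (hψ x hx) _).differentiableAt (by simp))

/-- The curvature tensor with lowered index, before the normal components of the second
derivatives are separated from the tangential ones. -/
theorem sum_inducedMetric_mul_riemannTensor (hU : IsOpen U)
    (hψ : ∀ x ∈ U, ContDiffAt ℝ ∞ ψ x)
    (hinj : ∀ x ∈ U, Function.Injective (fderiv ℝ ψ x)) {x : Fin m → ℝ} (hx : x ∈ U)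
    {D : Fin m → Fin m → E}
    (hD : ∀ i j, fderiv ℝ (fun y => fderiv ℝ ψ y (Pi.single j 1)) x (Pi.single i 1) = D i j)
    (r k i j : Fin m) :
    ∑ l, inducedMetric ψ x r l * riemannTensor (inducedMetric ψ) l k i j x =
      (⟪D j k, D i r⟫ - ∑ l, christoffel (inducedMetric ψ) l j k x *
          ⟪D i r, fderiv ℝ ψ x (Pi.single l 1)⟫) -
      (⟪D i k, D j r⟫ - ∑ l, christoffel (inducedMetric ψ) l i k x *
          ⟪D j r, fderiv ℝ ψ x (Pi.single l 1)⟫) := by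
  have hlow : ∀ r i j, ∑ k, inducedMetric ψ x r k * christoffel (inducedMetric ψ) k i j x =
      ⟪D i j, fderiv ℝ ψ x (Pi.single r 1)⟫ := fun r i j => by
    rw [sum_inducedMetric_mul_christoffel (hψ x hx) (hinj x hx), hD]
  have hd1 : ∀ i : Fin m, DifferentiableAt ℝ (fun y => fderiv ℝ ψ y (Pi.single i 1)) x :=
    fun i => (contDiffAt_fderiv_apply (hψ x hx) _).differentiableAt (by simp)
  have hd2 : ∀ i j : Fin m, DifferentiableAt ℝ (fun z =>
      fderiv ℝ (fun y => fderiv ℝ ψ y (Pi.single j 1)) z (Pi.single i 1)) x :=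
    fun i j => (contDiffAt_fderiv_apply (contDiffAt_fderiv_apply (hψ x hx) _) _).differentiableAt
      (by simp)
  set T : Fin m → Fin m → Fin m → E := fun i j k => fderiv ℝ (fun z =>
      fderiv ℝ (fun y => fderiv ℝ ψ y (Pi.single k 1)) z (Pi.single j 1)) x (Pi.single i 1) with hT
  have hsymT : ∀ i j k, T i j k = T j i k := fun i j k =>
    fderiv_fderiv_apply_comm ((contDiffAt_fderiv_apply (hψ x hx) _).of_le
      (WithTop.coe_le_coe.2 (le_top : (2 : ℕ∞) ≤ ⊤))) _ _
  -- differentiate the defining relation of the Christoffel symbols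
  have hder : ∀ i j k, ∑ l, (inducedMetric ψ x r l *
        partialDeriv i (christoffel (inducedMetric ψ) l j k) x
        + christoffel (inducedMetric ψ) l j k x *
          (⟪fderiv ℝ ψ x (Pi.single r 1), D i l⟫ + ⟪D i r, fderiv ℝ ψ x (Pi.single l 1)⟫)) =
      ⟪D j k, D i r⟫ + ⟪T i j k, fderiv ℝ ψ x (Pi.single r 1)⟫ := by
    intro i j k
    have hev : (fun y => ∑ l, inducedMetric ψ y r l * christoffel (inducedMetric ψ) l j k y)
        =ᶠ[nhds x] fun y => ⟪fderiv ℝ (fun y => fderiv ℝ ψ y (Pi.single k 1)) y (Pi.single j 1),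
          fderiv ℝ ψ y (Pi.single r 1)⟫ := by
      filter_upwards [hU.mem_nhds hx] with y hy
      exact sum_inducedMetric_mul_christoffel (hψ y hy) (hinj y hy) r j k
    have h := congrArg (fun L : (Fin m → ℝ) →L[ℝ] ℝ => L (Pi.single i 1)) hev.fderiv_eq
    have hr := partialDeriv_inner (i := i) (hd2 j k) (hd1 r)
    rw [partialDeriv] at hr
    simp only [hr, hD] at h
    rw [← h, fderiv_fun_sum
      (A := fun l y => inducedMetric ψ y r l * christoffel (inducedMetric ψ) l j k y)
      fun l _ => (differentiableAt_inducedMetric (hψ x hx) r l).mul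
        (differentiableAt_christoffel hU hψ hinj hx l j k)]
    rw [sum_apply]
    refine Finset.sum_congr rfl fun l _ => ?_
    rw [fderiv_fun_mul (differentiableAt_inducedMetric (hψ x hx) r l)
      (differentiableAt_christoffel hU hψ hinj hx l j k)]
    have hg := partialDeriv_inner (i := i) (hd1 r) (hd1 l)
    simp only [hD] at hg
    simp only [add_apply, smul_apply, smul_eq_mul]
    rw [← hg]
    rfl
  have h1 := hder i j k
  have h3 := hder j i k
  rw [hsymT j i k] at h3
  -- the quadratic terms
  have hq : ∀ i j, ∑ l, inducedMetric ψ x r l * ∑ s, christoffel (inducedMetric ψ) l i s x *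
      christoffel (inducedMetric ψ) s j k x =
      ∑ s, christoffel (inducedMetric ψ) s j k x * ⟪fderiv ℝ ψ x (Pi.single r 1), D i s⟫ := by
    intro i j
    simp only [Finset.mul_sum]
    rw [Finset.sum_comm]
    refine Finset.sum_congr rfl fun s _ => ?_
    rw [real_inner_comm, ← hlow r i s, Finset.mul_sum]
    exact Finset.sum_congr rfl fun l _ => by ring
  have hq1 := hq i j
  have hq2 := hq j i
  simp only [riemannTensor, mul_add, mul_sub, Finset.sum_add_distrib, Finset.sum_sub_distrib]
    at h1 h3 hq1 hq2 ⊢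
  linarith

theorem fderiv_apply_eq_sum (x c : Fin m → ℝ) :
    fderiv ℝ ψ x c = ∑ i, c i • fderiv ℝ ψ x (Pi.single i 1) := by
  conv_lhs => rw [pi_eq_sum_univ' c]
  simp [map_sum]

theorem metricApply_inducedMetric (x u v : Fin m → ℝ) :
    metricApply (inducedMetric ψ) x u v = ⟪fderiv ℝ ψ x u, fderiv ℝ ψ x v⟫ := by
  rw [fderiv_apply_eq_sum x u, fderiv_apply_eq_sum x v, sum_inner]
  simp only [inner_sum, inner_smul_left, inner_smul_right, metricApply, inducedMetric,
    Matrix.of_apply]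
  refine Finset.sum_congr rfl fun i _ => Finset.sum_congr rfl fun j _ => ?_
  simp; ring

theorem fderiv_fderiv_apply_eq_sum {x : Fin m → ℝ} (hψ : ContDiffAt ℝ ∞ ψ x)
    (a b : Fin m → ℝ) :
    fderiv ℝ (fun y => fderiv ℝ ψ y b) x a = ∑ i, ∑ j, (a i * b j) •
      fderiv ℝ (fun y => fderiv ℝ ψ y (Pi.single j 1)) x (Pi.single i 1) := by
  have h : (fun y => fderiv ℝ ψ y b) = fun y => ∑ j, b j • fderiv ℝ ψ y (Pi.single j 1) :=
    funext fun y => fderiv_apply_eq_sum y b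
  have hd : ∀ j : Fin m, DifferentiableAt ℝ (fun y => fderiv ℝ ψ y (Pi.single j 1)) x :=
    fun j => (contDiffAt_fderiv_apply hψ _).differentiableAt (by simp)
  rw [fderiv_apply_eq_sum (ψ := fun y => fderiv ℝ ψ y b) x a]
  refine Finset.sum_congr rfl fun i _ => ?_
  rw [h, fderiv_fun_sum (A := fun j y => b j • fderiv ℝ ψ y (Pi.single j 1))
    fun j _ => (hd j).const_smul _, sum_apply, Finset.smul_sum]
  refine Finset.sum_congr rfl fun j _ => ?_
  rw [fderiv_fun_const_smul (hd j), smul_apply, smul_smul]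

/-- The Gauss equation: if `B` is the normal component of the second derivative of an immersion
`ψ`, the sectional curvature of the induced metric is given by `B`. -/
theorem coordSectionalCurvature_inducedMetric (hU : IsOpen U)
    (hψ : ∀ x ∈ U, ContDiffAt ℝ ∞ ψ x)
    (hinj : ∀ x ∈ U, Function.Injective (fderiv ℝ ψ x)) {x : Fin m → ℝ} (hx : x ∈ U)
    {B : (Fin m → ℝ) → (Fin m → ℝ) → E}
    (hB : ∀ a b, ∃ c, fderiv ℝ (fun y => fderiv ℝ ψ y b) x a = fderiv ℝ ψ x c + B a b)
    (hBn : ∀ a b c, ⟪B a b, fderiv ℝ ψ x c⟫ = 0) (u v : Fin m → ℝ) :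
    coordSectionalCurvature (inducedMetric ψ) x u v =
      (⟪B u u, B v v⟫ - ⟪B u v, B u v⟫) /
        (⟪fderiv ℝ ψ x u, fderiv ℝ ψ x u⟫ * ⟪fderiv ℝ ψ x v, fderiv ℝ ψ x v⟫ -
          ⟪fderiv ℝ ψ x u, fderiv ℝ ψ x v⟫ ^ 2) := by
  have h2 : ContDiffAt ℝ 2 ψ x := (hψ x hx).of_le (WithTop.coe_le_coe.2 (le_top : (2 : ℕ∞) ≤ ⊤))
  set g := inducedMetric ψ with hg
  set d : Fin m → E := fun i => fderiv ℝ ψ x (Pi.single i 1) with hd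
  set D : Fin m → Fin m → E := fun i j =>
    fderiv ℝ (fun y => fderiv ℝ ψ y (Pi.single j 1)) x (Pi.single i 1) with hD
  set H : (Fin m → ℝ) → (Fin m → ℝ) → E := fun a b => fderiv ℝ (fun y => fderiv ℝ ψ y b) x a
  have hH : ∀ a b, H a b = ∑ i, ∑ j, (a i * b j) • D i j := fderiv_fderiv_apply_eq_sum (hψ x hx)
  have hHsym : ∀ a b, H a b = H b a := fun a b => fderiv_fderiv_apply_comm h2 a b
  -- the tangential component of the second derivative
  set t : (Fin m → ℝ) → (Fin m → ℝ) → E := fun a b =>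
    fderiv ℝ ψ x fun l => ∑ i, ∑ j, a i * b j * christoffel g l i j x with ht
  have htd : ∀ a b r, ⟪t a b, d r⟫ = ⟪H a b, d r⟫ := by
    intro a b r
    change ⟪fderiv ℝ ψ x _, d r⟫ = _
    rw [hH, fderiv_apply_eq_sum]
    simp only [sum_inner, inner_smul_left]
    have : ∀ i j, ⟪D i j, d r⟫ = ∑ k, g x r k * christoffel g k i j x := fun i j =>
      (sum_inducedMetric_mul_christoffel (hψ x hx) (hinj x hx) r i j).symm
    simp only [this, RCLike.conj_to_real, Finset.sum_mul, Finset.mul_sum]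
    rw [Finset.sum_comm]
    refine Finset.sum_congr rfl fun i _ => ?_
    rw [Finset.sum_comm]
    refine Finset.sum_congr rfl fun j _ => Finset.sum_congr rfl fun k _ => ?_
    have : g x r k = ⟪d k, d r⟫ := by rw [real_inner_comm]; rfl
    rw [this]; ring
  have hBt : ∀ a b, H a b = t a b + B a b := by
    intro a b
    obtain ⟨c, hc⟩ := hB a b
    set e : Fin m → ℝ := fun l => ∑ i, ∑ j, a i * b j * christoffel g l i j x with he
    have h1 : ∀ r, ⟪fderiv ℝ ψ x (c - e), d r⟫ = 0 := by
      intro r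
      have h3 := htd a b r
      change ⟪fderiv ℝ ψ x e, d r⟫ = _ at h3
      rw [map_sub, inner_sub_left, h3, show H a b = _ from hc, inner_add_left, hBn]
      ring
    have h4 : fderiv ℝ ψ x (c - e) = 0 := by
      rw [← inner_self_eq_zero (𝕜 := ℝ)]
      conv_lhs => rw [fderiv_apply_eq_sum x (c - e), ← fderiv_apply_eq_sum x (c - e)]
      rw [fderiv_apply_eq_sum x (c - e), inner_sum]
      refine Finset.sum_eq_zero fun r _ => ?_
      rw [← fderiv_apply_eq_sum x (c - e), inner_smul_right, h1, mul_zero]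
    rw [map_sub, sub_eq_zero] at h4
    rw [show H a b = _ from hc, h4]
  have hnum : metricApply g x
      (fun l => ∑ k, ∑ i, ∑ j, riemannTensor g l k i j x * u i * v j * v k) u =
      (⟪H v v, H u u⟫ - ⟪H u u, t v v⟫) - (⟪H u v, H v u⟫ - ⟪H v u, t u v⟫) := by
    have hR := sum_inducedMetric_mul_riemannTensor hU hψ hinj hx (D := D) (fun _ _ => rfl)
    have htt : ∀ a b, t a b = ∑ i, ∑ j, (a i * b j) • ∑ l, christoffel g l i j x • d l := by
      intro a b
      change fderiv ℝ ψ x _ = _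
      rw [fderiv_apply_eq_sum]
      simp only [Finset.sum_smul, Finset.smul_sum, smul_smul]
      rw [Finset.sum_comm]
      refine Finset.sum_congr rfl fun i _ => ?_
      rw [Finset.sum_comm]
    have hcon : ∀ (F G : Fin m → Fin m → E) (a b c e : Fin m → ℝ),
        ⟪∑ i, ∑ j, (a i * b j) • F i j, ∑ i, ∑ j, (c i * e j) • G i j⟫ =
        ∑ i, ∑ j, ∑ k, ∑ l, a i * b j * (c k * e l) * ⟪F i j, G k l⟫ := by
      intro F G a b c e
      rw [sum_inner]
      refine Finset.sum_congr rfl fun i _ => ?_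
      rw [sum_inner]
      refine Finset.sum_congr rfl fun j _ => ?_
      rw [inner_sum]
      refine Finset.sum_congr rfl fun k _ => ?_
      rw [inner_sum]
      refine Finset.sum_congr rfl fun l _ => ?_
      rw [inner_smul_left, inner_smul_right, RCLike.conj_to_real]
      ring
    have hfirst : ⟪H v v, H u u⟫ - ⟪H u u, t v v⟫ = ∑ j, ∑ k, ∑ i, ∑ r, v j * v k * (u i * u r) *
        (⟪D j k, D i r⟫ - ∑ l, christoffel g l j k x * ⟪D i r, d l⟫) := by
      rw [real_inner_comm, ← inner_sub_right, ← real_inner_comm, hH v v, htt, hH u u,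
        ← Finset.sum_sub_distrib]
      simp only [← Finset.sum_sub_distrib, ← smul_sub]
      rw [hcon]
      simp only [inner_sub_left, sum_inner, inner_smul_left, RCLike.conj_to_real,
        fun i j l => real_inner_comm (d l) (D i j)]
    have hsecond : ⟪H u v, H v u⟫ - ⟪H v u, t u v⟫ = ∑ i, ∑ k, ∑ j, ∑ r,
        u i * v k * (v j * u r) *
        (⟪D i k, D j r⟫ - ∑ l, christoffel g l i k x * ⟪D j r, d l⟫) := by
      rw [real_inner_comm, ← inner_sub_right, ← real_inner_comm, hH u v, htt, hH v u,
        ← Finset.sum_sub_distrib]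
      simp only [← Finset.sum_sub_distrib, ← smul_sub]
      rw [hcon]
      simp only [inner_sub_left, sum_inner, inner_smul_left, RCLike.conj_to_real,
        fun i j l => real_inner_comm (d l) (D i j)]
    have hleft : metricApply g x
        (fun l => ∑ k, ∑ i, ∑ j, riemannTensor g l k i j x * u i * v j * v k) u =
        ∑ k, ∑ i, ∑ j, ∑ r, u i * v j * v k * u r *
          ∑ l, g x r l * riemannTensor g l k i j x := by
      have hgs : ∀ l r, g x l r = g x r l := fun l r => real_inner_comm _ _
      simp only [metricApply, Finset.mul_sum, Finset.sum_mul]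
      rw [Finset.sum_comm]
      rw [Finset.sum_comm' (t' := Finset.univ) (s' := fun _ => Finset.univ) (by simp)]
      calc _ = ∑ l, ∑ k, ∑ r, ∑ i, ∑ j, g x r l *
              (riemannTensor g l k i j x * u i * v j * v k) * u r := by
            refine Finset.sum_congr rfl fun l _ => ?_
            rw [Finset.sum_comm]
            simp only [hgs l]
        _ = ∑ k, ∑ i, ∑ j, ∑ r, ∑ l, g x r l *
              (riemannTensor g l k i j x * u i * v j * v k) * u r := by
            rw [Finset.sum_comm]
            refine Finset.sum_congr rfl fun k _ => ?_
            calc _ = ∑ l, ∑ i, ∑ j, ∑ r, g x r l *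
                    (riemannTensor g l k i j x * u i * v j * v k) * u r := by
                  refine Finset.sum_congr rfl fun l _ => ?_
                  rw [Finset.sum_comm]
                  exact Finset.sum_congr rfl fun i _ => Finset.sum_comm
              _ = _ := by
                  rw [Finset.sum_comm]
                  refine Finset.sum_congr rfl fun i _ => ?_
                  rw [Finset.sum_comm]
                  exact Finset.sum_congr rfl fun j _ => Finset.sum_comm
        _ = _ := by
            refine Finset.sum_congr rfl fun k _ => Finset.sum_congr rfl fun i _ =>
              Finset.sum_congr rfl fun j _ => Finset.sum_congr rfl fun r _ =>
              Finset.sum_congr rfl fun l _ => by ring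
    rw [hleft, hfirst, hsecond]
    trans ∑ k, ∑ i, ∑ j, ∑ r,
          (u i * v j * v k * u r *
            (⟪D j k, D i r⟫ - ∑ l, christoffel g l j k x * ⟪D i r, d l⟫) -
          u i * v j * v k * u r *
            (⟪D i k, D j r⟫ - ∑ l, christoffel g l i k x * ⟪D j r, d l⟫))
    · refine Finset.sum_congr rfl fun k _ => Finset.sum_congr rfl fun i _ =>
        Finset.sum_congr rfl fun j _ => Finset.sum_congr rfl fun r _ => ?_
      rw [hR, mul_sub]
    simp only [Finset.sum_sub_distrib]
    congr 1
    · calc _ = ∑ k, ∑ j, ∑ i, ∑ r, v j * v k * (u i * u r) *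
            (⟪D j k, D i r⟫ - ∑ l, christoffel g l j k x * ⟪D i r, d l⟫) := by
            refine Finset.sum_congr rfl fun k _ => ?_
            rw [Finset.sum_comm]
            refine Finset.sum_congr rfl fun j _ => Finset.sum_congr rfl fun i _ =>
              Finset.sum_congr rfl fun r _ => by ring
        _ = _ := Finset.sum_comm
    · rw [Finset.sum_comm]
      refine Finset.sum_congr rfl fun k _ => Finset.sum_congr rfl fun j _ =>
        Finset.sum_congr rfl fun i _ => Finset.sum_congr rfl fun r _ => by ring
  rw [coordSectionalCurvature, hnum, hg, metricApply_inducedMetric, metricApply_inducedMetric,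
    metricApply_inducedMetric]
  congr 1
  have hn : ∀ a b c e, ⟪B a b, t c e⟫ = 0 := fun a b c e => hBn a b _
  have hn' : ∀ a b c e, ⟪t c e, B a b⟫ = 0 := fun a b c e => by rw [real_inner_comm]; exact hn a b c e
  rw [hHsym v u]
  simp only [hBt, inner_add_left, inner_add_right, hn, hn']
  rw [real_inner_comm (t v v) (t u u), real_inner_comm (B u u) (B v v)]
  ring

end Gauss

/-! ### Planes -/

section Planes

variable {E F G : Type*} [NormedAddCommGroup E] [InnerProductSpace ℝ E]
  [NormedAddCommGroup F] [InnerProductSpace ℝ F] [NormedAddCommGroup G] [InnerProductSpace ℝ G]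

/-- The image of a plane under a linear isometric embedding. -/
def TwoPlane.map (f : E →ₗᵢ[ℝ] F) (S : TwoPlane E) : TwoPlane F :=
  ⟨S.1.map f.toLinearMap, by
    rw [← (S.1.equivMapOfInjective f.toLinearMap f.injective).finrank_eq]; exact S.2⟩

theorem TwoPlane.map_map (f : E →ₗᵢ[ℝ] F) (g : F →ₗᵢ[ℝ] G) (S : TwoPlane E) :
    (S.map f).map g = S.map (g.comp f) := by
  apply Subtype.ext
  simp only [TwoPlane.map]
  rw [← Submodule.map_comp]
  rfl

theorem TwoPlane.map_id (S : TwoPlane E) : S.map LinearIsometry.id = S := by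
  apply Subtype.ext
  exact Submodule.map_id _

/-- A plane contained in the range of a linear isometric embedding is the image of a plane. -/
theorem TwoPlane.exists_map_eq (f : E →ₗᵢ[ℝ] F) {S : TwoPlane F}
    (h : S.1 ≤ LinearMap.range f.toLinearMap) : ∃ T : TwoPlane E, T.map f = S := by
  have hmap : (S.1.comap f.toLinearMap).map f.toLinearMap = S.1 :=
    Submodule.map_comap_eq_of_le h
  refine ⟨⟨S.1.comap f.toLinearMap, ?_⟩, Subtype.ext hmap⟩
  rw [((S.1.comap f.toLinearMap).equivMapOfInjective f.toLinearMap f.injective).finrank_eq, hmap]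
  exact S.2

theorem TwoPlane.map_le_range (f : E →ₗᵢ[ℝ] F) (T : TwoPlane E) :
    (T.map f).1 ≤ LinearMap.range f.toLinearMap :=
  LinearMap.map_le_range

theorem TwoPlane.range_map (f : E →ₗᵢ[ℝ] F) :
    range (TwoPlane.map f) = {S | S.1 ≤ LinearMap.range f.toLinearMap} := by
  ext S
  exact ⟨fun ⟨T, hT⟩ => hT ▸ T.map_le_range f, fun h => TwoPlane.exists_map_eq f h⟩

/-- The Gram determinant of two vectors. -/
def gramDet (x y : E) : ℝ := ⟪x, x⟫ * ⟪y, y⟫ - ⟪x, y⟫ ^ 2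

theorem gramDet_map (f : E →ₗᵢ[ℝ] F) (x y : E) : gramDet (f x) (f y) = gramDet x y := by
  simp [gramDet, f.inner_map_map]

theorem gramDet_nonneg (x y : E) : 0 ≤ gramDet x y := by
  have := real_inner_mul_inner_self_le x y
  rw [gramDet, sq]; linarith

theorem linearIndependent_of_gramDet_ne_zero {x y : E} (h : gramDet x y ≠ 0) :
    LinearIndependent ℝ ![x, y] := by
  rw [LinearIndependent.pair_iff]
  intro s t hst
  have h1 : s * ⟪x, x⟫ + t * ⟪x, y⟫ = 0 := by
    have := congrArg (fun z => ⟪x, z⟫) hst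
    simpa [inner_add_right, inner_smul_right] using this
  have h2 : s * ⟪x, y⟫ + t * ⟪y, y⟫ = 0 := by
    have := congrArg (fun z => ⟪y, z⟫) hst
    simpa [inner_add_right, inner_smul_right, real_inner_comm] using this
  unfold gramDet at h
  constructor
  · refine (mul_eq_zero.1 (?_ : s * (⟪x, x⟫ * ⟪y, y⟫ - ⟪x, y⟫ ^ 2) = 0)).resolve_right h
    linear_combination ⟪y, y⟫ * h1 - ⟪x, y⟫ * h2
  · refine (mul_eq_zero.1 (?_ : t * (⟪x, x⟫ * ⟪y, y⟫ - ⟪x, y⟫ ^ 2) = 0)).resolve_right h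
    linear_combination ⟪x, x⟫ * h2 - ⟪x, y⟫ * h1

theorem gramDet_ne_zero_of_linearIndependent {x y : E} (h : LinearIndependent ℝ ![x, y]) :
    gramDet x y ≠ 0 := by
  intro h0
  rw [LinearIndependent.pair_iff] at h
  have hz : ⟪y, y⟫ • x + (-⟪x, y⟫) • y = 0 := by
    rw [← inner_self_eq_zero (𝕜 := ℝ)]
    simp only [inner_add_left, inner_add_right, inner_smul_left, inner_smul_right,
      RCLike.conj_to_real, real_inner_comm x y]
    unfold gramDet at h0
    linear_combination ⟪y, y⟫ * h0
  have hy := (h _ _ hz).1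
  rw [inner_self_eq_zero] at hy
  have := (h 0 1 (by simp [hy])).2
  exact one_ne_zero this

theorem range_pair {α : Type*} (x y : α) : range ![x, y] = {x, y} := by
  simp [pair_comm]

theorem finrank_span_pair {x y : E} (h : LinearIndependent ℝ ![x, y]) :
    Module.finrank ℝ (Submodule.span ℝ {x, y}) = 2 := by
  have := finrank_span_eq_card h
  rwa [range_pair, Fintype.card_fin] at this

/-- The plane spanned by two vectors with nonvanishing Gram determinant. -/
def planeSpan (x y : E) (h : gramDet x y ≠ 0) : TwoPlane E :=
  ⟨Submodule.span ℝ {x, y}, finrank_span_pair (linearIndependent_of_gramDet_ne_zero h)⟩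

theorem gramDet_ne_zero_of_finrank_span {x y : E}
    (h : Module.finrank ℝ (Submodule.span ℝ {x, y}) = 2) : gramDet x y ≠ 0 := by
  apply gramDet_ne_zero_of_linearIndependent
  rw [linearIndependent_iff_card_eq_finrank_span]
  rw [Fintype.card_fin, Set.finrank, range_pair, h]

theorem TwoPlane.exists_orthonormal (S : TwoPlane E) :
    ∃ x y : E, ‖x‖ = 1 ∧ ‖y‖ = 1 ∧ ⟪x, y⟫ = 0 ∧ Submodule.span ℝ {x, y} = S.1 := by
  obtain ⟨S, hS⟩ := S
  have : FiniteDimensional ℝ S := Module.finite_of_finrank_pos (by rw [hS]; norm_num)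
  let b := (stdOrthonormalBasis ℝ S).reindex (finCongr hS)
  refine ⟨b 0, b 1, b.norm_eq_one 0, b.norm_eq_one 1, b.inner_eq_zero (by simp), ?_⟩
  have h1 : (Submodule.span ℝ (range b)).map S.subtype = S := by
    rw [← b.coe_toBasis, b.toBasis.span_eq]; simp
  rw [Submodule.map_span, ← range_comp] at h1
  refine Eq.trans ?_ h1
  congr 1
  ext z
  simp [Fin.exists_fin_two, eq_comm]

theorem TwoPlane.exists_planeSpan (S : TwoPlane E) : ∃ x y, ∃ h, S = planeSpan x y h := by
  obtain ⟨x, y, -, -, -, h⟩ := S.exists_orthonormal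
  have h2 : Module.finrank ℝ (Submodule.span ℝ {x, y}) = 2 := by rw [h]; exact S.2
  exact ⟨x, y, gramDet_ne_zero_of_finrank_span h2, Subtype.ext h.symm⟩

theorem planeSpan_map (f : E →ₗᵢ[ℝ] F) {x y : E} (h : gramDet x y ≠ 0) :
    (planeSpan x y h).map f = planeSpan (f x) (f y) (by rwa [gramDet_map]) := by
  apply Subtype.ext
  simp [planeSpan, TwoPlane.map, Submodule.map_span, image_pair]

end Planes

/-! ### Homogeneous submanifolds -/

section Homogeneous

variable {E W : Type*} [NormedAddCommGroup E] [InnerProductSpace ℝ E]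
  [NormedAddCommGroup W] [InnerProductSpace ℝ W]

/-- `M` is an orbit of linear isometries of the ambient space, and `φ` is a smooth parametrization
by the vector space `W` of the relatively open subset `M ∩ O`, with inverse the restriction of the
smooth map `ρ`. The differential of `φ` at `0` is the isometry `ι` and the second differential at
`0` is the form `B`, which is normal to `M`; hence `B` is the second fundamental form. -/
structure HomogeneousChart (M : Set E) (φ : W → E) (ρ : E → W) (O : Set E) (ι : W →ₗᵢ[ℝ] E)
    (B : W →ₗ[ℝ] W →ₗ[ℝ] E) : Prop where
  isOpen : IsOpen O
  contDiff : ContDiff ℝ ∞ φ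
  contDiffOn : ContDiffOn ℝ ∞ ρ O
  mem : ∀ x, φ x ∈ M ∩ O
  left_inv : ∀ x, ρ (φ x) = x
  right_inv : ∀ q ∈ M ∩ O, φ (ρ q) = q
  transitive : ∀ p ∈ M, ∃ g : E ≃ₗᵢ[ℝ] E, g '' M = M ∧ g (φ 0) = p
  fderiv_zero : fderiv ℝ φ 0 = ι.toContinuousLinearMap
  fderiv_fderiv_zero : ∀ u v, fderiv ℝ (fun y => fderiv ℝ φ y v) 0 u = B u v
  normal : ∀ u v w, ⟪B u v, ι w⟫ = 0

variable {M : Set E} {φ : W → E} {ρ : E → W} {O : Set E} {ι : W →ₗᵢ[ℝ] E}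
    {B : W →ₗ[ℝ] W →ₗ[ℝ] E} {m : ℕ}

theorem fderiv_linearIsometryEquiv_comp {V : Type*} [NormedAddCommGroup V] [NormedSpace ℝ V]
    (g : E ≃ₗᵢ[ℝ] E) (ψ : V → E) (x v : V) :
    fderiv ℝ (fun y => g (ψ y)) x v = g (fderiv ℝ ψ x v) := by
  have := g.comp_fderiv (f := ψ) (x := x)
  have h : (fun y => g (ψ y)) = g ∘ ψ := rfl
  rw [h, this]; rfl

theorem inducedMetric_linearIsometryEquiv_comp (g : E ≃ₗᵢ[ℝ] E) (ψ : (Fin m → ℝ) → E) :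
    inducedMetric (fun y => g (ψ y)) = inducedMetric ψ := by
  ext x i j
  simp [inducedMetric, fderiv_linearIsometryEquiv_comp]

theorem symm_image_eq {g : E ≃ₗᵢ[ℝ] E} (hg : g '' M = M) : g.symm '' M = M := by
  conv_lhs => rw [← hg]
  rw [← image_comp]
  simp

theorem IsLocalParametrization.comp_linearIsometryEquiv {p : E} {U : Set (Fin m → ℝ)}
    {ψ : (Fin m → ℝ) → E} (h : IsLocalParametrization m M p U ψ) {g : E ≃ₗᵢ[ℝ] E}
    (hg : g '' M = M) : IsLocalParametrization m M (g p) U fun y => g (ψ y) where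
  isOpen := h.isOpen
  zero_mem := h.zero_mem
  map_zero := by rw [h.map_zero]
  contDiffOn := g.contDiff.comp_contDiffOn h.contDiffOn
  injective_fderiv x hx := by
    intro a b hab
    rw [fderiv_linearIsometryEquiv_comp, fderiv_linearIsometryEquiv_comp] at hab
    exact h.injective_fderiv x hx (g.injective hab)
  isEmbedding := g.toHomeomorph.isEmbedding.comp h.isEmbedding
  image_eq := by
    obtain ⟨O, hO, h1⟩ := h.image_eq
    refine ⟨g '' O, g.toHomeomorph.isOpenMap O hO, ?_⟩
    rw [show (fun y => g (ψ y)) = g ∘ ψ from rfl, image_comp, h1, image_inter g.injective, hg]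

/-- The parametrization and the vectors chosen in the definition of the sectional curvature are
arbitrary, so every admissible choice has to be considered. -/
theorem sectionalCurvature_eq {q : E × TwoPlane E} {s : ℝ}
    (hex : ∃ U ψ u v, IsLocalParametrization m M q.1 U ψ ∧
      Submodule.span ℝ {fderiv ℝ ψ 0 u, fderiv ℝ ψ 0 v} = q.2.1)
    (h : ∀ U ψ u v, IsLocalParametrization m M q.1 U ψ →
      Submodule.span ℝ {fderiv ℝ ψ 0 u, fderiv ℝ ψ 0 v} = q.2.1 →
      coordSectionalCurvature (inducedMetric ψ) 0 u v = s) :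
    sectionalCurvature m M q = s := by
  have h1 : ∃ c : Set (Fin m → ℝ) × ((Fin m → ℝ) → E) × (Fin m → ℝ) × (Fin m → ℝ),
      IsLocalParametrization m M q.1 c.1 c.2.1 ∧
      Submodule.span ℝ {fderiv ℝ c.2.1 0 c.2.2.1, fderiv ℝ c.2.1 0 c.2.2.2} = q.2.1 := by
    obtain ⟨U, ψ, u, v, h2⟩ := hex
    exact ⟨(U, ψ, u, v), h2⟩
  unfold sectionalCurvature
  rw [dif_pos h1]
  exact h _ _ _ _ h1.choose_spec.1 h1.choose_spec.2

/-- The tangent spaces are permuted by the ambient isometries preserving `M`. -/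
theorem tangentSpaceOf_map {g : E ≃ₗᵢ[ℝ] E} (hg : g '' M = M) (p : E) :
    tangentSpaceOf M (g p) = (tangentSpaceOf M p).map g.toLinearIsometry.toLinearMap := by
  have key : ∀ (g : E ≃ₗᵢ[ℝ] E), g '' M = M → ∀ p,
      (tangentSpaceOf M p).map g.toLinearIsometry.toLinearMap ≤ tangentSpaceOf M (g p) := by
    intro g hg p
    rw [tangentSpaceOf, tangentSpaceOf, Submodule.map_span]
    apply Submodule.span_mono
    rintro _ ⟨v, ⟨γ, h1, h2, h3, h4⟩, rfl⟩
    refine ⟨fun t => g (γ t), g.contDiff.comp h1, fun t => ?_, congrArg g h3, ?_⟩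
    · rw [← hg]; exact mem_image_of_mem g (h2 t)
    · rw [← fderiv_apply_one_eq_deriv, fderiv_linearIsometryEquiv_comp, fderiv_apply_one_eq_deriv,
        h4]
      rfl
  refine le_antisymm ?_ (key g hg p)
  have h := key g.symm (symm_image_eq hg) (g p)
  rw [g.symm_apply_apply] at h
  intro v hv
  refine ⟨g.symm v, h ⟨v, hv, rfl⟩, g.apply_symm_apply v⟩

namespace HomogeneousChart

theorem tangentSpaceOf_base (H : HomogeneousChart M φ ρ O ι B) :
    tangentSpaceOf M (φ 0) = LinearMap.range ι.toLinearMap := by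
  have hd : Differentiable ℝ φ := H.contDiff.differentiable (by simp)
  apply le_antisymm
  · rw [tangentSpaceOf, Submodule.span_le]
    rintro v ⟨γ, h1, h2, h3, rfl⟩
    have hO : ∀ᶠ t in nhds (0 : ℝ), γ t ∈ O :=
      h1.continuous.continuousAt.eventually_mem (by rw [h3]; exact H.isOpen.mem_nhds (H.mem 0).2)
    have hγ : γ =ᶠ[nhds 0] fun t => φ (ρ (γ t)) := by
      filter_upwards [hO] with t ht
      exact (H.right_inv _ ⟨h2 t, ht⟩).symm
    have hρ : DifferentiableAt ℝ ρ (γ 0) :=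
      (H.contDiffOn.contDiffAt (H.isOpen.mem_nhds (by rw [h3]; exact (H.mem 0).2))).differentiableAt
        (by simp)
    have hγd : DifferentiableAt ℝ γ 0 := h1.differentiable (by simp) 0
    have hc : HasDerivAt (fun t => φ (ρ (γ t)))
        (fderiv ℝ φ (ρ (γ 0)) (deriv (fun t => ρ (γ t)) 0)) 0 :=
      (hd _).hasFDerivAt.comp_hasDerivAt 0 (hρ.comp (0 : ℝ) hγd).hasDerivAt
    rw [hγ.deriv_eq, hc.deriv, h3, H.left_inv, H.fderiv_zero]
    exact ⟨_, rfl⟩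
  · rintro _ ⟨x, rfl⟩
    refine Submodule.subset_span ⟨fun t => φ (t • x), ?_, fun t => (H.mem _).1, by simp, ?_⟩
    · exact H.contDiff.comp (contDiff_id.smul contDiff_const)
    · have h1 : HasDerivAt (fun t : ℝ => t • x) x 0 := by
        simpa using (hasDerivAt_id (0 : ℝ)).smul_const x
      have h2 := HasFDerivAt.comp_hasDerivAt (0 : ℝ) (f := fun t : ℝ => t • x) (l := φ)
        (hd _).hasFDerivAt h1
      simp only [zero_smul, H.fderiv_zero] at h2
      exact h2.deriv

theorem injective_fderiv (H : HomogeneousChart M φ ρ O ι B) (x : W) : Function.Injective (fderiv ℝ φ x) := by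
  have hρ : DifferentiableAt ℝ ρ (φ x) :=
    (H.contDiffOn.contDiffAt (H.isOpen.mem_nhds (H.mem x).2)).differentiableAt (by simp)
  have h1 : HasFDerivAt (ρ ∘ φ) ((fderiv ℝ ρ (φ x)).comp (fderiv ℝ φ x)) x :=
    hρ.hasFDerivAt.comp x (H.contDiff.differentiable (by simp) x).hasFDerivAt
  have h2 : ρ ∘ φ = id := funext H.left_inv
  rw [h2] at h1
  have h3 := h1.unique (hasFDerivAt_id x)
  intro a b hab
  have : ∀ v, fderiv ℝ ρ (φ x) (fderiv ℝ φ x v) = v := fun v => congrArg (fun L => L v) h3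
  rw [← this a, hab, this]

theorem isLocalParametrization_base (H : HomogeneousChart M φ ρ O ι B)
    (L : (Fin m → ℝ) ≃L[ℝ] W) :
    IsLocalParametrization m M (φ 0) univ fun x => φ (L x) where
  isOpen := isOpen_univ
  zero_mem := mem_univ _
  map_zero := by simp
  contDiffOn := (H.contDiff.comp L.contDiff).contDiffOn
  injective_fderiv x _ := by
    have : fderiv ℝ (fun x => φ (L x)) x = (fderiv ℝ φ (L x)).comp (L : (Fin m → ℝ) →L[ℝ] W) :=
      ((H.contDiff.differentiable (by simp) _).hasFDerivAt.comp x L.hasFDerivAt).fderiv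
    rw [this]
    exact (H.injective_fderiv _).comp L.injective
  isEmbedding := by
    have h1 : Topology.IsEmbedding fun x : W => (⟨φ x, (H.mem x).2⟩ : O) :=
      .of_leftInverse (f := fun q : O => ρ q) (fun x => H.left_inv x)
        H.contDiffOn.continuousOn.domRestrict (H.contDiff.continuous.subtype_mk _)
    exact (Topology.IsEmbedding.subtypeVal.comp h1).comp
      (L.toHomeomorph.isEmbedding.comp .subtypeVal)
  image_eq := by
    refine ⟨O, H.isOpen, ?_⟩
    ext q
    constructor
    · rintro ⟨x, -, rfl⟩
      exact H.mem _
    · intro hq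
      exact ⟨L.symm (ρ q), mem_univ _, by simp [H.right_inv q hq]⟩

theorem isLocalParametrization (H : HomogeneousChart M φ ρ O ι B)
    {g : E ≃ₗᵢ[ℝ] E} (hg : g '' M = M) (L : (Fin m → ℝ) ≃L[ℝ] W) :
    IsLocalParametrization m M (g (φ 0)) univ fun x => g (φ (L x)) :=
  (H.isLocalParametrization_base L).comp_linearIsometryEquiv hg

/-- The sectional curvature, in terms of the second fundamental form `B`, of the plane spanned by
two tangent vectors. -/
def gaussCurvature (B : W →ₗ[ℝ] W →ₗ[ℝ] E) (x y : W) : ℝ :=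
  (⟪B x x, B y y⟫ - ⟪B x y, B x y⟫) / gramDet x y

/-- Second derivatives at the base point are symmetric. -/
theorem symm (H : HomogeneousChart M φ ρ O ι B) (u v : W) : B u v = B v u := by
  rw [← H.fderiv_fderiv_zero, ← H.fderiv_fderiv_zero]
  exact fderiv_fderiv_apply_comm (H.contDiff.contDiffAt.of_le
    (WithTop.coe_le_coe.2 (le_top : (2 : ℕ∞) ≤ ⊤))) u v

/-- The curvature of a plane may be computed in any local parametrization `ψ`, because the
transition map `ρ ∘ ψ` is smooth and changes the second derivatives only by tangent vectors. -/
theorem coordSectionalCurvature_base (H : HomogeneousChart M φ ρ O ι B) [FiniteDimensional ℝ W]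
    (hm : Module.finrank ℝ W = m) {U : Set (Fin m → ℝ)} {ψ : (Fin m → ℝ) → E}
    (h : IsLocalParametrization m M (φ 0) U ψ) :
    ∃ T : (Fin m → ℝ) →L[ℝ] W, (∀ a, fderiv ℝ ψ 0 a = ι (T a)) ∧
      ∀ u v, coordSectionalCurvature (inducedMetric ψ) 0 u v = gaussCurvature B (T u) (T v) := by
  have hψ : ∀ x ∈ U, ContDiffAt ℝ ∞ ψ x := fun x hx =>
    h.contDiffOn.contDiffAt (h.isOpen.mem_nhds hx)
  have hMψ : ∀ x ∈ U, ψ x ∈ M := by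
    intro x hx
    obtain ⟨O', -, h2⟩ := h.image_eq
    exact (h2.subset (mem_image_of_mem ψ hx)).1
  have hV : ∀ᶠ x in nhds (0 : Fin m → ℝ), x ∈ U ∧ ψ x ∈ O := by
    refine (h.isOpen.eventually_mem h.zero_mem).and ?_
    exact (hψ 0 h.zero_mem).continuousAt.eventually_mem
      (by rw [h.map_zero]; exact H.isOpen.mem_nhds (H.mem 0).2)
  set τ : (Fin m → ℝ) → W := fun x => ρ (ψ x) with hτ
  have hτ0 : τ 0 = 0 := by rw [hτ]; simp only [h.map_zero, H.left_inv]
  have hτd : ∀ x, x ∈ U ∧ ψ x ∈ O → ContDiffAt ℝ ∞ τ x := fun x hx =>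
    ContDiffAt.comp x (H.contDiffOn.contDiffAt (H.isOpen.mem_nhds hx.2)) (hψ x hx.1)
  have hφd : Differentiable ℝ φ := H.contDiff.differentiable (by simp)
  have heq : ∀ᶠ x in nhds (0 : Fin m → ℝ), ψ x = φ (τ x) :=
    hV.mono fun x hx => (H.right_inv _ ⟨hMψ x hx.1, hx.2⟩).symm
  have hder : ∀ᶠ x in nhds (0 : Fin m → ℝ), ∀ a,
      fderiv ℝ ψ x a = fderiv ℝ φ (τ x) (fderiv ℝ τ x a) := by
    filter_upwards [hV, heq.eventually_nhds] with x hx hxe a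
    rw [Filter.EventuallyEq.fderiv_eq (f := fun x => φ (τ x)) hxe]
    have := ((hφd (τ x)).hasFDerivAt.comp x ((hτd x hx).differentiableAt (by simp)).hasFDerivAt)
    rw [show (fun x => φ (τ x)) = φ ∘ τ from rfl, this.fderiv]
    rfl
  set T := fderiv ℝ τ 0 with hT
  have hψT : ∀ a, fderiv ℝ ψ 0 a = ι (T a) := by
    intro a
    rw [hder.self_of_nhds a, hτ0, H.fderiv_zero]
    rfl
  have hTsurj : Function.Surjective T := by
    have hinj : Function.Injective (T : (Fin m → ℝ) →ₗ[ℝ] W) := by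
      intro a b hab
      apply h.injective_fderiv 0 h.zero_mem
      rw [hψT, hψT]
      exact congrArg ι hab
    exact (LinearMap.injective_iff_surjective_of_finrank_eq_finrank (by simp [hm])).1 hinj
  refine ⟨T, hψT, fun u v => ?_⟩
  have hsecond : ∀ a b, ∃ c, fderiv ℝ (fun y => fderiv ℝ ψ y b) 0 a =
      fderiv ℝ ψ 0 c + B (T a) (T b) := by
    intro a b
    obtain ⟨c, hc⟩ := hTsurj (fderiv ℝ (fun y => fderiv ℝ τ y b) 0 a)
    refine ⟨c, ?_⟩
    have h1 : (fun y => fderiv ℝ ψ y b) =ᶠ[nhds 0]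
        fun y => fderiv ℝ φ (τ y) (fderiv ℝ τ y b) := hder.mono fun y hy => hy b
    have h0 := hV.self_of_nhds
    have hD : DifferentiableAt ℝ (fderiv ℝ φ) 0 :=
      (H.contDiff.contDiffAt.fderiv_right (m := 1) (by exact WithTop.coe_le_coe.2 le_top)).differentiableAt
        (by norm_num)
    have h2 : HasFDerivAt (fun y => fderiv ℝ φ (τ y)) ((fderiv ℝ (fderiv ℝ φ) 0).comp T) 0 := by
      have h3 : HasFDerivAt (fderiv ℝ φ) (fderiv ℝ (fderiv ℝ φ) 0) (τ 0) := by
        rw [hτ0]; exact hD.hasFDerivAt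
      exact h3.comp 0 ((hτd 0 h0).differentiableAt (by simp)).hasFDerivAt
    have h4 : HasFDerivAt (fun y => fderiv ℝ τ y b) (fderiv ℝ (fun y => fderiv ℝ τ y b) 0) 0 :=
      ((contDiffAt_fderiv_apply (hτd 0 h0) b).differentiableAt (by simp)).hasFDerivAt
    have h5 := (h2.clm_apply h4).fderiv
    have h6 : ∀ w z, fderiv ℝ (fderiv ℝ φ) 0 w z = B w z := by
      intro w z
      rw [← H.fderiv_fderiv_zero, (hD.hasFDerivAt.clm_apply (hasFDerivAt_const z 0)).fderiv]
      simp
    rw [h1.fderiv_eq, h5]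
    simp only [add_apply, ContinuousLinearMap.comp_apply, ContinuousLinearMap.flip_apply, h6, hτ0,
      ← hc, hψT, H.fderiv_zero]
    rfl
  rw [coordSectionalCurvature_inducedMetric h.isOpen hψ h.injective_fderiv h.zero_mem
    (B := fun a b => B (T a) (T b)) hsecond
    (fun a b c => by rw [hψT]; exact H.normal _ _ _)]
  simp only [hψT, ι.inner_map_map, gaussCurvature, gramDet]

/-- The sectional curvature does not depend on the basis of the plane. -/
theorem gaussCurvature_eq_of_span_eq (H : HomogeneousChart M φ ρ O ι B) {x y x' y' : W}
    (h : gramDet x' y' ≠ 0)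
    (hspan : Submodule.span ℝ {x, y} = Submodule.span ℝ {x', y'}) :
    gaussCurvature B x' y' = gaussCurvature B x y := by
  have hx : x' ∈ Submodule.span ℝ {x, y} := hspan ▸ Submodule.subset_span (by simp)
  have hy : y' ∈ Submodule.span ℝ {x, y} := hspan ▸ Submodule.subset_span (by simp)
  obtain ⟨a, b, rfl⟩ := Submodule.mem_span_pair.1 hx
  obtain ⟨c, d, rfl⟩ := Submodule.mem_span_pair.1 hy
  have hgram : gramDet (a • x + b • y) (c • x + d • y) = (a * d - b * c) ^ 2 * gramDet x y := by
    simp only [gramDet, inner_add_left, inner_add_right, inner_smul_left, inner_smul_right,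
      RCLike.conj_to_real, real_inner_comm x y]
    ring
  rw [hgram] at h
  have hdet : (a * d - b * c) ^ 2 ≠ 0 := left_ne_zero_of_mul h
  rw [gaussCurvature, gaussCurvature, hgram]
  have hnum : ⟪B (a • x + b • y) (a • x + b • y), B (c • x + d • y) (c • x + d • y)⟫ -
      ⟪B (a • x + b • y) (c • x + d • y), B (a • x + b • y) (c • x + d • y)⟫ =
      (a * d - b * c) ^ 2 * (⟪B x x, B y y⟫ - ⟪B x y, B x y⟫) := by
    simp only [map_add, map_smul, LinearMap.add_apply, LinearMap.smul_apply, H.symm y x,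
      inner_add_left, inner_add_right, inner_smul_left, inner_smul_right,
      RCLike.conj_to_real, real_inner_comm (B x x) (B y y), real_inner_comm (B x x) (B x y),
      real_inner_comm (B x y) (B y y)]
    ring
  rw [hnum, mul_div_mul_left _ _ hdet]

theorem sectionalCurvature_map (H : HomogeneousChart M φ ρ O ι B) [FiniteDimensional ℝ W]
    (hm : Module.finrank ℝ W = m) {g : E ≃ₗᵢ[ℝ] E} (hg : g '' M = M) {x y : W}
    (h : gramDet x y ≠ 0) :
    sectionalCurvature m M (g (φ 0), ((planeSpan x y h).map ι).map g.toLinearIsometry) =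
      gaussCurvature B x y := by
  have hS : (((planeSpan x y h).map ι).map g.toLinearIsometry).1 =
      Submodule.span ℝ {g (ι x), g (ι y)} := by
    rw [planeSpan_map, planeSpan_map]; rfl
  apply sectionalCurvature_eq
  · have L : (Fin m → ℝ) ≃L[ℝ] W := ContinuousLinearEquiv.ofFinrankEq (by simp [hm])
    refine ⟨univ, fun x => g (φ (L x)), L.symm x, L.symm y, H.isLocalParametrization hg L, ?_⟩
    have hL : ∀ a, fderiv ℝ (fun x => g (φ (L x))) 0 a = g (ι (L a)) := by
      intro a
      rw [fderiv_linearIsometryEquiv_comp g (fun x => φ (L x))]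
      have : HasFDerivAt (φ ∘ L) ((fderiv ℝ φ (L 0)).comp (L : (Fin m → ℝ) →L[ℝ] W)) 0 :=
        ((H.contDiff.differentiable (by simp) _).hasFDerivAt.comp 0 L.hasFDerivAt)
      rw [show (fun x => φ (L x)) = φ ∘ L from rfl, this.fderiv, L.map_zero, H.fderiv_zero]
      rfl
    rw [hL, hL, L.apply_symm_apply, L.apply_symm_apply]
    exact hS.symm
  · intro U ψ u v hψ hspan
    have hψ' : IsLocalParametrization m M (φ 0) U fun y => g.symm (ψ y) := by
      have := hψ.comp_linearIsometryEquiv (symm_image_eq hg)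
      simpa using this
    obtain ⟨T, hT, hK⟩ := H.coordSectionalCurvature_base hm hψ'
    rw [← inducedMetric_linearIsometryEquiv_comp g.symm, hK]
    have hspan' : (Submodule.span ℝ {T u, T v}).map (g.toLinearIsometry.comp ι).toLinearMap =
        (Submodule.span ℝ {x, y}).map (g.toLinearIsometry.comp ι).toLinearMap := by
      have hψT : ∀ a, fderiv ℝ ψ 0 a = g (ι (T a)) := by
        intro a
        rw [← hT, fderiv_linearIsometryEquiv_comp, g.apply_symm_apply]
      simp only [hψT] at hspan
      rw [hS] at hspan
      simpa [Submodule.map_span, image_pair] using hspan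
    have hsp := Submodule.map_injective_of_injective
      (f := (g.toLinearIsometry.comp ι).toLinearMap) (g.toLinearIsometry.comp ι).injective hspan'
    refine H.gaussCurvature_eq_of_span_eq (gramDet_ne_zero_of_finrank_span ?_) hsp.symm
    rw [hsp]
    exact (planeSpan x y h).2

theorem tangentSpaceOf_eq (H : HomogeneousChart M φ ρ O ι B) {g : E ≃ₗᵢ[ℝ] E} (hg : g '' M = M) :
    tangentSpaceOf M (g (φ 0)) = LinearMap.range (g.toLinearIsometry.comp ι).toLinearMap := by
  rw [tangentSpaceOf_map hg, H.tangentSpaceOf_base]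
  exact (LinearMap.range_comp _ _).symm

theorem mem_grassmannBundle (H : HomogeneousChart M φ ρ O ι B) {q : E × TwoPlane E} :
    q ∈ grassmannBundle M ↔ ∃ g : E ≃ₗᵢ[ℝ] E, g '' M = M ∧ ∃ S : TwoPlane W,
      q = (g (φ 0), (S.map ι).map g.toLinearIsometry) := by
  constructor
  · rintro ⟨h1, h2⟩
    obtain ⟨g, hg, hp⟩ := H.transitive _ h1
    rw [← hp, H.tangentSpaceOf_eq hg] at h2
    obtain ⟨S, hS⟩ := TwoPlane.exists_map_eq _ h2
    exact ⟨g, hg, S, Prod.ext hp.symm (by rw [TwoPlane.map_map, hS])⟩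
  · rintro ⟨g, hg, S, rfl⟩
    refine ⟨?_, ?_⟩
    · change g (φ 0) ∈ M
      have : g (φ 0) ∈ g '' M := mem_image_of_mem g (H.mem 0).1
      rwa [hg] at this
    · change ((S.map ι).map g.toLinearIsometry).1 ≤ tangentSpaceOf M (g (φ 0))
      rw [H.tangentSpaceOf_eq hg, TwoPlane.map_map]
      exact TwoPlane.map_le_range _ _

theorem sectionalCurvature_image (H : HomogeneousChart M φ ρ O ι B) [FiniteDimensional ℝ W]
    (hm : Module.finrank ℝ W = m) :
    sectionalCurvature m M '' grassmannBundle M =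
      {s | ∃ x y, gramDet x y ≠ 0 ∧ gaussCurvature B x y = s} := by
  ext s
  constructor
  · rintro ⟨q, hq, rfl⟩
    obtain ⟨g, hg, S, rfl⟩ := H.mem_grassmannBundle.1 hq
    obtain ⟨x, y, h, rfl⟩ := S.exists_planeSpan
    exact ⟨x, y, h, (H.sectionalCurvature_map hm hg h).symm⟩
  · rintro ⟨x, y, h, rfl⟩
    exact ⟨_, H.mem_grassmannBundle.2 ⟨LinearIsometryEquiv.refl ℝ E, by simp, planeSpan x y h, rfl⟩,
      H.sectionalCurvature_map hm (by simp) h⟩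

theorem isCompactSubmanifold (H : HomogeneousChart M φ ρ O ι B) [FiniteDimensional ℝ W]
    (hm : Module.finrank ℝ W = m) (hM : IsCompact M) : IsCompactSubmanifold m M := by
  refine ⟨hM, ⟨_, (H.mem 0).1⟩, fun p hp => ?_⟩
  obtain ⟨g, hg, rfl⟩ := H.transitive p hp
  exact ⟨_, _, H.isLocalParametrization hg (ContinuousLinearEquiv.ofFinrankEq (by simp [hm]))⟩

/-- By homogeneity, it suffices to exhibit the symmetry at the base point. -/
theorem isSymmetricSubmanifold (H : HomogeneousChart M φ ρ O ι B) {σ : E ≃ₗᵢ[ℝ] E}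
    (hσ : σ '' M = M) (h0 : σ (φ 0) = φ 0) (hι : ∀ x, σ (ι x) = -ι x) :
    IsSymmetricSubmanifold M := by
  intro p hp
  obtain ⟨g, hg, rfl⟩ := H.transitive p hp
  refine ⟨(g.symm.trans σ).trans g, ?_, ?_, ?_⟩
  · rw [LinearIsometryEquiv.coe_trans, LinearIsometryEquiv.coe_trans, image_comp, image_comp,
      symm_image_eq hg, hσ, hg]
  · simp [h0]
  · rw [H.tangentSpaceOf_eq hg]
    rintro _ ⟨x, rfl⟩
    simp [hι]

end HomogeneousChart
end Homogeneous

/-! ### The metric geometry of the Grassmannian of planes -/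

section HilbertSchmidt

variable {E F G : Type*} [NormedAddCommGroup E] [InnerProductSpace ℝ E] [FiniteDimensional ℝ E]
  [NormedAddCommGroup F] [InnerProductSpace ℝ F]
  [NormedAddCommGroup G] [InnerProductSpace ℝ G]

/-- The square of the Hilbert--Schmidt norm of a linear map. -/
def hilbertSchmidtSq (A : E →L[ℝ] F) : ℝ := ∑ i, ‖A (stdOrthonormalBasis ℝ E i)‖ ^ 2

theorem hilbertSchmidtSq_isometry_comp (f : F →ₗᵢ[ℝ] G) (A : E →L[ℝ] F) :
    hilbertSchmidtSq (f.toContinuousLinearMap.comp A) = hilbertSchmidtSq A := by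
  simp [hilbertSchmidtSq]

theorem norm_sq_apply_le_hilbertSchmidtSq (A : E →L[ℝ] F) (x : E) :
    ‖A x‖ ^ 2 ≤ hilbertSchmidtSq A * ‖x‖ ^ 2 := by
  set b := stdOrthonormalBasis ℝ E
  have h1 : A x = ∑ i, ⟪b i, x⟫ • A (b i) := by
    conv_lhs => rw [← b.sum_repr' x]
    simp
  have h2 : ‖A x‖ ≤ ∑ i, ‖A (b i)‖ * |⟪b i, x⟫| := by
    rw [h1]
    refine (norm_sum_le _ _).trans (Finset.sum_le_sum fun i _ => ?_)
    rw [norm_smul, Real.norm_eq_abs, mul_comm]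
  calc ‖A x‖ ^ 2 ≤ (∑ i, ‖A (b i)‖ * |⟪b i, x⟫|) ^ 2 := by gcongr
    _ ≤ (∑ i, ‖A (b i)‖ ^ 2) * ∑ i, |⟪b i, x⟫| ^ 2 := Finset.sum_mul_sq_le_sq_mul_sq _ _ _
    _ = hilbertSchmidtSq A * ‖x‖ ^ 2 := by
      rw [← b.sum_sq_norm_inner_right x]
      rfl

variable [FiniteDimensional ℝ F] [FiniteDimensional ℝ G]

theorem hilbertSchmidtSq_adjoint (A : E →L[ℝ] F) :
    hilbertSchmidtSq (ContinuousLinearMap.adjoint A) = hilbertSchmidtSq A := by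
  unfold hilbertSchmidtSq
  have h1 : ∀ i, ‖A (stdOrthonormalBasis ℝ E i)‖ ^ 2 =
      ∑ k, ⟪stdOrthonormalBasis ℝ F k, A (stdOrthonormalBasis ℝ E i)⟫ ^ 2 := fun i => by
    rw [← (stdOrthonormalBasis ℝ F).sum_sq_norm_inner_right]; simp
  have h2 : ∀ k, ‖ContinuousLinearMap.adjoint A (stdOrthonormalBasis ℝ F k)‖ ^ 2 =
      ∑ i, ⟪stdOrthonormalBasis ℝ F k, A (stdOrthonormalBasis ℝ E i)⟫ ^ 2 := fun k => by
    rw [← (stdOrthonormalBasis ℝ E).sum_sq_norm_inner_right]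
    simp [ContinuousLinearMap.adjoint_inner_right, real_inner_comm]
  simp only [h1, h2]
  exact Finset.sum_comm

theorem hilbertSchmidtSq_comp_adjoint (f : E →ₗᵢ[ℝ] G) (A : E →L[ℝ] F) :
    hilbertSchmidtSq (A.comp (ContinuousLinearMap.adjoint f.toContinuousLinearMap)) =
      hilbertSchmidtSq A := by
  rw [← hilbertSchmidtSq_adjoint, ContinuousLinearMap.adjoint_comp,
    ContinuousLinearMap.adjoint_adjoint, hilbertSchmidtSq_isometry_comp, hilbertSchmidtSq_adjoint]

namespace TwoPlane

theorem isometry_projMatrix : Isometry (projMatrix : TwoPlane E → _) := fun _ _ => rfl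

theorem dist_sq (S T : TwoPlane E) :
    dist S T ^ 2 = hilbertSchmidtSq (S.1.starProjection - T.1.starProjection) / 2 := by
  rw [← isometry_projMatrix.dist_eq, EuclideanSpace.dist_eq, Real.sq_sqrt (by positivity),
    Fintype.sum_prod_type_right, hilbertSchmidtSq, Finset.sum_div]
  refine Finset.sum_congr rfl fun j _ => ?_
  rw [← (stdOrthonormalBasis ℝ E).sum_sq_norm_inner_right, Finset.sum_div]
  refine Finset.sum_congr rfl fun i _ => ?_
  simp only [projMatrix, Real.dist_eq, ← mul_sub, ← inner_sub_right]
  rw [sq_abs, mul_pow, inv_pow, Real.sq_sqrt (by norm_num)]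
  simp
  ring

theorem starProjection_map (f : E →ₗᵢ[ℝ] F) (S : TwoPlane E) :
    (S.map f).1.starProjection = f.toContinuousLinearMap.comp
      (S.1.starProjection.comp (ContinuousLinearMap.adjoint f.toContinuousLinearMap)) := by
  ext x
  refine Submodule.eq_starProjection_of_mem_of_inner_eq_zero (K := (S.map f).1) ?_ ?_
  · exact ⟨S.1.starProjection (ContinuousLinearMap.adjoint f.toContinuousLinearMap x),
      S.1.starProjection_apply_mem _, rfl⟩
  · rintro _ ⟨s, hs, rfl⟩
    have h1 : ⟪x, f s⟫ = ⟪ContinuousLinearMap.adjoint f.toContinuousLinearMap x, s⟫ := by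
      rw [ContinuousLinearMap.adjoint_inner_left]; rfl
    have h2 := S.1.starProjection_inner_eq_zero
      (ContinuousLinearMap.adjoint f.toContinuousLinearMap x) s hs
    simp only [ContinuousLinearMap.comp_apply, LinearIsometry.coe_toLinearMap,
      LinearIsometry.coe_toContinuousLinearMap, inner_sub_left, h1, f.inner_map_map] at h2 ⊢
    exact h2

theorem isometry_map (f : E →ₗᵢ[ℝ] F) : Isometry (TwoPlane.map f) := by
  refine Isometry.of_dist_eq fun S T => ?_
  rw [← sq_eq_sq₀ dist_nonneg dist_nonneg, dist_sq, dist_sq, starProjection_map,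
    starProjection_map, ← ContinuousLinearMap.comp_sub, ← ContinuousLinearMap.sub_comp,
    hilbertSchmidtSq_isometry_comp, hilbertSchmidtSq_comp_adjoint]

theorem norm_starProjection_sub_apply_le (S T : TwoPlane E) (x : E) :
    ‖S.1.starProjection x - T.1.starProjection x‖ ≤ 2 * dist S T * ‖x‖ := by
  have h := norm_sq_apply_le_hilbertSchmidtSq (S.1.starProjection - T.1.starProjection) x
  have h2 := dist_sq S T
  have h3 : ‖(S.1.starProjection - T.1.starProjection) x‖ ^ 2 ≤ (2 * dist S T * ‖x‖) ^ 2 := by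
    refine h.trans ?_
    rw [mul_pow, mul_pow, h2]
    nlinarith [sq_nonneg (dist S T), sq_nonneg ‖x‖, mul_nonneg (sq_nonneg (dist S T)) (sq_nonneg ‖x‖)]
  exact abs_le_of_sq_le_sq' h3 (by positivity) |>.2

instance : SecondCountableTopology (TwoPlane E) :=
  isometry_projMatrix.isEmbedding.secondCountableTopology

/-- The linear isometries of `E` act transitively on the planes. -/
theorem exists_map_eq_of_equiv (S T : TwoPlane E) :
    ∃ g : E ≃ₗᵢ[ℝ] E, S.map g.toLinearIsometry = T := by
  have e : S.1 ≃ₗᵢ[ℝ] T.1 := (stdOrthonormalBasis ℝ S.1).equiv (stdOrthonormalBasis ℝ T.1)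
    (finCongr (S.2.trans T.2.symm))
  let L : S.1 →ₗᵢ[ℝ] E := T.1.subtypeₗᵢ.comp e.toLinearIsometry
  refine ⟨L.extend.toLinearIsometryEquiv rfl, Subtype.ext ?_⟩
  change S.1.map L.extend.toLinearMap = T.1
  ext y
  constructor
  · rintro ⟨x, hx, rfl⟩
    have : L.extend x = L ⟨x, hx⟩ := L.extend_apply ⟨x, hx⟩
    change L.extend x ∈ T.1
    rw [this]
    exact (e ⟨x, hx⟩).2
  · intro hy
    refine ⟨e.symm ⟨y, hy⟩, (e.symm ⟨y, hy⟩).2, ?_⟩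
    have := L.extend_apply (e.symm ⟨y, hy⟩)
    refine this.trans ?_
    simp [L]

/-- The Grassmannian is bounded in a finite-dimensional space. -/
theorem totallyBounded_univ : TotallyBounded (univ : Set (TwoPlane E)) := by
  have hb : Bornology.IsBounded (range (projMatrix : TwoPlane E → _)) := by
    refine Metric.isBounded_iff.2 ⟨2 * Module.finrank ℝ E + 1, ?_⟩
    rintro _ ⟨S, rfl⟩ _ ⟨T, rfl⟩
    rw [isometry_projMatrix.dist_eq]
    have h1 := dist_sq S T
    have h2 : hilbertSchmidtSq (S.1.starProjection - T.1.starProjection) ≤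
        ∑ i : Fin (Module.finrank ℝ E), 4 := by
      refine Finset.sum_le_sum fun i _ => ?_
      have h3 : ‖(S.1.starProjection - T.1.starProjection) (stdOrthonormalBasis ℝ E i)‖ ≤ 2 := by
        refine (norm_sub_le _ _).trans ?_
        have h4 := S.1.norm_starProjection_apply_le (stdOrthonormalBasis ℝ E i)
        have h5 := T.1.norm_starProjection_apply_le (stdOrthonormalBasis ℝ E i)
        rw [OrthonormalBasis.norm_eq_one] at h4 h5
        exact (add_le_add h4 h5).trans (by norm_num)
      nlinarith [norm_nonneg ((S.1.starProjection - T.1.starProjection) (stdOrthonormalBasis ℝ E i))]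
    rw [Finset.sum_const, Finset.card_univ, Fintype.card_fin, nsmul_eq_mul] at h2
    nlinarith [dist_nonneg (x := S) (y := T), Nat.cast_nonneg (α := ℝ) (Module.finrank ℝ E)]
  have := totallyBounded_preimage (f := (projMatrix : TwoPlane E → _))
    isometry_projMatrix.isUniformInducing
    (Bornology.IsBounded.isCompact_closure hb |>.totallyBounded.subset subset_closure)
  rwa [preimage_range] at this

end TwoPlane
end HilbertSchmidt

/-! ### The Hausdorff measure of the Grassmannian -/

section HausdorffCharts

variable {X : Type*} [MetricSpace X] [MeasurableSpace X] [BorelSpace X] {ι : Type*} [Fintype ι]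

theorem hausdorffMeasure_image_lt_top {κ : (ι → ℝ) → X} {K : NNReal} {s : Set (ι → ℝ)}
    (hs : Bornology.IsBounded s) (hκ : LipschitzOnWith K κ s) :
    Measure.hausdorffMeasure (Fintype.card ι : ℝ) (κ '' s) < ⊤ := by
  refine (hκ.hausdorffMeasure_image_le (by positivity)).trans_lt ?_
  rw [hausdorffMeasure_pi_real]
  exact ENNReal.mul_lt_top (by simp) hs.measure_lt_top

theorem hausdorffMeasure_image_pos {κ : (ι → ℝ) → X} {K : NNReal} {s : Set (ι → ℝ)}
    (hs : volume s ≠ 0) (hκ : ∀ x ∈ s, ∀ y ∈ s, dist x y ≤ K * dist (κ x) (κ y)) :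
    0 < Measure.hausdorffMeasure (Fintype.card ι : ℝ) (κ '' s) := by
  have hinj : InjOn κ s := by
    intro x hx y hy hxy
    have := hκ x hx y hy
    rw [hxy, dist_self, mul_zero] at this
    exact dist_le_zero.1 this
  have hlip : LipschitzOnWith K (Function.invFunOn κ s) (κ '' s) := by
    refine LipschitzOnWith.of_dist_le_mul ?_
    rintro _ ⟨x, hx, rfl⟩ _ ⟨y, hy, rfl⟩
    rw [hinj.leftInvOn_invFunOn hx, hinj.leftInvOn_invFunOn hy]
    exact hκ x hx y hy
  have h1 := hlip.hausdorffMeasure_image_le (d := Fintype.card ι) (by positivity)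
  rw [hinj.leftInvOn_invFunOn.image_image, hausdorffMeasure_pi_real] at h1
  rw [pos_iff_ne_zero]
  intro h0
  rw [h0, mul_zero] at h1
  exact hs (le_antisymm h1 bot_le)

end HausdorffCharts

section PairProjection

variable {E : Type*} [NormedAddCommGroup E] [InnerProductSpace ℝ E]

/-- The orthogonal projection of `w` to the plane spanned by `u` and `v`. -/
def pairProjection (u v w : E) : E :=
  (gramDet u v)⁻¹ • ((⟪v, v⟫ * ⟪u, w⟫ - ⟪u, v⟫ * ⟪v, w⟫) • u +
    (⟪u, u⟫ * ⟪v, w⟫ - ⟪u, v⟫ * ⟪u, w⟫) • v)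

theorem contDiff_gramDet : ContDiff ℝ ∞ fun p : E × E => gramDet p.1 p.2 :=
  ((contDiff_fst.inner ℝ contDiff_fst).mul (contDiff_snd.inner ℝ contDiff_snd)).sub
    ((contDiff_fst.inner ℝ contDiff_snd).pow 2)

theorem contDiffAt_pairProjection {p : E × E} (h : gramDet p.1 p.2 ≠ 0) (w : E) :
    ContDiffAt ℝ ∞ (fun p : E × E => pairProjection p.1 p.2 w) p := by
  have h11 : ContDiff ℝ ∞ fun p : E × E => ⟪p.1, p.1⟫ := contDiff_fst.inner ℝ contDiff_fst
  have h22 : ContDiff ℝ ∞ fun p : E × E => ⟪p.2, p.2⟫ := contDiff_snd.inner ℝ contDiff_snd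
  have h12 : ContDiff ℝ ∞ fun p : E × E => ⟪p.1, p.2⟫ := contDiff_fst.inner ℝ contDiff_snd
  have h1 : ContDiff ℝ ∞ fun p : E × E => ⟪p.1, w⟫ := contDiff_fst.inner ℝ contDiff_const
  have h2 : ContDiff ℝ ∞ fun p : E × E => ⟪p.2, w⟫ := contDiff_snd.inner ℝ contDiff_const
  refine (contDiff_gramDet.contDiffAt.inv h).smul (ContDiff.contDiffAt ?_)
  exact (((h22.mul h1).sub (h12.mul h2)).smul contDiff_fst).add
    (((h11.mul h2).sub (h12.mul h1)).smul contDiff_snd)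

theorem gramDet_graph_ne_zero {e₁ e₂ a b : E} (h1 : ‖e₁‖ = 1) (h2 : ‖e₂‖ = 1)
    (h12 : ⟪e₁, e₂⟫ = 0) (ha1 : ⟪e₁, a⟫ = 0) (ha2 : ⟪e₂, a⟫ = 0) (hb1 : ⟪e₁, b⟫ = 0)
    (hb2 : ⟪e₂, b⟫ = 0) : gramDet (e₁ + a) (e₂ + b) ≠ 0 := by
  apply gramDet_ne_zero_of_linearIndependent
  rw [LinearIndependent.pair_iff]
  intro s t hst
  have h21 : ⟪e₂, e₁⟫ = 0 := by rw [real_inner_comm, h12]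
  have e1 := congrArg (fun z => ⟪e₁, z⟫) hst
  have e2 := congrArg (fun z => ⟪e₂, z⟫) hst
  simp [inner_add_right, inner_smul_right, h1, h2, h12, ha1, ha2, hb1, hb2, h21] at e1 e2
  exact ⟨e1, e2⟩

variable [FiniteDimensional ℝ E]

theorem starProjection_planeSpan {u v : E} (h : gramDet u v ≠ 0) (w : E) :
    (planeSpan u v h).1.starProjection w = pairProjection u v w := by
  refine Submodule.eq_starProjection_of_mem_of_inner_eq_zero (K := (planeSpan u v h).1) ?_ ?_
  · exact Submodule.smul_mem _ _ (Submodule.add_mem _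
      (Submodule.smul_mem _ _ (Submodule.subset_span (by simp)))
      (Submodule.smul_mem _ _ (Submodule.subset_span (by simp))))
  · intro s hs
    obtain ⟨a, b, rfl⟩ := Submodule.mem_span_pair.1 hs
    simp only [pairProjection, inner_sub_left, inner_smul_left, inner_smul_right, inner_add_left,
      inner_add_right, RCLike.conj_to_real, real_inner_comm u v, real_inner_comm u w,
      real_inner_comm v w]
    have h' : gramDet u v = ⟪u, u⟫ * ⟪v, v⟫ - ⟪u, v⟫ ^ 2 := rfl
    field_simp
    rw [h']
    ring

theorem contDiffAt_projMatrix_planeSpan {V : Type*} [NormedAddCommGroup V] [NormedSpace ℝ V]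
    {u v : V → E} (hu : ContDiff ℝ ∞ u) (hv : ContDiff ℝ ∞ v) (h : ∀ x, gramDet (u x) (v x) ≠ 0)
    (x : V) : ContDiffAt ℝ ∞ (fun x => (planeSpan (u x) (v x) (h x)).projMatrix) x := by
  rw [contDiffAt_euclidean]
  intro ij
  simp only [TwoPlane.projMatrix, starProjection_planeSpan]
  refine contDiffAt_const.mul (contDiffAt_const.inner ℝ ?_)
  exact ContDiffAt.comp x (f := fun x => (u x, v x)) (contDiffAt_pairProjection (h x) _)
    (hu.contDiffAt.prodMk hv.contDiffAt)

theorem continuous_planeSpan :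
    Continuous fun p : {p : E × E // gramDet p.1 p.2 ≠ 0} => planeSpan p.1.1 p.1.2 p.2 := by
  rw [TwoPlane.isometry_projMatrix.isEmbedding.continuous_iff]
  refine (PiLp.continuous_toLp 2 _).comp (continuous_pi fun ij => ?_)
  simp only [starProjection_planeSpan]
  refine continuous_const.mul (continuous_const.inner ?_)
  rw [continuous_iff_continuousAt]
  intro p
  exact ContinuousAt.comp (f := Subtype.val) (contDiffAt_pairProjection p.2 _).continuousAt
    continuous_subtype_val.continuousAt

end PairProjection

section Chart

variable {E : Type*} [NormedAddCommGroup E] [InnerProductSpace ℝ E] [FiniteDimensional ℝ E]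

/-- Near a plane, the planes are the graphs of linear maps to the orthogonal complement; this
parametrization is bilipschitz near the origin. -/
theorem TwoPlane.exists_bilipschitz_chart (S₀ : TwoPlane E) :
    ∃ κ : (Fin 2 × Fin (Module.finrank ℝ E - 2) → ℝ) → TwoPlane E,
      ∃ s ∈ nhds 0, Bornology.IsBounded s ∧ (∃ K, LipschitzOnWith K κ s) ∧
        (∃ K : NNReal, ∀ x ∈ s, ∀ y ∈ s, dist x y ≤ K * dist (κ x) (κ y)) ∧
        κ '' s ∈ nhds S₀ := by
  obtain ⟨e₁, e₂, h1, h2, h12, hspan⟩ := S₀.exists_orthonormal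
  have h21 : ⟪e₂, e₁⟫ = 0 := by rw [real_inner_comm, h12]
  have he1 : e₁ ∈ S₀.1 := hspan ▸ Submodule.subset_span (by simp)
  have he2 : e₂ ∈ S₀.1 := hspan ▸ Submodule.subset_span (by simp)
  set N := S₀.1ᗮ with hN
  have hNfin : Module.finrank ℝ N = Module.finrank ℝ E - 2 := by
    have := S₀.1.finrank_add_finrank_orthogonal
    have h2 := S₀.2
    change Module.finrank ℝ S₀.1 = 2 at h2
    rw [h2] at this
    change Module.finrank ℝ S₀.1ᗮ = _
    omega
  let L : (Fin 2 × Fin (Module.finrank ℝ E - 2) → ℝ) ≃L[ℝ] N × N :=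
    ContinuousLinearEquiv.ofFinrankEq (by
      rw [Module.finrank_prod, hNfin]; simp; ring)
  have hort1 : ∀ a : N, ⟪e₁, (a : E)⟫ = 0 := fun a => a.2 _ he1
  have hort2 : ∀ a : N, ⟪e₂, (a : E)⟫ = 0 := fun a => a.2 _ he2
  have hg : ∀ p : N × N, gramDet (e₁ + (p.1 : E)) (e₂ + (p.2 : E)) ≠ 0 := fun p =>
    gramDet_graph_ne_zero h1 h2 h12 (hort1 _) (hort2 _) (hort1 _) (hort2 _)
  let c : N × N → TwoPlane E := fun p => planeSpan _ _ (hg p)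
  have hc0 : c 0 = S₀ := by
    apply Subtype.ext
    simp [c, planeSpan, hspan]
  -- the chart is smooth, hence Lipschitz near the origin
  have hsm : ∀ x, ContDiffAt ℝ ∞ (fun x => (c (L x)).projMatrix) x := by
    intro x
    refine contDiffAt_projMatrix_planeSpan (u := fun x => e₁ + ((L x).1 : E))
      (v := fun x => e₂ + ((L x).2 : E)) ?_ ?_ (fun x => hg (L x)) x
    · exact contDiff_const.add
        ((N.subtypeL.contDiff.comp contDiff_fst).comp L.contDiff)
    · exact contDiff_const.add
        ((N.subtypeL.contDiff.comp contDiff_snd).comp L.contDiff)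
  obtain ⟨K, t, ht, hlip⟩ := ((hsm 0).of_le (m := 1)
    (WithTop.coe_le_coe.2 le_top)).exists_lipschitzOnWith
  have hlip' : LipschitzOnWith K (fun x => c (L x)) t := fun x hx y hy => by
    rw [← TwoPlane.isometry_projMatrix.edist_eq]; exact hlip hx hy
  -- the chart expands distances
  have hanti : ∀ p q : N × N, ‖p‖ ≤ 1 → ‖q‖ ≤ 1 → dist p q ≤ 20 * dist (c p) (c q) := by
    have key : ∀ (e : E) (p q : N × N) (a a' : N), ‖e‖ = 1 → ‖a‖ ≤ 1 → ‖q‖ ≤ 1 →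
        e + (a : E) ∈ (c p).1 → e + (a' : E) ∈ (c q).1 →
        ‖a - a'‖ ≤ 20 * dist (c p) (c q) := by
      intro e p q a a' he ha hq hp' hq'
      set x : E := e + a with hx
      set y : E := (c q).1.starProjection x with hy
      have hxn : ‖x‖ ≤ 2 := by
        refine (norm_add_le _ _).trans ?_
        rw [he]
        have : ‖(a : E)‖ ≤ 1 := ha
        linarith
      have hδ : ‖x - y‖ ≤ 4 * dist (c p) (c q) := by
        have h3 := TwoPlane.norm_starProjection_sub_apply_le (c p) (c q) x
        rw [Submodule.starProjection_eq_self_iff.2 hp'] at h3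
        refine h3.trans ?_
        nlinarith [dist_nonneg (x := c p) (y := c q)]
      -- the vector `z` is small since it lies in a graph and its components in `S₀` are small
      set z : E := y - (e + a') with hz
      have hzmem : z ∈ (c q).1 := Submodule.sub_mem _ (Submodule.starProjection_apply_mem _ _) hq'
      obtain ⟨s, t, hst⟩ := Submodule.mem_span_pair.1 hzmem
      have hq1 : ‖(q.1 : E)‖ ≤ 1 := (norm_fst_le q).trans hq
      have hq2 : ‖(q.2 : E)‖ ≤ 1 := (norm_snd_le q).trans hq
      have hs : |s| ≤ ‖x - y‖ := by
        have h3 : ⟪e₁, z⟫ = s := by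
          rw [← hst]
          simp [inner_add_right, inner_smul_right, h1, h12, hort1]
        have h4 : ⟪e₁, z⟫ = -⟪e₁, x - y⟫ := by
          rw [hz, hx]
          simp only [inner_sub_right, inner_add_right, hort1]
          ring
        rw [← h3, h4, abs_neg]
        simpa [h1] using abs_real_inner_le_norm e₁ (x - y)
      have ht : |t| ≤ ‖x - y‖ := by
        have h3 : ⟪e₂, z⟫ = t := by
          rw [← hst]
          simp [inner_add_right, inner_smul_right, h2, h21, hort2]
        have h4 : ⟪e₂, z⟫ = -⟪e₂, x - y⟫ := by
          rw [hz, hx]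
          simp only [inner_sub_right, inner_add_right, hort2]
          ring
        rw [← h3, h4, abs_neg]
        simpa [h2] using abs_real_inner_le_norm e₂ (x - y)
      have hzn : ‖z‖ ≤ 4 * ‖x - y‖ := by
        rw [← hst]
        have h3 : ‖e₁ + (q.1 : E)‖ ≤ 2 := (norm_add_le _ _).trans (by rw [h1]; linarith)
        have h4 : ‖e₂ + (q.2 : E)‖ ≤ 2 := (norm_add_le _ _).trans (by rw [h2]; linarith)
        refine (norm_add_le _ _).trans ?_
        rw [norm_smul, norm_smul, Real.norm_eq_abs, Real.norm_eq_abs]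
        have h5 := mul_le_mul hs h3 (norm_nonneg _) (norm_nonneg _)
        have h6 := mul_le_mul ht h4 (norm_nonneg _) (norm_nonneg _)
        linarith
      have haa : ((a - a' : N) : E) = (x - y) + z := by
        rw [hz, hx]; push_cast; abel
      have : ‖a - a'‖ = ‖(x - y) + z‖ := by rw [← haa]; rfl
      rw [this]
      refine (norm_add_le _ _).trans ?_
      linarith
    intro p q hp hq
    have hm1 : ∀ p : N × N, e₁ + (p.1 : E) ∈ (c p).1 := fun p => Submodule.subset_span (by simp)
    have hm2 : ∀ p : N × N, e₂ + (p.2 : E) ∈ (c p).1 := fun p => Submodule.subset_span (by simp)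
    rw [Prod.dist_eq, dist_eq_norm, dist_eq_norm]
    exact max_le (key e₁ p q _ _ h1 ((norm_fst_le p).trans hp) hq (hm1 p) (hm1 q))
      (key e₂ p q _ _ h2 ((norm_snd_le p).trans hp) hq (hm2 p) (hm2 q))
  -- the image of the chart is a neighbourhood
  have hsurj : ∀ ε : ℝ, 0 < ε → ∃ δ > 0, ∀ S : TwoPlane E, dist S S₀ < δ →
      ∃ p, ‖p‖ < ε ∧ c p = S := by
    intro ε hε
    refine ⟨min (1 / 4) (ε / 4), by positivity, fun S hS => ?_⟩
    have hd1 : dist S S₀ < 1 / 4 := hS.trans_le (min_le_left _ _)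
    have hd2 : dist S S₀ < ε / 4 := hS.trans_le (min_le_right _ _)
    have hdiff : ∀ s ∈ S.1, ‖s - S₀.1.starProjection s‖ ≤ 2 * dist S S₀ * ‖s‖ := by
      intro s hs
      have h3 := TwoPlane.norm_starProjection_sub_apply_le S S₀ s
      rwa [Submodule.starProjection_eq_self_iff.2 hs] at h3
    let T : S.1 →ₗ[ℝ] S₀.1 :=
      (S₀.1.orthogonalProjectionOnto : E →ₗ[ℝ] S₀.1).comp S.1.subtype
    have hTv : ∀ s : S.1, ((T s : S₀.1) : E) = S₀.1.starProjection s := fun s => rfl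
    have hTinj : Function.Injective T := by
      rw [← LinearMap.ker_eq_bot, LinearMap.ker_eq_bot']
      intro s hs
      have h3 := hdiff s s.2
      rw [← hTv, hs] at h3
      simp only [ZeroMemClass.coe_zero, sub_zero] at h3
      have h4 : ‖(s : E)‖ = 0 := by nlinarith [norm_nonneg (s : E)]
      exact Subtype.ext (norm_eq_zero.1 h4)
    have hTsurj : Function.Surjective T :=
      (LinearMap.injective_iff_surjective_of_finrank_eq_finrank (S.2.trans S₀.2.symm)).1 hTinj
    have hlift : ∀ e ∈ S₀.1, ‖e‖ = 1 → ∃ a : N, ‖a‖ < ε ∧ e + (a : E) ∈ S.1 := by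
      intro e he hen
      obtain ⟨s, hs⟩ := hTsurj ⟨e, he⟩
      have hs' : S₀.1.starProjection s = e := by rw [← hTv, hs]
      refine ⟨⟨s - e, ?_⟩, ?_, by simp⟩
      · rw [← hs']; exact S₀.1.sub_starProjection_mem_orthogonal _
      · have h3 := hdiff s s.2
        rw [hs'] at h3
        change ‖(s : E) - e‖ < ε
        have h4 : ‖(s : E)‖ ≤ 1 + ‖(s : E) - e‖ := by
          have := norm_add_le e ((s : E) - e)
          rwa [add_sub_cancel, hen] at this
        have h5 : 2 * dist S S₀ * ‖(s : E)‖ ≤ 2 * dist S S₀ * (1 + ‖(s : E) - e‖) :=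
          mul_le_mul_of_nonneg_left h4 (by positivity)
        nlinarith [norm_nonneg ((s : E) - e), dist_nonneg (x := S) (y := S₀)]
    obtain ⟨a, ha, has⟩ := hlift e₁ he1 h1
    obtain ⟨b, hb, hbs⟩ := hlift e₂ he2 h2
    refine ⟨(a, b), max_lt ha hb, Subtype.ext ?_⟩
    have hfin : FiniteDimensional ℝ S.1 := inferInstance
    refine Submodule.eq_of_le_of_finrank_eq (K := ℝ) ?_ ((c (a, b)).2.trans S.2.symm)
    change Submodule.span ℝ _ ≤ _
    rw [Submodule.span_le]
    rintro z (rfl | rfl)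
    · exact has
    · exact hbs
  obtain ⟨ε, hε, hεt⟩ := Metric.mem_nhds_iff.1
    (Filter.inter_mem ht (L.continuous.continuousAt.preimage_mem_nhds
      (by rw [map_zero]; exact Metric.ball_mem_nhds (0 : N × N) one_pos)))
  refine ⟨fun x => c (L x), Metric.ball 0 ε, Metric.ball_mem_nhds _ hε, Metric.isBounded_ball,
    ⟨K, hlip'.mono fun x hx => (hεt hx).1⟩, ?_, ?_⟩
  · refine ⟨‖(L.symm : N × N →L[ℝ] (Fin 2 × Fin (Module.finrank ℝ E - 2) → ℝ))‖₊ * 20, fun x hx y hy => ?_⟩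
    have hx1 : ‖L x‖ ≤ 1 := by have := (hεt hx).2; simp at this; exact this.le
    have hy1 : ‖L y‖ ≤ 1 := by have := (hεt hy).2; simp at this; exact this.le
    have h3 := hanti _ _ hx1 hy1
    have h4 := (L.symm : N × N →L[ℝ] (Fin 2 × Fin (Module.finrank ℝ E - 2) → ℝ)).le_opNorm (L x - L y)
    simp only [map_sub, ContinuousLinearEquiv.coe_coe, L.symm_apply_apply] at h4
    rw [dist_eq_norm]
    refine h4.trans ?_
    rw [← dist_eq_norm, NNReal.coe_mul, mul_assoc]
    exact mul_le_mul_of_nonneg_left h3 (norm_nonneg _)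
  · have hpre : L.symm ⁻¹' Metric.ball 0 ε ∈ nhds (0 : N × N) :=
      L.symm.continuous.continuousAt.preimage_mem_nhds
        (by rw [map_zero]; exact Metric.ball_mem_nhds _ hε)
    obtain ⟨η, hη, hball⟩ := Metric.mem_nhds_iff.1 hpre
    obtain ⟨δ, hδ, hS⟩ := hsurj η hη
    refine Metric.mem_nhds_iff.2 ⟨δ, hδ, fun S hSδ => ?_⟩
    obtain ⟨p, hp, rfl⟩ := hS S hSδ
    exact ⟨L.symm p, hball (by simpa using hp), by simp⟩

end Chart

/-! ### Uniformly distributed measures -/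

section Uniform

open Filter Topology

variable {X : Type*} [MetricSpace X] [SecondCountableTopology X] [MeasurableSpace X]

/-- Countably many balls of a given radius cover the space, and all have the same measure. -/
theorem measure_ball_pos_of_uniform {μ : Measure X}
    (hμ : ∀ x y r, μ (Metric.ball x r) = μ (Metric.ball y r)) (h0 : μ ≠ 0) (x : X) {r : ℝ}
    (hr : 0 < r) : 0 < μ (Metric.ball x r) := by
  rw [pos_iff_ne_zero]
  intro h
  apply h0
  rw [← Measure.measure_univ_eq_zero]
  obtain ⟨s, hs, hcov⟩ := TopologicalSpace.countable_cover_nhds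
    (fun y : X => Metric.ball_mem_nhds y hr)
  rw [← hcov, measure_biUnion_null_iff hs]
  exact fun y _ => (hμ y x r).trans h

variable [BorelSpace X]

/-- Fatou's lemma and Tonelli's theorem compare two measures on an open set `U` through the masses
of small balls. -/
theorem measure_le_mul_of_tendsto_ball_div {μ ν : Measure X} [IsFiniteMeasure μ]
    [IsFiniteMeasure ν]
    (hμ : ∀ x y r, μ (Metric.ball x r) = μ (Metric.ball y r))
    (hν : ∀ x y r, ν (Metric.ball x r) = ν (Metric.ball y r)) (hν0 : ν ≠ 0) (x₀ : X)
    {r : ℕ → ℝ} (hr : ∀ n, 0 < r n) (hr0 : Tendsto r atTop (𝓝 0)) {c : ENNReal}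
    (hc : Tendsto (fun n => μ (Metric.ball x₀ (r n)) / ν (Metric.ball x₀ (r n))) atTop (𝓝 c))
    {U : Set X} (hU : IsOpen U) : μ U ≤ c * ν U := by
  have hmeas : ∀ r, MeasurableSet {p : X × X | dist p.1 p.2 < r} := fun r =>
    (isOpen_lt (continuous_fst.dist continuous_snd) continuous_const).measurableSet
  have hball : ∀ (x : X) r, Prod.mk x ⁻¹' {p : X × X | dist p.1 p.2 < r} = Metric.ball x r := by
    intro x r; ext y; simp [dist_comm]
  have hball' : ∀ (y : X) r, (fun x => (x, y)) ⁻¹' {p : X × X | dist p.1 p.2 < r} =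
      Metric.ball y r := by
    intro x r; ext y; simp
  have hmeasF : ∀ r, Measurable fun x => (ν.restrict U) (Metric.ball x r) := by
    intro r
    simp only [← hball]
    exact measurable_measure_prodMk_left (hmeas r)
  have hswap : ∀ r, ∫⁻ x in U, (ν.restrict U) (Metric.ball x r) ∂μ ≤
      μ (Metric.ball x₀ r) * ν U := by
    intro r
    calc ∫⁻ x in U, (ν.restrict U) (Metric.ball x r) ∂μ
        = ((μ.restrict U).prod (ν.restrict U)) {p : X × X | dist p.1 p.2 < r} := by
          rw [Measure.prod_apply (hmeas r)]; simp only [hball]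
      _ = ∫⁻ y in U, (μ.restrict U) (Metric.ball y r) ∂ν := by
          rw [Measure.prod_apply_symm (hmeas r)]; simp only [hball']
      _ ≤ ∫⁻ y in U, μ (Metric.ball x₀ r) ∂ν := by
          refine lintegral_mono fun y => ?_
          exact (Measure.restrict_apply_le _ _).trans (hμ _ _ _).le
      _ = _ := by simp
  calc μ U = ∫⁻ x in U, 1 ∂μ := by simp
    _ ≤ ∫⁻ x in U, liminf (fun n => (ν.restrict U) (Metric.ball x (r n)) /
          ν (Metric.ball x₀ (r n))) atTop ∂μ := by
        refine setLIntegral_mono_ae' hU.measurableSet (ae_of_all _ fun x hx => ?_)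
        refine le_liminf_of_le (by isBoundedDefault) ?_
        obtain ⟨ε, hε, hsub⟩ := Metric.isOpen_iff.1 hU x hx
        filter_upwards [hr0.eventually (gt_mem_nhds hε)] with n hn
        have h1 : Metric.ball x (r n) ⊆ U := (Metric.ball_subset_ball hn.le).trans hsub
        rw [Measure.restrict_apply Metric.isOpen_ball.measurableSet, inter_eq_left.2 h1,
          hν x x₀, ENNReal.div_self (measure_ball_pos_of_uniform hν hν0 _ (hr n)).ne'
            (measure_ne_top _ _)]
    _ ≤ liminf (fun n => ∫⁻ x in U, (ν.restrict U) (Metric.ball x (r n)) /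
          ν (Metric.ball x₀ (r n)) ∂μ) atTop :=
        lintegral_liminf_le fun n => (hmeasF _).div_const _
    _ ≤ liminf (fun n => μ (Metric.ball x₀ (r n)) / ν (Metric.ball x₀ (r n)) * ν U) atTop := by
        refine liminf_le_liminf (Eventually.of_forall fun n => ?_) (by isBoundedDefault)
          (by isBoundedDefault)
        simp only [div_eq_mul_inv]
        rw [lintegral_mul_const _ (hmeasF _)]
        calc _ ≤ μ (Metric.ball x₀ (r n)) * ν U * (ν (Metric.ball x₀ (r n)))⁻¹ := by
              gcongr; exact hswap _
          _ = _ := by ring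
    _ = c * ν U := (ENNReal.Tendsto.mul_const hc (Or.inr (measure_ne_top _ _))).liminf_eq

/-- Two finite nonzero measures for which the mass of a ball depends only on its radius are
proportional (Christensen). -/
theorem exists_eq_smul_of_uniform {μ ν : Measure X} [IsFiniteMeasure μ] [IsFiniteMeasure ν]
    (hμ : ∀ x y r, μ (Metric.ball x r) = μ (Metric.ball y r))
    (hν : ∀ x y r, ν (Metric.ball x r) = ν (Metric.ball y r)) (hμ0 : μ ≠ 0) (hν0 : ν ≠ 0) :
    ∃ c : ENNReal, c ≠ 0 ∧ c ≠ ⊤ ∧ μ = c • ν := by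
  have hne : Nonempty X := by
    by_contra h
    rw [not_nonempty_iff] at h
    exact hμ0 (Measure.eq_zero_of_isEmpty μ)
  obtain ⟨x₀⟩ := hne
  obtain ⟨c, -, φ, hφ, hc⟩ := isCompact_univ.tendsto_subseq (x := fun n : ℕ =>
    μ (Metric.ball x₀ (1 / ((n : ℝ) + 1))) / ν (Metric.ball x₀ (1 / ((n : ℝ) + 1))))
    (fun n => mem_univ _)
  set r : ℕ → ℝ := fun n => 1 / ((φ n : ℝ) + 1) with hrdef
  have hr : ∀ n, 0 < r n := fun n => by positivity
  have hr0 : Tendsto r atTop (𝓝 0) :=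
    tendsto_one_div_add_atTop_nhds_zero_nat.comp hφ.tendsto_atTop
  have hc1 : Tendsto (fun n => μ (Metric.ball x₀ (r n)) / ν (Metric.ball x₀ (r n))) atTop (𝓝 c) :=
    hc
  have hc2 : Tendsto (fun n => ν (Metric.ball x₀ (r n)) / μ (Metric.ball x₀ (r n))) atTop
      (𝓝 c⁻¹) := by
    refine (tendsto_inv_iff.2 hc1).congr fun n => ?_
    exact ENNReal.inv_div (Or.inl (measure_ne_top _ _))
      (Or.inl (measure_ball_pos_of_uniform hν hν0 _ (hr n)).ne')
  have h1 : ∀ U, IsOpen U → μ U ≤ c * ν U := fun U hU =>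
    measure_le_mul_of_tendsto_ball_div hμ hν hν0 x₀ hr hr0 hc1 hU
  have h2 : ∀ U, IsOpen U → ν U ≤ c⁻¹ * μ U := fun U hU =>
    measure_le_mul_of_tendsto_ball_div hν hμ hμ0 x₀ hr hr0 hc2 hU
  have hc0 : c ≠ 0 := by
    rintro rfl
    have := h1 univ isOpen_univ
    rw [zero_mul] at this
    exact hμ0 (Measure.measure_univ_eq_zero.1 (le_antisymm this bot_le))
  have hct : c ≠ ⊤ := by
    rintro rfl
    have := h2 univ isOpen_univ
    rw [ENNReal.inv_top, zero_mul] at this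
    exact hν0 (Measure.measure_univ_eq_zero.1 (le_antisymm this bot_le))
  have h3 : ∀ U, IsOpen U → μ U = (c • ν) U := by
    intro U hU
    refine le_antisymm (h1 U hU) ?_
    rw [Measure.smul_apply, smul_eq_mul]
    calc c * ν U ≤ c * (c⁻¹ * μ U) := by gcongr; exact h2 U hU
      _ = μ U := by rw [← mul_assoc, ENNReal.mul_inv_cancel hc0 hct, one_mul]
  refine ⟨c, hc0, hct, ?_⟩
  exact ext_of_generate_finite _ (BorelSpace.measurable_eq (α := X)) isPiSystem_isOpen h3
    (h3 _ isOpen_univ)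

end Uniform

/-! ### The invariant measure on the Grassmannian -/

section Invariant

variable {E : Type*} [NormedAddCommGroup E] [InnerProductSpace ℝ E]

theorem TwoPlane.map_surjective (g : E ≃ₗᵢ[ℝ] E) :
    Function.Surjective (TwoPlane.map g.toLinearIsometry) := by
  intro S
  refine ⟨S.map g.symm.toLinearIsometry, ?_⟩
  rw [TwoPlane.map_map]
  convert S.map_id
  ext x
  simp

variable [FiniteDimensional ℝ E]

theorem TwoPlane.nonempty (h : 2 ≤ Module.finrank ℝ E) : Nonempty (TwoPlane E) := by
  have b := stdOrthonormalBasis ℝ E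
  refine ⟨planeSpan (b ⟨0, by omega⟩) (b ⟨1, by omega⟩) ?_⟩
  simp [gramDet]

theorem TwoPlane.image_ball (g : E ≃ₗᵢ[ℝ] E) (S : TwoPlane E) (r : ℝ) :
    TwoPlane.map g.toLinearIsometry '' Metric.ball S r =
      Metric.ball (S.map g.toLinearIsometry) r := by
  ext T
  constructor
  · rintro ⟨S', h, rfl⟩
    rwa [Metric.mem_ball, (TwoPlane.isometry_map _).dist_eq]
  · intro h
    obtain ⟨S', rfl⟩ := TwoPlane.map_surjective g T
    rw [Metric.mem_ball, (TwoPlane.isometry_map _).dist_eq] at h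
    exact ⟨S', h, rfl⟩

theorem TwoPlane.hausdorffMeasure_ball_eq (d : ℝ) (S T : TwoPlane E) (r : ℝ) :
    Measure.hausdorffMeasure d (Metric.ball S r) = Measure.hausdorffMeasure d (Metric.ball T r) := by
  obtain ⟨g, rfl⟩ := TwoPlane.exists_map_eq_of_equiv S T
  rw [← TwoPlane.image_ball, (TwoPlane.isometry_map _).hausdorffMeasure_image
    (Or.inr (TwoPlane.map_surjective g))]

/-- The Grassmannian has finite positive Hausdorff measure in its dimension. -/
theorem TwoPlane.hausdorffMeasure_univ (h : 2 ≤ Module.finrank ℝ E) :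
    0 < Measure.hausdorffMeasure (2 * ((Module.finrank ℝ E : ℝ) - 2)) (univ : Set (TwoPlane E)) ∧
    Measure.hausdorffMeasure (2 * ((Module.finrank ℝ E : ℝ) - 2)) (univ : Set (TwoPlane E)) < ⊤ := by
  obtain ⟨S₀⟩ := TwoPlane.nonempty h
  obtain ⟨κ, s, hs, hsb, ⟨K, hK⟩, ⟨K', hK'⟩, hκ⟩ := S₀.exists_bilipschitz_chart
  have hd : (Fintype.card (Fin 2 × Fin (Module.finrank ℝ E - 2)) : ℝ) =
      2 * ((Module.finrank ℝ E : ℝ) - 2) := by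
    simp [Nat.cast_sub h]
  have hpos := hausdorffMeasure_image_pos
    (Measure.measure_pos_of_mem_nhds volume hs).ne' hK'
  have hfin := hausdorffMeasure_image_lt_top hsb hK
  rw [hd] at hpos hfin
  refine ⟨hpos.trans_le (measure_mono (subset_univ _)), ?_⟩
  obtain ⟨ε, hε, hball⟩ := Metric.mem_nhds_iff.1 hκ
  obtain ⟨t, ht, hcov⟩ := Metric.totallyBounded_iff.1 (TwoPlane.totallyBounded_univ (E := E)) ε hε
  refine (measure_mono hcov).trans_lt ?_
  rw [← ht.coe_toFinset]
  refine (measure_biUnion_finset_le _ _).trans_lt (ENNReal.sum_lt_top.2 fun S _ => ?_)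
  rw [TwoPlane.hausdorffMeasure_ball_eq _ S S₀]
  exact (measure_mono hball).trans_lt hfin

end Invariant

/-! ### The beta law of the projection of a Gaussian vector -/

section Beta

/-- The density of the beta distribution with parameters `a / 2` and `b / 2`, not normalized. -/
def betaDensity (a b : ℕ) (t : ℝ) : ENNReal :=
  ENNReal.ofReal (t ^ ((a : ℝ) / 2 - 1) * (1 - t) ^ ((b : ℝ) / 2 - 1))

theorem measurable_betaDensity (a b : ℕ) : Measurable (betaDensity a b) := by
  unfold betaDensity
  fun_prop

theorem setLIntegral_Ioi_eq_mul_left {r : ℝ} (hr : 0 < r) (h : ℝ → ENNReal) :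
    ∫⁻ s in Ioi (0 : ℝ), h s = ∫⁻ w in Ioi (0 : ℝ), ENNReal.ofReal r * h (r * w) := by
  have himg : (fun w => r * w) '' Ioi 0 = Ioi 0 := by
    rw [Set.image_mul_left_Ioi hr, mul_zero]
  conv_lhs => rw [← himg]
  rw [lintegral_image_eq_lintegral_abs_deriv_mul measurableSet_Ioi (f' := fun _ => r)
    (fun x _ => by simpa using ((hasDerivAt_id x).const_mul r).hasDerivWithinAt)
    (fun x _ y _ hxy => mul_left_cancel₀ hr.ne' hxy)]
  simp [abs_of_pos hr]

theorem image_inv_one_add_sq : (fun w : ℝ => (1 + w ^ 2)⁻¹) '' Ioi 0 = Ioo 0 1 := by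
  ext t
  constructor
  · rintro ⟨w, hw, rfl⟩
    have hw' : 0 < w := hw
    exact ⟨by positivity, inv_lt_one_of_one_lt₀ (by nlinarith)⟩
  · rintro ⟨h0, h1⟩
    have h2 : 0 < t⁻¹ - 1 := by
      rw [sub_pos]; exact (one_lt_inv₀ h0).2 h1
    refine ⟨√(t⁻¹ - 1), Real.sqrt_pos.2 h2, ?_⟩
    simp only
    rw [Real.sq_sqrt h2.le]
    simp

/-- The substitution `t = 1 / (1 + w²)`. -/
theorem setLIntegral_betaDensity_mul {a b : ℕ} (hb : 0 < b) (f : ℝ → ENNReal) :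
    ∫⁻ t in Ioo (0 : ℝ) 1, betaDensity a b t * f t =
      2 * ∫⁻ w in Ioi (0 : ℝ), ENNReal.ofReal (w ^ (b - 1) *
        (1 + w ^ 2) ^ (-((a + b : ℝ) / 2))) * f (1 + w ^ 2)⁻¹ := by
  rw [← image_inv_one_add_sq, lintegral_image_eq_lintegral_abs_deriv_mul measurableSet_Ioi
    (f' := fun w => -(2 * w) / (1 + w ^ 2) ^ 2), ← lintegral_const_mul' _ _ (by simp)]
  · refine setLIntegral_congr_fun measurableSet_Ioi fun w hw => ?_
    have hw' : 0 < w := hw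
    have hw1 : 0 < 1 + w ^ 2 := by positivity
    simp only [betaDensity]
    rw [← mul_assoc, ← mul_assoc, ← ENNReal.ofReal_mul (by positivity)]
    congr 1
    rw [show (2 : ENNReal) = ENNReal.ofReal 2 by simp, ← ENNReal.ofReal_mul (by norm_num)]
    congr 1
    have h1 : |-(2 * w) / (1 + w ^ 2) ^ 2| = 2 * w / (1 + w ^ 2) ^ 2 := by
      rw [neg_div, abs_neg, abs_of_pos (by positivity)]
    have h2 : 1 - (1 + w ^ 2)⁻¹ = w ^ 2 * (1 + w ^ 2)⁻¹ := by field_simp; ring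
    rw [h1, h2, Real.mul_rpow (by positivity) (by positivity), Real.inv_rpow hw1.le,
      Real.inv_rpow hw1.le, ← Real.rpow_neg hw1.le, ← Real.rpow_neg hw1.le,
      ← Real.rpow_natCast_mul hw'.le, ← Real.rpow_natCast w (b - 1), Nat.cast_sub hb]
    have h3 : 2 * w / (1 + w ^ 2) ^ 2 = 2 * w ^ (1 : ℝ) * (1 + w ^ 2) ^ (-2 : ℝ) := by
      rw [Real.rpow_one, Real.rpow_neg hw1.le, div_eq_mul_inv]
      norm_cast
    rw [h3]
    have h4 : w ^ ((b : ℝ) - (1 : ℕ)) = w ^ (1 : ℝ) * w ^ ((2 : ℕ) * ((b : ℝ) / 2 - 1)) := by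
      rw [← Real.rpow_add hw']; congr 1; push_cast; ring
    have h5 : (1 + w ^ 2) ^ (-((a + b : ℝ) / 2)) = (1 + w ^ 2) ^ (-2 : ℝ) *
        (1 + w ^ 2) ^ (-((a : ℝ) / 2 - 1)) * (1 + w ^ 2) ^ (-((b : ℝ) / 2 - 1)) := by
      rw [← Real.rpow_add hw1, ← Real.rpow_add hw1]; congr 1; ring
    rw [h4, h5]
    ring
  · intro w hw
    have hw1 : (1 + w ^ 2) ≠ 0 := by positivity
    have h := (((hasDerivAt_id w).pow 2).const_add 1).inv hw1
    refine (h.congr_deriv ?_).hasDerivWithinAt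
    simp
  · intro x hx y hy hxy
    have hx' : 0 < x := hx
    have hy' : 0 < y := hy
    have := inv_injective hxy
    nlinarith

/-- The moment of the Gaussian weight that appears when the radius is integrated out. -/
def gaussianMoment (n : ℕ) : ENNReal := ∫⁻ r in Ioi (0 : ℝ), ENNReal.ofReal (r ^ n * Real.exp (-r ^ 2))

theorem gaussianMoment_ne_top (n : ℕ) : gaussianMoment n ≠ ⊤ := by
  have h := integrableOn_rpow_mul_exp_neg_mul_sq one_pos (s := n) (by
    have : (0 : ℝ) ≤ n := n.cast_nonneg
    linarith)
  have := h.lintegral_lt_top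
  refine (lt_of_le_of_lt (le_of_eq ?_) this).ne
  exact lintegral_congr fun r => by simp

theorem gaussianMoment_ne_zero (n : ℕ) : gaussianMoment n ≠ 0 := by
  unfold gaussianMoment
  rw [← pos_iff_ne_zero, setLIntegral_pos_iff (by fun_prop)]
  have : Function.support (fun r : ℝ => ENNReal.ofReal (r ^ n * Real.exp (-r ^ 2))) ∩ Ioi 0 =
      Ioi 0 := by
    refine inter_eq_right.2 fun r hr => ?_
    have hr' : 0 < r := hr
    simp only [Function.mem_support, ne_eq, ENNReal.ofReal_eq_zero, not_le]
    positivity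
  rw [this]
  simp

theorem setLIntegral_gaussian_scale (n : ℕ) {w : ℝ} (hw : 0 < w) :
    ∫⁻ r in Ioi (0 : ℝ), ENNReal.ofReal (r ^ n * Real.exp (-(r ^ 2 * w))) =
      ENNReal.ofReal (w ^ (-((n + 1 : ℝ) / 2))) * gaussianMoment n := by
  have hs : 0 < w ^ (-(1 / 2 : ℝ)) := by positivity
  rw [setLIntegral_Ioi_eq_mul_left hs, gaussianMoment, ← lintegral_const_mul' _ _ (by simp)]
  refine setLIntegral_congr_fun measurableSet_Ioi fun r hr => ?_
  have hr' : 0 < r := hr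
  rw [← ENNReal.ofReal_mul hs.le, ← ENNReal.ofReal_mul (by positivity)]
  congr 1
  have h1 : (w ^ (-(1 / 2 : ℝ)) * r) ^ 2 * w = r ^ 2 := by
    rw [mul_pow, ← Real.rpow_mul_natCast hw.le]
    norm_num
    rw [Real.rpow_neg_one]
    field_simp
  rw [h1, mul_pow, ← Real.rpow_mul_natCast hw.le]
  have h2 : w ^ (-((n + 1 : ℝ) / 2)) = w ^ (-(1 / 2 : ℝ)) * w ^ (-(1 / 2) * (n : ℝ)) := by
    rw [← Real.rpow_add hw]; congr 1; ring
  rw [h2]; ring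

/-- For independent radii `r` and `s` of Gaussian vectors in dimensions `a` and `b`, the quotient
`r² / (r² + s²)` has the beta distribution; the substitution `s = r w` separates the variables. -/
theorem lintegral_radial_quotient {a b : ℕ} (ha : 0 < a) (hb : 0 < b) {f : ℝ → ENNReal}
    (hf : Measurable f) :
    ∫⁻ r in Ioi (0 : ℝ), ENNReal.ofReal (r ^ (a - 1) * Real.exp (-r ^ 2)) *
      ∫⁻ s in Ioi (0 : ℝ), ENNReal.ofReal (s ^ (b - 1) * Real.exp (-s ^ 2)) *
        f (r ^ 2 / (r ^ 2 + s ^ 2)) =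
      gaussianMoment (a + b - 1) / 2 * ∫⁻ t in Ioo (0 : ℝ) 1, betaDensity a b t * f t := by
  have h1 : ∀ r ∈ Ioi (0 : ℝ), ENNReal.ofReal (r ^ (a - 1) * Real.exp (-r ^ 2)) *
      ∫⁻ s in Ioi (0 : ℝ), ENNReal.ofReal (s ^ (b - 1) * Real.exp (-s ^ 2)) *
        f (r ^ 2 / (r ^ 2 + s ^ 2)) =
      ∫⁻ w in Ioi (0 : ℝ), ENNReal.ofReal (w ^ (b - 1)) * f (1 + w ^ 2)⁻¹ *
        ENNReal.ofReal (r ^ (a + b - 1) * Real.exp (-(r ^ 2 * (1 + w ^ 2)))) := by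
    intro r hr
    have hr' : 0 < r := hr
    rw [setLIntegral_Ioi_eq_mul_left hr', ← lintegral_const_mul' _ _ (by simp)]
    refine setLIntegral_congr_fun measurableSet_Ioi fun w hw => ?_
    have hw' : 0 < w := hw
    have h2 : r ^ 2 / (r ^ 2 + (r * w) ^ 2) = (1 + w ^ 2)⁻¹ := by
      field_simp
    rw [h2, ← mul_assoc, ← mul_assoc, ← ENNReal.ofReal_mul (by positivity),
      ← ENNReal.ofReal_mul (by positivity), mul_right_comm (ENNReal.ofReal (w ^ (b - 1))),
      ← ENNReal.ofReal_mul (by positivity)]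
    congr 2
    have h3 : r ^ (a + b - 1) = r ^ (a - 1) * r * r ^ (b - 1) := by
      rw [← pow_succ, ← pow_add]; congr 1; omega
    have h4 : Real.exp (-(r ^ 2 * (1 + w ^ 2))) = Real.exp (-r ^ 2) * Real.exp (-(r * w) ^ 2) := by
      rw [← Real.exp_add]; congr 1; ring
    rw [h3, h4]; ring
  rw [setLIntegral_congr_fun measurableSet_Ioi h1, lintegral_lintegral_swap]
  · rw [setLIntegral_betaDensity_mul hb, ← mul_assoc, ENNReal.div_mul_cancel (by simp) (by simp),
      ← lintegral_const_mul' _ _ (gaussianMoment_ne_top _)]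
    refine setLIntegral_congr_fun measurableSet_Ioi fun w hw => ?_
    have hw' : 0 < w := hw
    rw [lintegral_const_mul _ (by fun_prop), setLIntegral_gaussian_scale _ (by positivity),
      ENNReal.ofReal_mul (by positivity)]
    have h5 : ((a + b - 1 : ℕ) + 1 : ℝ) = a + b := by
      have : a + b - 1 + 1 = a + b := by omega
      exact_mod_cast this
    rw [h5]; ring
  · refine Measurable.aemeasurable ?_
    fun_prop

end Beta

section Radial

variable {E : Type*} [NormedAddCommGroup E] [NormedSpace ℝ E] [FiniteDimensional ℝ E]
  [MeasurableSpace E] [BorelSpace E]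

/-- Integration of a radial function. -/
theorem lintegral_norm [Nontrivial E] (μ : Measure E) [μ.IsAddHaarMeasure] :
    ∃ c : ENNReal, c ≠ 0 ∧ c ≠ ⊤ ∧ ∀ f : ℝ → ENNReal, Measurable f →
      ∫⁻ x, f ‖x‖ ∂μ =
        c * ∫⁻ r in Ioi (0 : ℝ), ENNReal.ofReal (r ^ (Module.finrank ℝ E - 1)) * f r := by
  refine ⟨μ.toSphere univ, by
    rw [ne_eq, Measure.measure_univ_eq_zero]; exact μ.toSphere_ne_zero, measure_ne_top _ _,
    fun f hf => ?_⟩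
  have h1 : ∫⁻ x, f ‖x‖ ∂μ = ∫⁻ x : ({(0)}ᶜ : Set E), f ‖x.1‖ ∂(μ.comap (↑)) := by
    rw [lintegral_subtype_comap (measurableSet_singleton _).compl (fun x => f ‖x‖),
      restrict_compl_singleton]
  have h2 : ∫⁻ x : ({(0)}ᶜ : Set E), f ‖x.1‖ ∂(μ.comap (↑)) =
      ∫⁻ x, f x.2 ∂μ.toSphere.prod (.volumeIoiPow (Module.finrank ℝ E - 1)) := by
    rw [← μ.measurePreserving_homeomorphUnitSphereProd.lintegral_comp (by fun_prop)]
    simp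
  rw [h1, h2, lintegral_prod _ (by fun_prop)]
  simp only [lintegral_const, Measure.volumeIoiPow]
  rw [lintegral_withDensity_eq_lintegral_mul _ (by fun_prop) (by fun_prop), mul_comm]
  congr 1
  rw [← lintegral_subtype_comap measurableSet_Ioi
    (fun r => ENNReal.ofReal (r ^ (Module.finrank ℝ E - 1)) * f r)]
  rfl

end Radial

/-! ### Gaussian vectors -/

section Gaussian

variable {E : Type*} [NormedAddCommGroup E] [InnerProductSpace ℝ E] [FiniteDimensional ℝ E]
  [MeasurableSpace E] [BorelSpace E]

/-- The measure with density `exp (-‖x‖²)`. Only its invariance under isometries, its finiteness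
and its product structure matter, so it is not normalized. -/
def gaussianWeight (E : Type*) [NormedAddCommGroup E] [InnerProductSpace ℝ E]
    [FiniteDimensional ℝ E] [MeasurableSpace E] [BorelSpace E] : Measure E :=
  volume.withDensity fun x => ENNReal.ofReal (Real.exp (-‖x‖ ^ 2))

instance : IsFiniteMeasure (gaussianWeight E) := by
  refine isFiniteMeasure_withDensity_ofReal (Integrable.hasFiniteIntegral ?_)
  have h := GaussianFourier.integral_rexp_neg_mul_sq_norm (V := E) one_pos
  simp only [neg_mul, one_mul] at h
  refine Integrable.of_integral_ne_zero ?_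
  rw [h]
  positivity

theorem gaussianWeight_map (g : E ≃ₗᵢ[ℝ] E) : (gaussianWeight E).map g = gaussianWeight E := by
  ext s hs
  rw [Measure.map_apply g.continuous.measurable hs, gaussianWeight,
    withDensity_apply _ (g.continuous.measurable hs), withDensity_apply _ hs,
    ← g.measurePreserving.setLIntegral_comp_preimage hs (by fun_prop)]
  simp

theorem gaussianWeight_univ_ne_zero : gaussianWeight E univ ≠ 0 := by
  rw [gaussianWeight, withDensity_apply _ MeasurableSet.univ, Measure.restrict_univ]
  rw [ne_eq, lintegral_eq_zero_iff (by fun_prop)]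
  intro h
  have : (volume : Measure E) univ = 0 := by
    rw [Filter.eventuallyEq_iff_exists_mem] at h
    obtain ⟨s, hs, heq⟩ := h
    have : s = ∅ := by
      ext x
      simp only [mem_empty_iff_false, iff_false]
      intro hx
      have := heq hx
      simp only [Pi.zero_apply, ENNReal.ofReal_eq_zero] at this
      exact absurd this (not_le.2 (Real.exp_pos _))
    rw [this] at hs
    simpa using mem_ae_iff.1 hs
  exact isOpen_univ.measure_ne_zero volume univ_nonempty this

theorem gaussianWeight_singleton [Nontrivial E] (x : E) : gaussianWeight E {x} = 0 :=
  withDensity_absolutelyContinuous _ _ (measure_singleton x)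

theorem isAddHaarMeasure_prod {F G : Type*} [NormedAddCommGroup F] [MeasurableSpace F]
    [BorelSpace F] [SecondCountableTopology F] [NormedAddCommGroup G] [MeasurableSpace G]
    [BorelSpace G] [SecondCountableTopology G] (μ : Measure F) (ν : Measure G) [SFinite μ]
    [SFinite ν] [μ.IsAddHaarMeasure] [ν.IsAddHaarMeasure] : (μ.prod ν).IsAddHaarMeasure :=
  inferInstance

/-- In an orthogonal decomposition `ℝ e ⊕ D₁ ⊕ D₂` the share of the component in `D₁` of the
squared length of the component in `D₁ ⊕ D₂` of a Gaussian vector is beta distributed. -/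
theorem lintegral_gaussianWeight_of_orthogonal {e : E} {D₁ D₂ : Submodule ℝ E} {a b : ℕ}
    (he : ‖e‖ = 1) (h1 : ∀ y ∈ D₁, ⟪e, y⟫ = 0) (h2 : ∀ y ∈ D₂, ⟪e, y⟫ = 0)
    (h12 : ∀ y ∈ D₁, ∀ z ∈ D₂, ⟪y, z⟫ = 0) (ha : Module.finrank ℝ D₁ = a) (ha0 : 0 < a)
    (hb : Module.finrank ℝ D₂ = b) (hb0 : 0 < b) (hE : Module.finrank ℝ E = 1 + a + b) :
    ∃ c : ENNReal, c ≠ 0 ∧ c ≠ ⊤ ∧ ∀ (f : ℝ → ENNReal) (h : E → ENNReal), Measurable f →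
      Measurable h →
      (∀ (α : ℝ) (y z : E), y ∈ D₁ → z ∈ D₂ → y ≠ 0 →
        h (α • e + y + z) = f (‖y‖ ^ 2 / (‖y‖ ^ 2 + ‖z‖ ^ 2))) →
      ∫⁻ x, h x ∂gaussianWeight E = c * ∫⁻ t in Ioo (0 : ℝ) 1, betaDensity a b t * f t := by
  have hnt1 : Nontrivial D₁ := Module.nontrivial_of_finrank_pos (R := ℝ) (ha ▸ ha0)
  have hnt2 : Nontrivial D₂ := Module.nontrivial_of_finrank_pos (R := ℝ) (hb ▸ hb0)
  let Φ₀ : ℝ × D₁ × D₂ →ₗ[ℝ] E :=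
    (LinearMap.toSpanSingleton ℝ E e).coprod (D₁.subtype.coprod D₂.subtype)
  have hΦ : ∀ p, Φ₀ p = p.1 • e + (p.2.1 : E) + (p.2.2 : E) := fun p => by
    simp [Φ₀, add_assoc]
  have hnorm : ∀ p, ‖Φ₀ p‖ ^ 2 = p.1 ^ 2 + ‖(p.2.1 : E)‖ ^ 2 + ‖(p.2.2 : E)‖ ^ 2 := by
    intro p
    have e1 := h1 _ p.2.1.2
    have e2 := h2 _ p.2.2.2
    have e12 := h12 _ p.2.1.2 _ p.2.2.2
    rw [hΦ, norm_add_sq_real, norm_add_sq_real, inner_add_left, inner_smul_left, inner_smul_left,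
      e1, e2, e12, norm_smul, he]
    simp
  have hinj : Function.Injective Φ₀ := by
    rw [← LinearMap.ker_eq_bot, LinearMap.ker_eq_bot']
    intro p hp
    have h3 := hnorm p
    rw [hp, norm_zero] at h3
    have h4 : p.1 = 0 := by nlinarith [sq_nonneg p.1, sq_nonneg ‖(p.2.1 : E)‖, sq_nonneg ‖(p.2.2 : E)‖]
    have h5 : ‖(p.2.1 : E)‖ = 0 := by
      nlinarith [sq_nonneg p.1, sq_nonneg ‖(p.2.1 : E)‖, sq_nonneg ‖(p.2.2 : E)‖]
    have h6 : ‖(p.2.2 : E)‖ = 0 := by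
      nlinarith [sq_nonneg p.1, sq_nonneg ‖(p.2.1 : E)‖, sq_nonneg ‖(p.2.2 : E)‖]
    exact Prod.ext h4 (Prod.ext (Subtype.ext (norm_eq_zero.1 h5)) (Subtype.ext (norm_eq_zero.1 h6)))
  let Φ : (ℝ × D₁ × D₂) ≃L[ℝ] E :=
    (LinearEquiv.ofInjectiveOfFinrankEq Φ₀ hinj (by
      rw [Module.finrank_prod, Module.finrank_prod, ha, hb, hE]; simp; ring)).toContinuousLinearEquiv
  have hΦ' : ∀ p, Φ p = Φ₀ p := fun p => rfl
  let ν : Measure (ℝ × D₁ × D₂) := volume.prod (volume.prod volume)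
  have hνh : ν.IsAddHaarMeasure := isAddHaarMeasure_prod _ _
  have hν : (ν.map Φ).IsAddHaarMeasure := Φ.isAddHaarMeasure_map ν
  have hvol := Measure.isAddLeftInvariant_eq_smul (volume : Measure E) (ν.map Φ)
  set c₀ := (volume : Measure E).addHaarScalarFactor (ν.map Φ)
  have hc₀ : c₀ ≠ 0 := by
    intro h0
    rw [h0, zero_smul] at hvol
    exact isOpen_univ.measure_ne_zero (volume : Measure E) univ_nonempty (by rw [hvol]; simp)
  obtain ⟨c₁, hc1, hc1', hr1⟩ := lintegral_norm (E := D₁) volume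
  obtain ⟨c₂, hc2, hc2', hr2⟩ := lintegral_norm (E := D₂) volume
  set G := ∫⁻ α : ℝ, ENNReal.ofReal (Real.exp (-α ^ 2)) with hG
  have hG0 : G ≠ 0 := by
    have := gaussianWeight_univ_ne_zero (E := ℝ)
    rw [gaussianWeight, withDensity_apply _ MeasurableSet.univ, Measure.restrict_univ] at this
    simpa [hG] using this
  have hGt : G ≠ ⊤ := by
    have := measure_ne_top (gaussianWeight ℝ) univ
    rw [gaussianWeight, withDensity_apply _ MeasurableSet.univ, Measure.restrict_univ] at this
    simpa [hG] using this
  refine ⟨c₀ * (G * (c₁ * c₂ * (gaussianMoment (a + b - 1) / 2))), ?_, ?_, ?_⟩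
  · simp [hc₀, hG0, hc1, hc2, gaussianMoment_ne_zero]
  · refine ENNReal.mul_ne_top (by simp) (ENNReal.mul_ne_top hGt (ENNReal.mul_ne_top
      (ENNReal.mul_ne_top hc1' hc2') (ENNReal.div_ne_top (gaussianMoment_ne_top _) (by simp))))
  intro f h hf hh hfh
  have hexp : ∀ p : ℝ × D₁ × D₂, ENNReal.ofReal (Real.exp (-‖Φ p‖ ^ 2)) =
      ENNReal.ofReal (Real.exp (-p.1 ^ 2)) * (ENNReal.ofReal (Real.exp (-‖p.2.1‖ ^ 2)) *
        ENNReal.ofReal (Real.exp (-‖p.2.2‖ ^ 2))) := by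
    intro p
    rw [← ENNReal.ofReal_mul (by positivity), ← ENNReal.ofReal_mul (by positivity),
      ← Real.exp_add, ← Real.exp_add, hΦ', hnorm]
    congr 2
    simp only [Submodule.coe_norm]
    ring
  have hsec : ∀ α : ℝ, ∫⁻ q : D₁ × D₂, ENNReal.ofReal (Real.exp (-‖q.1‖ ^ 2)) *
      ENNReal.ofReal (Real.exp (-‖q.2‖ ^ 2)) * h (Φ (α, q)) ∂(volume.prod volume) =
      c₁ * c₂ * (gaussianMoment (a + b - 1) / 2 *
        ∫⁻ t in Ioo (0 : ℝ) 1, betaDensity a b t * f t) := by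
    intro α
    have hΦm : Measurable Φ := Φ.continuous.measurable
    rw [lintegral_prod _ (by fun_prop)]
    have hinner : ∀ y : D₁, y ≠ 0 → ∫⁻ z : D₂, ENNReal.ofReal (Real.exp (-‖y‖ ^ 2)) *
        ENNReal.ofReal (Real.exp (-‖z‖ ^ 2)) * h (Φ (α, y, z)) =
        ENNReal.ofReal (Real.exp (-‖y‖ ^ 2)) * (c₂ * ∫⁻ s in Ioi (0 : ℝ),
          ENNReal.ofReal (s ^ (b - 1) * Real.exp (-s ^ 2)) *
            f (‖y‖ ^ 2 / (‖y‖ ^ 2 + s ^ 2))) := by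
      intro y hy
      have h3 : ∀ z : D₂, h (Φ (α, y, z)) = f (‖y‖ ^ 2 / (‖y‖ ^ 2 + ‖z‖ ^ 2)) := by
        intro z
        rw [hΦ', hΦ]
        exact hfh α y z y.2 z.2 (by simpa using hy)
      simp only [h3, mul_assoc]
      rw [lintegral_const_mul _ (by fun_prop)]
      congr 1
      rw [hr2 (fun s => ENNReal.ofReal (Real.exp (-s ^ 2)) * f (‖y‖ ^ 2 / (‖y‖ ^ 2 + s ^ 2)))
        (by fun_prop), hb]
      congr 1
      refine setLIntegral_congr_fun measurableSet_Ioi fun s hs => ?_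
      have hs' : 0 < s := hs
      rw [ENNReal.ofReal_mul (by positivity), mul_assoc]
    have hae : ∀ᵐ y : D₁, y ≠ 0 := by
      rw [ae_iff]; simp
    rw [lintegral_congr_ae (hae.mono fun y hy => hinner y hy),
      hr1 (fun r => ENNReal.ofReal (Real.exp (-r ^ 2)) * (c₂ * ∫⁻ s in Ioi (0 : ℝ),
          ENNReal.ofReal (s ^ (b - 1) * Real.exp (-s ^ 2)) * f (r ^ 2 / (r ^ 2 + s ^ 2))))
        (by
          refine Measurable.mul (by fun_prop) (Measurable.const_mul ?_ _)
          refine Measurable.lintegral_prod_right' (f := fun p : ℝ × ℝ =>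
            ENNReal.ofReal (p.2 ^ (b - 1) * Real.exp (-p.2 ^ 2)) *
              f (p.1 ^ 2 / (p.1 ^ 2 + p.2 ^ 2))) ?_
          fun_prop),
      ← lintegral_radial_quotient ha0 hb0 hf, ha, mul_assoc]
    congr 1
    rw [← lintegral_const_mul' _ _ hc2']
    refine setLIntegral_congr_fun measurableSet_Ioi fun r hr => ?_
    have hr' : 0 < r := hr
    rw [ENNReal.ofReal_mul (by positivity)]
    ring
  rw [gaussianWeight, lintegral_withDensity_eq_lintegral_mul _ (by fun_prop) hh,
    hvol, lintegral_smul_measure, lintegral_map (by fun_prop) Φ.continuous.measurable]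
  have hΦm : Measurable Φ := Φ.continuous.measurable
  simp only [Pi.mul_apply, hexp]
  rw [lintegral_prod _ (by fun_prop)]
  simp only [mul_assoc]
  have hlast : ∀ α : ℝ, ∫⁻ q : D₁ × D₂, ENNReal.ofReal (Real.exp (-α ^ 2)) *
      (ENNReal.ofReal (Real.exp (-‖q.1‖ ^ 2)) *
      (ENNReal.ofReal (Real.exp (-‖q.2‖ ^ 2)) * h (Φ (α, q)))) ∂(volume.prod volume) =
      ENNReal.ofReal (Real.exp (-α ^ 2)) * (c₁ * c₂ * (gaussianMoment (a + b - 1) / 2 *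
        ∫⁻ t in Ioo (0 : ℝ) 1, betaDensity a b t * f t)) := by
    intro α
    rw [lintegral_const_mul _ (by fun_prop), ← hsec α]
    simp only [mul_assoc]
  simp only [hlast]
  rw [lintegral_mul_const _ (by fun_prop), ← hG, ENNReal.smul_def, smul_eq_mul]
  simp only [mul_assoc]

end Gaussian

/-! ### The curvature of a uniformly distributed plane -/

theorem lintegral_betaDensity_ne_zero (a b : ℕ) : ∫⁻ t in Ioo (0 : ℝ) 1, betaDensity a b t ≠ 0 := by
  rw [← pos_iff_ne_zero, setLIntegral_pos_iff (measurable_betaDensity a b)]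
  have : Function.support (betaDensity a b) ∩ Ioo 0 1 = Ioo 0 1 := by
    refine inter_eq_right.2 fun t ht => ?_
    have h1 : 0 < t := ht.1
    have h2 : 0 < 1 - t := sub_pos.2 ht.2
    simp only [betaDensity, Function.mem_support, ne_eq, ENNReal.ofReal_eq_zero, not_le]
    positivity
  rw [this]
  simp

section PlaneLaw

variable {W : Type*} [NormedAddCommGroup W] [InnerProductSpace ℝ W]

theorem continuous_gramDet : Continuous fun p : W × W => gramDet p.1 p.2 :=
  contDiff_gramDet.continuous

open Classical in
/-- The span of a pair of vectors, with the value `S₀` for linearly dependent vectors. -/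
def planeOf (S₀ : TwoPlane W) (p : W × W) : TwoPlane W :=
  if h : gramDet p.1 p.2 ≠ 0 then planeSpan p.1 p.2 h else S₀

theorem planeOf_map {S₀ : TwoPlane W} {p : W × W} (h : gramDet p.1 p.2 ≠ 0) (g : W ≃ₗᵢ[ℝ] W) :
    planeOf S₀ (g p.1, g p.2) = (planeOf S₀ p).map g.toLinearIsometry := by
  have h' : gramDet (g p.1) (g p.2) ≠ 0 := by
    rw [← LinearIsometryEquiv.coe_toLinearIsometry, gramDet_map]; exact h
  rw [planeOf, planeOf, dif_pos h', dif_pos h, planeSpan_map]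
  rfl

variable [FiniteDimensional ℝ W]

/-- The condition that determines the distribution of the curvature: for every `x ≠ 0`, the
curvature `K x y` of the plane spanned by `x` and `y` lies between `1` and `4`, according to the
share of a subspace `D` of dimension `a + 1` containing `x` in the plane. -/
def IsQuarterPinchedBy (a : ℕ) (K : W → W → ℝ) : Prop :=
  ∀ x : W, x ≠ 0 → ∃ D : Submodule ℝ W, x ∈ D ∧ Module.finrank ℝ D = a + 1 ∧
    ∀ y, gramDet x y ≠ 0 → gramDet x y * K x y =
      ‖x‖ ^ 2 * (‖y‖ ^ 2 + 3 * ‖D.starProjection y‖ ^ 2) - 4 * ⟪x, y⟫ ^ 2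

/-- In the decomposition of `W` into the line of `x`, the orthogonal complement `D₁` of `x` in `D`
and the orthogonal complement `D₂` of `D`, the curvature is `1 + 3 t` with `t` the share of the
component in `D₁` of the squared length of the component in `D₁ ⊕ D₂`. -/
theorem IsQuarterPinchedBy.exists_orthogonal {a b : ℕ} {K : W → W → ℝ}
    (hK : IsQuarterPinchedBy a K)
    (hW : Module.finrank ℝ W = 1 + a + b) {x : W} (hx : x ≠ 0) :
    ∃ D₁ D₂ : Submodule ℝ W, (∀ y ∈ D₁, ⟪x, y⟫ = 0) ∧ (∀ y ∈ D₂, ⟪x, y⟫ = 0) ∧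
      (∀ y ∈ D₁, ∀ z ∈ D₂, ⟪y, z⟫ = 0) ∧ Module.finrank ℝ D₁ = a ∧ Module.finrank ℝ D₂ = b ∧
      ∀ (α : ℝ) (y z : W), y ∈ D₁ → z ∈ D₂ →
        gramDet x (α • x + y + z) = ‖x‖ ^ 2 * (‖y‖ ^ 2 + ‖z‖ ^ 2) ∧
        (0 < ‖y‖ ^ 2 + ‖z‖ ^ 2 →
          K x (α • x + y + z) = 1 + 3 * (‖y‖ ^ 2 / (‖y‖ ^ 2 + ‖z‖ ^ 2))) := by
  obtain ⟨D, hxD, hD, h⟩ := hK x hx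
  have h1 : ∀ y ∈ (Submodule.span ℝ {x})ᗮ ⊓ D, ⟪x, y⟫ = 0 := fun y hy =>
    Submodule.mem_orthogonal_singleton_iff_inner_right.1 hy.1
  have h2 : ∀ z ∈ Dᗮ, ∀ y ∈ D, ⟪y, z⟫ = 0 := fun z hz y hy => hz y hy
  refine ⟨(Submodule.span ℝ {x})ᗮ ⊓ D, Dᗮ, h1, fun z hz => h2 z hz x hxD,
    fun y hy z hz => h2 z hz y hy.2, ?_, ?_, ?_⟩
  · have := Submodule.finrank_add_inf_finrank_orthogonal (𝕜 := ℝ) (K₁ := Submodule.span ℝ {x})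
      (K₂ := D) ((Submodule.span_singleton_le_iff_mem x D).2 hxD)
    rw [finrank_span_singleton hx, hD] at this
    omega
  · have := Submodule.finrank_add_finrank_orthogonal D
    omega
  · intro α y z hy hz
    have hxy := h1 y hy
    have hxz := h2 z hz x hxD
    have hyz := h2 z hz y hy.2
    have hyx : ⟪y, x⟫ = 0 := by rw [real_inner_comm, hxy]
    have hzx : ⟪z, x⟫ = 0 := by rw [real_inner_comm, hxz]
    have hzy : ⟪z, y⟫ = 0 := by rw [real_inner_comm, hyz]
    have hP : D.starProjection (α • x + y + z) = α • x + y := by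
      rw [map_add, Submodule.starProjection_eq_self_iff.2
        (Submodule.add_mem _ (Submodule.smul_mem _ _ hxD) hy.2),
        (Submodule.starProjection_apply_eq_zero_iff D).2 hz, add_zero]
    have hg : gramDet x (α • x + y + z) = ‖x‖ ^ 2 * (‖y‖ ^ 2 + ‖z‖ ^ 2) := by
      simp only [gramDet, inner_add_left, inner_add_right, inner_smul_left, inner_smul_right,
        hxy, hxz, hyz, hyx, hzx, hzy, real_inner_self_eq_norm_sq, RCLike.conj_to_real]
      ring
    refine ⟨hg, fun hpos => ?_⟩
    have hx0 : 0 < ‖x‖ ^ 2 := by positivity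
    have hn1 : ‖α • x + y‖ ^ 2 = α ^ 2 * ‖x‖ ^ 2 + ‖y‖ ^ 2 := by
      rw [← real_inner_self_eq_norm_sq]
      simp only [inner_add_left, inner_add_right, inner_smul_left, inner_smul_right,
        hxy, hyx, real_inner_self_eq_norm_sq, RCLike.conj_to_real]
      ring
    have hn2 : ‖α • x + y + z‖ ^ 2 = α ^ 2 * ‖x‖ ^ 2 + ‖y‖ ^ 2 + ‖z‖ ^ 2 := by
      rw [← real_inner_self_eq_norm_sq]
      simp only [inner_add_left, inner_add_right, inner_smul_left, inner_smul_right,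
        hxy, hyx, hxz, hyz, hzx, hzy, real_inner_self_eq_norm_sq, RCLike.conj_to_real]
      ring
    have hi : ⟪x, α • x + y + z⟫ = α * ‖x‖ ^ 2 := by
      simp only [inner_add_right, inner_smul_right, hxy, hxz, real_inner_self_eq_norm_sq]
      ring
    have h3 : ‖x‖ ^ 2 * (‖y‖ ^ 2 + ‖z‖ ^ 2) ≠ 0 := (mul_pos hx0 hpos).ne'
    have := h (α • x + y + z) (by rwa [hg])
    rw [hg, hP, hn1, hn2, hi] at this
    apply mul_left_cancel₀ h3
    rw [this]
    field_simp
    ring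

variable [MeasurableSpace W] [BorelSpace W]

theorem measurableSet_gramDet_ne_zero : MeasurableSet {p : W × W | gramDet p.1 p.2 ≠ 0} :=
  (isOpen_ne_fun continuous_gramDet continuous_const).measurableSet

/-- A function on planes is measurable if it is measurable as a function of spanning vectors. -/
theorem measurable_of_measurable_planeSpan {β : Type*} [MeasurableSpace β] {s : TwoPlane W → β}
    (hs : Measurable fun p : {p : W × W // gramDet p.1 p.2 ≠ 0} =>
      s (planeSpan p.1.1 p.1.2 p.2)) : Measurable s := by
  have : PolishSpace {p : W × W // gramDet p.1 p.2 ≠ 0} :=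
    (isOpen_ne_fun continuous_gramDet continuous_const).polishSpace
  refine (Measurable.measurable_comp_iff_of_surjective continuous_planeSpan.measurable ?_).1 hs
  intro S
  obtain ⟨x, y, h, rfl⟩ := S.exists_planeSpan
  exact ⟨⟨(x, y), h⟩, rfl⟩

theorem measurable_planeOf (S₀ : TwoPlane W) : Measurable (planeOf S₀) := by
  classical
  exact Measurable.dite (s := {p : W × W | gramDet p.1 p.2 ≠ 0})
    (f := fun p => planeSpan p.1.1 p.1.2 p.2) (g := fun _ => S₀)
    continuous_planeSpan.measurable measurable_const measurableSet_gramDet_ne_zero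

/-- The law of the plane spanned by two independent Gaussian vectors. -/
def gaussianPlaneMeasure (S₀ : TwoPlane W) : Measure (TwoPlane W) :=
  (((gaussianWeight W).prod (gaussianWeight W)).restrict {p | gramDet p.1 p.2 ≠ 0}).map (planeOf S₀)

instance (S₀ : TwoPlane W) : IsFiniteMeasure (gaussianPlaneMeasure S₀) := by
  unfold gaussianPlaneMeasure; infer_instance

theorem gaussianPlaneMeasure_ball (S₀ S T : TwoPlane W) (r : ℝ) :
    gaussianPlaneMeasure S₀ (Metric.ball S r) = gaussianPlaneMeasure S₀ (Metric.ball T r) := by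
  obtain ⟨g, rfl⟩ := TwoPlane.exists_map_eq_of_equiv S T
  have hg : Measurable (Prod.map g g) := g.continuous.measurable.prodMap g.continuous.measurable
  have hinv : ((gaussianWeight W).prod (gaussianWeight W)).map (Prod.map g g) =
      (gaussianWeight W).prod (gaussianWeight W) := by
    rw [← Measure.map_prod_map _ _ g.continuous.measurable g.continuous.measurable,
      gaussianWeight_map]
  have hU := measurableSet_gramDet_ne_zero (W := W)
  have hb : ∀ S : TwoPlane W, MeasurableSet (planeOf S₀ ⁻¹' Metric.ball S r) := fun S =>
    measurable_planeOf S₀ Metric.isOpen_ball.measurableSet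
  unfold gaussianPlaneMeasure
  rw [Measure.map_apply (measurable_planeOf S₀) Metric.isOpen_ball.measurableSet,
    Measure.map_apply (measurable_planeOf S₀) Metric.isOpen_ball.measurableSet,
    Measure.restrict_apply (hb _), Measure.restrict_apply (hb _)]
  conv_rhs => rw [← hinv]
  rw [Measure.map_apply hg ((hb _).inter hU)]
  congr 1
  ext p
  simp only [mem_inter_iff, mem_preimage, mem_ofPred_eq, Prod.map_fst, Prod.map_snd]
  have h1 : gramDet (g p.1) (g p.2) = gramDet p.1 p.2 := gramDet_map g.toLinearIsometry _ _
  rw [h1]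
  refine and_congr_left fun h => ?_
  have h2 : planeOf S₀ (Prod.map g g p) = (planeOf S₀ p).map g.toLinearIsometry := planeOf_map h g
  rw [h2, Metric.mem_ball, Metric.mem_ball, (TwoPlane.isometry_map _).dist_eq]

variable {a b : ℕ} {K : W → W → ℝ}

/-- For fixed `x` and Gaussian `y` the curvature is distributed as `1 + 3 t` with `t` beta
distributed. The constant is the same for all `x`, hence `x` may then be integrated out. -/
theorem lintegral_gaussianWeight_curvature (hK : IsQuarterPinchedBy a K)
    (hW : Module.finrank ℝ W = 1 + a + b) (ha : 0 < a) (hb : 0 < b) :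
    ∃ c : ENNReal, c ≠ 0 ∧ c ≠ ⊤ ∧ ∀ x : W, x ≠ 0 → ∀ (f : ℝ → ENNReal) (h : W → ENNReal),
      Measurable f → Measurable h → (∀ y, gramDet x y ≠ 0 → h y = f (K x y)) →
      ∫⁻ y, h y ∂gaussianWeight W =
        c * ∫⁻ t in Ioo (0 : ℝ) 1, betaDensity a b t * f (1 + 3 * t) := by
  have key : ∀ x : W, x ≠ 0 → ∃ c : ENNReal, c ≠ 0 ∧ c ≠ ⊤ ∧ ∀ (f : ℝ → ENNReal) (h : W → ENNReal),
      Measurable f → Measurable h → (∀ y, gramDet x y ≠ 0 → h y = f (K x y)) →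
      ∫⁻ y, h y ∂gaussianWeight W =
        c * ∫⁻ t in Ioo (0 : ℝ) 1, betaDensity a b t * f (1 + 3 * t) := by
    intro x hx
    obtain ⟨D₁, D₂, h1, h2, h12, hd1, hd2, hD⟩ := hK.exists_orthogonal hW hx
    have hx0 : ‖x‖ ≠ 0 := norm_ne_zero_iff.2 hx
    obtain ⟨c, hc0, hct, hc⟩ := lintegral_gaussianWeight_of_orthogonal (e := ‖x‖⁻¹ • x)
      (by rw [norm_smul, norm_inv, norm_norm, inv_mul_cancel₀ hx0])
      (fun y hy => by rw [inner_smul_left, h1 y hy, mul_zero])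
      (fun y hy => by rw [inner_smul_left, h2 y hy, mul_zero]) h12 hd1 ha hd2 hb hW
    refine ⟨c, hc0, hct, fun f h hf hh hfh => ?_⟩
    refine hc (fun t => f (1 + 3 * t)) h (by fun_prop) hh fun α y z hy hz hy0 => ?_
    have hpos : 0 < ‖y‖ ^ 2 + ‖z‖ ^ 2 := by
      have : 0 < ‖y‖ := norm_pos_iff.2 hy0
      positivity
    obtain ⟨h3, h4⟩ := hD (α * ‖x‖⁻¹) y z hy hz
    rw [smul_smul, hfh _ (by rw [h3]; positivity), h4 hpos]
  have : Nontrivial W := Module.nontrivial_of_finrank_pos (R := ℝ) (by omega)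
  obtain ⟨x₀, hx₀⟩ := exists_ne (0 : W)
  obtain ⟨c, hc0, hct, hc⟩ := key x₀ hx₀
  have hone : ∀ {x : W} {c : ENNReal}, (∀ (f : ℝ → ENNReal) (h : W → ENNReal),
      Measurable f → Measurable h → (∀ y, gramDet x y ≠ 0 → h y = f (K x y)) →
      ∫⁻ y, h y ∂gaussianWeight W =
        c * ∫⁻ t in Ioo (0 : ℝ) 1, betaDensity a b t * f (1 + 3 * t)) →
      gaussianWeight W univ = c * ∫⁻ t in Ioo (0 : ℝ) 1, betaDensity a b t := by
    intro x c h
    simpa using h (fun _ => 1) (fun _ => 1) measurable_const measurable_const (fun _ _ => rfl)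
  have hB0 := lintegral_betaDensity_ne_zero a b
  have hBt : ∫⁻ t in Ioo (0 : ℝ) 1, betaDensity a b t ≠ ⊤ := by
    intro h
    have := hone hc
    rw [h, ENNReal.mul_top hc0] at this
    exact measure_ne_top _ _ this
  refine ⟨c, hc0, hct, fun x hx => ?_⟩
  obtain ⟨c', -, -, hc'⟩ := key x hx
  have : c' = c := by
    rw [← ENNReal.mul_left_inj hB0 hBt, ← hone hc', hone hc]
  exact this ▸ hc'

/-- The distribution of the curvature of a uniformly distributed plane is, up to the affine map
`t ↦ 1 + 3 t`, a beta distribution. -/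
theorem lintegral_hausdorffMeasure_curvature (hK : IsQuarterPinchedBy a K)
    (hKm : Measurable fun p : W × W => K p.1 p.2)
    (hW : Module.finrank ℝ W = 1 + a + b) (ha : 0 < a) (hb : 0 < b) {s : TwoPlane W → ℝ}
    (hs : ∀ x y h, s (planeSpan x y h) = K x y) :
    Measurable s ∧ ∃ c : ENNReal, c ≠ 0 ∧ c ≠ ⊤ ∧ ∀ f : ℝ → ENNReal, Measurable f →
      ∫⁻ S, f (s S) ∂(Measure.hausdorffMeasure (2 * ((Module.finrank ℝ W : ℝ) - 2))) =
        c * ∫⁻ t in Ioo (0 : ℝ) 1, betaDensity a b t * f (1 + 3 * t) := by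
  have hsm : Measurable s := by
    refine measurable_of_measurable_planeSpan ?_
    simp only [hs]
    exact hKm.comp measurable_subtype_coe
  refine ⟨hsm, ?_⟩
  obtain ⟨hpos, hfin⟩ := TwoPlane.hausdorffMeasure_univ (E := W) (by omega)
  obtain ⟨S₀⟩ := TwoPlane.nonempty (E := W) (by omega)
  set μ : Measure (TwoPlane W) := Measure.hausdorffMeasure (2 * ((Module.finrank ℝ W : ℝ) - 2))
  have : IsFiniteMeasure μ := ⟨hfin⟩
  have hμ0 : μ ≠ 0 := fun h => by rw [h] at hpos; simp at hpos
  have : Nontrivial W := Module.nontrivial_of_finrank_pos (R := ℝ) (by omega)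
  obtain ⟨c, hc0, hct, hc⟩ := lintegral_gaussianWeight_curvature hK hW ha hb
  have hU := measurableSet_gramDet_ne_zero (W := W)
  have hν : ∀ f : ℝ → ENNReal, Measurable f → ∫⁻ S, f (s S) ∂gaussianPlaneMeasure S₀ =
      c * gaussianWeight W univ *
        ∫⁻ t in Ioo (0 : ℝ) 1, betaDensity a b t * f (1 + 3 * t) := by
    intro f hf
    have h1 : Measurable fun p : W × W =>
        {p : W × W | gramDet p.1 p.2 ≠ 0}.indicator (fun p => f (K p.1 p.2)) p :=
      (hf.comp hKm).indicator hU
    have h2 : ∀ x : W, x ≠ 0 → ∫⁻ y, {p : W × W | gramDet p.1 p.2 ≠ 0}.indicator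
        (fun p => f (K p.1 p.2)) (x, y) ∂gaussianWeight W =
        c * ∫⁻ t in Ioo (0 : ℝ) 1, betaDensity a b t * f (1 + 3 * t) := fun x hx =>
      hc x hx f _ hf (h1.comp measurable_prodMk_left) fun y hy => indicator_of_mem (by exact hy) _
    have h3 : ∀ᵐ x : W ∂gaussianWeight W, x ≠ 0 := by
      rw [ae_iff]; simp [gaussianWeight_singleton]
    rw [gaussianPlaneMeasure, lintegral_map (f := fun S => f (s S)) (hf.comp hsm)
      (measurable_planeOf S₀)]
    calc _ = ∫⁻ p in {p : W × W | gramDet p.1 p.2 ≠ 0}, f (K p.1 p.2)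
          ∂(gaussianWeight W).prod (gaussianWeight W) := by
          refine setLIntegral_congr_fun hU fun p hp => ?_
          have hp' : gramDet p.1 p.2 ≠ 0 := hp
          simp only [planeOf, dif_pos hp', hs]
      _ = ∫⁻ x, ∫⁻ y, {p : W × W | gramDet p.1 p.2 ≠ 0}.indicator
        (fun p => f (K p.1 p.2)) (x, y) ∂gaussianWeight W ∂gaussianWeight W := by
          rw [← lintegral_indicator hU, lintegral_prod _ h1.aemeasurable]
      _ = _ := by
          rw [lintegral_congr_ae (h3.mono h2), lintegral_const]
          ring
  have hγ := gaussianWeight_univ_ne_zero (E := W)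
  have hν0 : gaussianPlaneMeasure S₀ ≠ 0 := by
    intro h
    have := hν (fun _ => 1) measurable_const
    rw [h] at this
    simp only [mul_one, lintegral_zero_measure] at this
    exact mul_ne_zero (mul_ne_zero hc0 hγ) (lintegral_betaDensity_ne_zero a b) this.symm
  obtain ⟨c', hc'0, hc't, hc'⟩ := exists_eq_smul_of_uniform (μ := μ) (ν := gaussianPlaneMeasure S₀)
    (fun S T r => TwoPlane.hausdorffMeasure_ball_eq _ S T r)
    (gaussianPlaneMeasure_ball S₀) hμ0 hν0
  refine ⟨c' * (c * gaussianWeight W univ), mul_ne_zero hc'0 (mul_ne_zero hc0 hγ),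
    ENNReal.mul_ne_top hc't (ENNReal.mul_ne_top hct (measure_ne_top _ _)), fun f hf => ?_⟩
  rw [hc', lintegral_smul_measure, hν f hf, smul_eq_mul, ← mul_assoc]

end PlaneLaw

/-! ### The Grassmann bundle of a homogeneous submanifold -/

section StabilizingIsometries

variable {E : Type*} [NormedAddCommGroup E] [InnerProductSpace ℝ E] [FiniteDimensional ℝ E]

/-- The linear isometries of the ambient space that map `M` onto itself, as a subset of the
normed space of endomorphisms; the condition on the adjoint, which is the inverse, expresses
surjectivity. -/
def stabilizingIsometries (M : Set E) : Set (E →L[ℝ] E) :=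
  {A | (∀ x, ‖A x‖ = ‖x‖) ∧ (∀ p ∈ M, A p ∈ M) ∧
    ∀ p ∈ M, ContinuousLinearMap.adjoint A p ∈ M}

variable {M : Set E}

theorem isCompact_stabilizingIsometries (hM : IsClosed M) :
    IsCompact (stabilizingIsometries M) := by
  have : ProperSpace (E →L[ℝ] E) := FiniteDimensional.proper ℝ _
  refine Metric.isCompact_of_isClosed_isBounded ?_ ?_
  · simp only [stabilizingIsometries, ofPred_and, ofPred_forall]
    have hev : ∀ x : E, Continuous fun A : E →L[ℝ] E => A x := fun x =>
      (ContinuousLinearMap.apply ℝ E x).continuous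
    refine (isClosed_iInter fun x => isClosed_eq (hev x).norm continuous_const).inter
      ((isClosed_iInter fun p => isClosed_iInter fun _ => hM.preimage (hev p)).inter
        (isClosed_iInter fun p => isClosed_iInter fun _ => hM.preimage ((hev p).comp
          (ContinuousLinearMap.adjoint (𝕜 := ℝ) (E := E) (F := E)).continuous)))
  · refine Metric.isBounded_iff_subset_closedBall 0 |>.2 ⟨1, fun A hA => ?_⟩
    rw [mem_closedBall_zero_iff]
    exact A.opNorm_le_bound zero_le_one fun x => by rw [hA.1, one_mul]

/-- An element of `stabilizingIsometries M` as a linear isometry. -/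
def stabilizingIsometries.toLinearIsometry (A : stabilizingIsometries M) : E →ₗᵢ[ℝ] E :=
  ⟨A.1, A.2.1⟩

theorem stabilizingIsometries.exists_equiv (A : stabilizingIsometries M) :
    ∃ g : E ≃ₗᵢ[ℝ] E, g '' M = M ∧ (∀ x, g x = A.1 x) ∧
      g.toLinearIsometry = stabilizingIsometries.toLinearIsometry A := by
  let g := (stabilizingIsometries.toLinearIsometry A).toLinearIsometryEquiv rfl
  have hg : ∀ x, g x = A.1 x := fun x => rfl
  have hsymm : ∀ x, g.symm x = ContinuousLinearMap.adjoint A.1 x := by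
    intro x
    refine ext_inner_right ℝ fun y => ?_
    rw [ContinuousLinearMap.adjoint_inner_left, ← hg, ← g.inner_map_map, g.apply_symm_apply]
  refine ⟨g, ?_, hg, by ext x; rfl⟩
  apply Subset.antisymm
  · rintro _ ⟨p, hp, rfl⟩
    exact A.2.2.1 p hp
  · intro p hp
    exact ⟨g.symm p, by rw [hsymm]; exact A.2.2.2 p hp, g.apply_symm_apply p⟩

theorem exists_stabilizingIsometries {g : E ≃ₗᵢ[ℝ] E} (hg : g '' M = M) :
    ∃ A : stabilizingIsometries M, ∀ x, A.1 x = g x := by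
  have hmem : ∀ {h : E ≃ₗᵢ[ℝ] E}, h '' M = M → ∀ p ∈ M, h p ∈ M := fun {h} hg p hp => by
    have := mem_image_of_mem h hp; rwa [hg] at this
  refine ⟨⟨g.toContinuousLinearEquiv.toContinuousLinearMap, g.norm_map, hmem hg, ?_⟩, fun x => rfl⟩
  intro p hp
  have h : ContinuousLinearMap.adjoint (g.toContinuousLinearEquiv.toContinuousLinearMap) p =
      g.symm p := by
    refine ext_inner_right ℝ fun y => ?_
    rw [ContinuousLinearMap.adjoint_inner_left, ← g.inner_map_map (g.symm p), g.apply_symm_apply]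
    rfl
  rw [h]
  exact hmem (symm_image_eq hg) p hp

end StabilizingIsometries

namespace HomogeneousChart

variable {E W : Type*} [NormedAddCommGroup E] [InnerProductSpace ℝ E]
  [NormedAddCommGroup W] [InnerProductSpace ℝ W] {M : Set E} {φ : W → E} {ρ : E → W} {O : Set E}
  {ι : W →ₗᵢ[ℝ] E} {B : W →ₗ[ℝ] W →ₗ[ℝ] E} {m : ℕ}

/-- The chart bounds the measure of a neighbourhood of the base point from both sides, and finitely
many translates of that neighbourhood cover the compact set `M`. -/
theorem hausdorffMeasure_pos_lt_top [MeasurableSpace E] [BorelSpace E]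
    (H : HomogeneousChart M φ ρ O ι B) [FiniteDimensional ℝ W]
    (hm : Module.finrank ℝ W = m) (hM : IsCompact M) :
    0 < Measure.hausdorffMeasure (m : ℝ) M ∧ Measure.hausdorffMeasure (m : ℝ) M < ⊤ := by
  have L : (Fin m → ℝ) ≃L[ℝ] W := ContinuousLinearEquiv.ofFinrankEq (by simp [hm])
  have hκ : ContDiff ℝ 1 fun x => φ (L x) := (H.contDiff.comp L.contDiff).of_le (by simp)
  have hσ : ContDiffOn ℝ 1 (fun p => L.symm (ρ p)) O :=
    (L.symm.contDiff.comp_contDiffOn H.contDiffOn).of_le (by simp)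
  have h0 : φ (L 0) = φ 0 := by simp
  obtain ⟨K, t, ht, hK⟩ := hκ.contDiffAt.exists_lipschitzOnWith (x := 0)
  have hO : O ∈ nhds (φ (L 0)) := H.isOpen.mem_nhds (H.mem _).2
  obtain ⟨K', t', ht', hK'⟩ := (hσ.contDiffAt hO).exists_lipschitzOnWith
  set s : Set (Fin m → ℝ) := t ∩ Metric.ball 0 1 ∩ (fun x => φ (L x)) ⁻¹' t' with hs
  have hsn : s ∈ nhds 0 := Filter.inter_mem (Filter.inter_mem ht (Metric.ball_mem_nhds _ one_pos))
    (hκ.continuous.continuousAt.preimage_mem_nhds ht')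
  have hpos := hausdorffMeasure_image_pos (κ := fun x => φ (L x)) (K := K') (s := s)
    (Measure.measure_pos_of_mem_nhds volume hsn).ne' fun x hx y hy => by
      have := hK'.dist_le_mul _ hx.2 _ hy.2
      simpa [H.left_inv] using this
  have hfin := hausdorffMeasure_image_lt_top (κ := fun x => φ (L x)) (s := s)
    (Metric.isBounded_ball.subset (inter_subset_left.trans inter_subset_right))
    (hK.mono (inter_subset_left.trans inter_subset_left))
  rw [Fintype.card_fin] at hpos hfin
  refine ⟨hpos.trans_le (measure_mono ?_), ?_⟩
  · rintro _ ⟨x, -, rfl⟩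
    exact (H.mem _).1
  -- By homogeneity, the finite measure of a neighbourhood of the base point bounds the measure
  -- near every point of `M`.
  refine hM.measure_lt_top_of_nhdsWithin fun p hp => ?_
  obtain ⟨g, hg, rfl⟩ := H.transitive p hp
  refine ⟨g '' ((fun x => φ (L x)) '' s), ?_, ?_⟩
  · have hN : {q | q ∈ O ∧ L.symm (ρ q) ∈ s} ∈ nhds (φ 0) := by
      rw [h0] at hO
      refine Filter.inter_mem hO ((hσ.contDiffAt hO).continuousAt.preimage_mem_nhds ?_)
      have h1 : L.symm (ρ (φ 0)) = 0 := by rw [H.left_inv, map_zero]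
      rw [h1]
      exact hsn
    have hN' : g.symm ⁻¹' {q | q ∈ O ∧ L.symm (ρ q) ∈ s} ∈ nhds (g (φ 0)) :=
      g.symm.continuous.continuousAt.preimage_mem_nhds (by simpa using hN)
    refine mem_nhdsWithin.2 ?_
    obtain ⟨V, hV, hVo, hpV⟩ := mem_nhds_iff.1 hN'
    refine ⟨V, hVo, hpV, ?_⟩
    rintro q ⟨hqV, hqM⟩
    obtain ⟨h1, h2⟩ := hV hqV
    have h3 : g.symm q ∈ M := by
      have := mem_image_of_mem g.symm hqM
      rwa [symm_image_eq hg] at this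
    exact ⟨g.symm q, ⟨_, h2, by simpa using H.right_inv _ ⟨h3, h1⟩⟩, by simp⟩
  · rwa [g.isometry.hausdorffMeasure_image (Or.inr g.surjective)]

variable [FiniteDimensional ℝ E]

/-- Every stabilizing isometry carries the planes tangent to `M` at the base point to planes
tangent to `M`. -/
def bundleMap (ι : W →ₗᵢ[ℝ] E) (p₀ : E) (q : stabilizingIsometries M × TwoPlane W) :
    E × TwoPlane E :=
  (q.1.1 p₀, q.2.map ((stabilizingIsometries.toLinearIsometry q.1).comp ι))

theorem range_bundleMap (H : HomogeneousChart M φ ρ O ι B) :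
    range (bundleMap (M := M) ι (φ 0)) = grassmannBundle M := by
  ext q
  rw [H.mem_grassmannBundle]
  constructor
  · rintro ⟨⟨A, S⟩, rfl⟩
    obtain ⟨g, hg, hgA, hgi⟩ := stabilizingIsometries.exists_equiv A
    exact ⟨g, hg, S, by simp only [bundleMap, TwoPlane.map_map, hgi, hgA]⟩
  · rintro ⟨g, hg, S, rfl⟩
    obtain ⟨A, hA⟩ := exists_stabilizingIsometries hg
    refine ⟨(A, S), Prod.ext (hA _) ?_⟩
    simp only [bundleMap, TwoPlane.map_map]
    congr 1
    ext x
    exact hA _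

theorem sectionalCurvature_bundleMap (H : HomogeneousChart M φ ρ O ι B) [FiniteDimensional ℝ W]
    (hm : Module.finrank ℝ W = m) (A : stabilizingIsometries M) {x y : W} (h : gramDet x y ≠ 0) :
    sectionalCurvature m M (bundleMap ι (φ 0) (A, planeSpan x y h)) = gaussCurvature B x y := by
  obtain ⟨g, hg, hgA, hgi⟩ := stabilizingIsometries.exists_equiv A
  rw [← H.sectionalCurvature_map hm hg h]
  simp only [bundleMap, TwoPlane.map_map, hgi, hgA]

theorem continuous_bundleMap_planeSpan (ι : W →ₗᵢ[ℝ] E) (p₀ : E) :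
    Continuous fun q : stabilizingIsometries M × {p : W × W // gramDet p.1 p.2 ≠ 0} =>
      bundleMap ι p₀ (q.1, planeSpan q.2.1.1 q.2.1.2 q.2.2) := by
  have hA : Continuous fun q : stabilizingIsometries M × {p : W × W // gramDet p.1 p.2 ≠ 0} =>
      (q.1.1 : E →L[ℝ] E) := continuous_subtype_val.comp continuous_fst
  have hx : Continuous fun q : stabilizingIsometries M × {p : W × W // gramDet p.1 p.2 ≠ 0} =>
      q.1.1 (ι q.2.1.1) := hA.clm_apply
    (ι.continuous.comp (continuous_fst.comp (continuous_subtype_val.comp continuous_snd)))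
  have hy : Continuous fun q : stabilizingIsometries M × {p : W × W // gramDet p.1 p.2 ≠ 0} =>
      q.1.1 (ι q.2.1.2) := hA.clm_apply
    (ι.continuous.comp (continuous_snd.comp (continuous_subtype_val.comp continuous_snd)))
  have hg : ∀ q : stabilizingIsometries M × {p : W × W // gramDet p.1 p.2 ≠ 0},
      gramDet (q.1.1 (ι q.2.1.1)) (q.1.1 (ι q.2.1.2)) ≠ 0 := fun q => by
    have h := q.2.2
    rw [← gramDet_map ((stabilizingIsometries.toLinearIsometry q.1).comp ι)] at h
    exact h
  have h1 : Continuous fun q : stabilizingIsometries M × {p : W × W // gramDet p.1 p.2 ≠ 0} =>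
      (⟨(q.1.1 (ι q.2.1.1), q.1.1 (ι q.2.1.2)), hg q⟩ :
        {p : E × E // gramDet p.1 p.2 ≠ 0}) :=
    Continuous.subtype_mk (hx.prodMk hy) hg
  have h2 := continuous_planeSpan.comp h1
  have h3 : Continuous fun q : stabilizingIsometries M × {p : W × W // gramDet p.1 p.2 ≠ 0} =>
      (planeSpan q.2.1.1 q.2.1.2 q.2.2).map
        ((stabilizingIsometries.toLinearIsometry q.1).comp ι) := by
    refine h2.congr fun q => ?_
    rw [planeSpan_map]
    rfl
  exact (hA.clm_apply continuous_const).prodMk h3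

/-- The bundle is the continuous image of the product of the compact set of stabilizing isometries
and the compact set of orthonormal pairs. -/
theorem isCompact_grassmannBundle (H : HomogeneousChart M φ ρ O ι B) [FiniteDimensional ℝ W]
    (hM : IsCompact M) : IsCompact (grassmannBundle M) := by
  have h1 : CompactSpace (stabilizingIsometries M) :=
    isCompact_iff_compactSpace.1 (isCompact_stabilizingIsometries hM.isClosed)
  let T : Set (W × W) := {p | ‖p.1‖ = 1 ∧ ‖p.2‖ = 1 ∧ ⟪p.1, p.2⟫ = 0}
  have hT : IsCompact T := by
    refine Metric.isCompact_of_isClosed_isBounded ?_ ?_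
    · exact (isClosed_eq (by fun_prop) continuous_const).inter
        ((isClosed_eq (by fun_prop) continuous_const).inter
          (isClosed_eq (by fun_prop) continuous_const))
    · refine (Metric.isBounded_iff_subset_closedBall 0).2 ⟨1, fun p hp => ?_⟩
      rw [mem_closedBall_zero_iff, Prod.norm_def, hp.1, hp.2.1, max_self]
  have hTg : ∀ p ∈ T, gramDet p.1 p.2 ≠ 0 := by
    rintro p ⟨h1, h2, h3⟩
    simp [gramDet, h1, h2, h3]
  have h2 : CompactSpace T := isCompact_iff_compactSpace.1 hT
  have h3 : Continuous fun q : stabilizingIsometries M × T =>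
      bundleMap ι (φ 0) (q.1, planeSpan q.2.1.1 q.2.1.2 (hTg _ q.2.2)) :=
    (continuous_bundleMap_planeSpan ι (φ 0)).comp (f := fun q : stabilizingIsometries M × T =>
      (q.1, (⟨q.2.1, hTg _ q.2.2⟩ : {p : W × W // gramDet p.1 p.2 ≠ 0}))) (by fun_prop)
  convert isCompact_range h3
  rw [← H.range_bundleMap]
  apply Subset.antisymm
  · rintro _ ⟨⟨A, S⟩, rfl⟩
    obtain ⟨x, y, h1, h2, h12, hS⟩ := S.exists_orthonormal
    refine ⟨(A, ⟨(x, y), h1, h2, h12⟩), ?_⟩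
    simp only
    congr 2
    exact Subtype.ext hS
  · rintro _ ⟨q, rfl⟩
    exact mem_range_self _

variable [MeasurableSpace E] [BorelSpace E]

/-- Measurability is tested on the Polish space of pairs of a stabilizing isometry and a linearly
independent pair of vectors, which maps onto the source of the map. -/
theorem measurable_bundleMap (ι : W →ₗᵢ[ℝ] E) (p₀ : E) [FiniteDimensional ℝ W]
    (hM : IsCompact M) :
    Measurable (bundleMap (M := M) ι p₀) := by
  have h1 : IsClosed (stabilizingIsometries M) :=
    (isCompact_stabilizingIsometries hM.isClosed).isClosed
  have : SecondCountableTopology (E →L[ℝ] E) := by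
    have : ProperSpace (E →L[ℝ] E) := FiniteDimensional.proper ℝ _
    infer_instance
  have := h1.polishSpace
  have : PolishSpace {p : W × W // gramDet p.1 p.2 ≠ 0} :=
    (isOpen_ne_fun continuous_gramDet continuous_const).polishSpace
  borelize W
  refine (Measurable.measurable_comp_iff_of_surjective (X := stabilizingIsometries M ×
    {p : W × W // gramDet p.1 p.2 ≠ 0}) (f := fun q => (q.1, planeSpan q.2.1.1 q.2.1.2 q.2.2))
    ?_ ?_).1 (continuous_bundleMap_planeSpan ι p₀).measurable
  · exact measurable_fst.prodMk (continuous_planeSpan.measurable.comp measurable_snd)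
  · rintro ⟨A, S⟩
    obtain ⟨x, y, h, rfl⟩ := S.exists_planeSpan
    exact ⟨(A, ⟨(x, y), h⟩), rfl⟩

end HomogeneousChart

/-! ### The distribution of the sectional curvature -/

namespace HomogeneousChart

variable {E W : Type*} [NormedAddCommGroup E] [InnerProductSpace ℝ E]
  [NormedAddCommGroup W] [InnerProductSpace ℝ W] [FiniteDimensional ℝ W] {M : Set E}
  {φ : W → E} {ρ : E → W} {O : Set E} {ι : W →ₗᵢ[ℝ] E} {B : W →ₗ[ℝ] W →ₗ[ℝ] E} {m : ℕ}

theorem measurable_gaussCurvature [MeasurableSpace W] [BorelSpace W] (B : W →ₗ[ℝ] W →ₗ[ℝ] E) :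
    Measurable fun p : W × W => gaussCurvature B p.1 p.2 := by
  have hB : ∀ f g : W × W → W, Continuous f → Continuous g →
      Continuous fun p : W × W => B (f p) (g p) := fun f g hf hg =>
    (B.toContinuousBilinearMap.continuous.comp hf).clm_apply hg
  have h1 := hB _ _ continuous_fst continuous_fst
  have h2 := hB _ _ continuous_snd continuous_snd
  have h3 := hB _ _ continuous_fst continuous_snd
  exact ((h1.inner h2).sub (h3.inner h3)).measurable.div continuous_gramDet.measurable

variable [FiniteDimensional ℝ E] [MeasurableSpace E]

/-- The fibre measure of the Grassmann bundle at the image of the base point under a stabilizing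
isometry. -/
theorem fubiniStudyVolume_map (H : HomogeneousChart M φ ρ O ι B)
    (hm2 : 2 ≤ m) (A : stabilizingIsometries M) :
    (fubiniStudyVolume m (tangentSpaceOf M (A.1 (φ 0)))).map (Prod.mk (A.1 (φ 0))) =
      (Measure.hausdorffMeasure (2 * ((m : ℝ) - 2))).map fun S => bundleMap ι (φ 0) (A, S) := by
  obtain ⟨g, hg, hgA, hgi⟩ := stabilizingIsometries.exists_equiv A
  have hd : 0 ≤ 2 * ((m : ℝ) - 2) := by
    have : (2 : ℝ) ≤ m := by exact_mod_cast hm2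
    linarith
  rw [fubiniStudyVolume, ← hgA, H.tangentSpaceOf_eq hg, ← TwoPlane.range_map,
    ← (TwoPlane.isometry_map _).map_hausdorffMeasure (Or.inl hd),
    Measure.map_map measurable_prodMk_left (TwoPlane.isometry_map _).continuous.measurable, hgi, hgA]
  rfl

variable [BorelSpace E]

/-- The sectional curvature becomes an explicit quotient of polynomials after composition with a
surjection from a Polish space, and measurability descends along such a surjection. -/
theorem measurable_sectionalCurvature (H : HomogeneousChart M φ ρ O ι B)
    (hm : Module.finrank ℝ W = m) (hM : IsCompact M) :
    Measurable fun q : grassmannBundle M => sectionalCurvature m M q := by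
  borelize W
  have h1 : IsClosed (stabilizingIsometries M) :=
    (isCompact_stabilizingIsometries hM.isClosed).isClosed
  have : SecondCountableTopology (E →L[ℝ] E) := by
    have : ProperSpace (E →L[ℝ] E) := FiniteDimensional.proper ℝ _
    infer_instance
  have := h1.polishSpace
  have : PolishSpace {p : W × W // gramDet p.1 p.2 ≠ 0} :=
    (isOpen_ne_fun continuous_gramDet continuous_const).polishSpace
  have hmem : ∀ q : stabilizingIsometries M × {p : W × W // gramDet p.1 p.2 ≠ 0},
      bundleMap ι (φ 0) (q.1, planeSpan q.2.1.1 q.2.1.2 q.2.2) ∈ grassmannBundle M := fun q => by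
    rw [← H.range_bundleMap]
    exact mem_range_self _
  refine (Measurable.measurable_comp_iff_of_surjective (X := stabilizingIsometries M ×
    {p : W × W // gramDet p.1 p.2 ≠ 0}) (f := fun q => (⟨_, hmem q⟩ : grassmannBundle M))
    ?_ ?_).1 ?_
  · exact ((continuous_bundleMap_planeSpan ι (φ 0)).subtype_mk hmem).measurable
  · rintro ⟨q, hq⟩
    have hq' := hq
    rw [← H.range_bundleMap] at hq'
    obtain ⟨⟨A, S⟩, rfl⟩ := hq'
    obtain ⟨x, y, h, rfl⟩ := S.exists_planeSpan
    exact ⟨(A, ⟨(x, y), h⟩), rfl⟩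
  · have h2 : (fun q : grassmannBundle M => sectionalCurvature m M q) ∘
        (fun q : stabilizingIsometries M × {p : W × W // gramDet p.1 p.2 ≠ 0} =>
          (⟨_, hmem q⟩ : grassmannBundle M)) = fun q => gaussCurvature B q.2.1.1 q.2.1.2 :=
      funext fun q => H.sectionalCurvature_bundleMap hm q.1 q.2.2
    rw [h2]
    exact (measurable_gaussCurvature B).comp (measurable_subtype_coe.comp measurable_snd)

theorem aemeasurable_fibreMeasure (H : HomogeneousChart M φ ρ O ι B) (hM : IsCompact M)
    (hm : Module.finrank ℝ W = m) (hm2 : 2 ≤ m) :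
    AEMeasurable (fun p => (fubiniStudyVolume m (tangentSpaceOf M p)).map (Prod.mk p))
      ((Measure.hausdorffMeasure (m : ℝ)).restrict M) := by
  refine aemeasurable_restrict_of_measurable_subtype hM.measurableSet ?_
  have h1 : IsClosed (stabilizingIsometries M) :=
    (isCompact_stabilizingIsometries hM.isClosed).isClosed
  have : SecondCountableTopology (E →L[ℝ] E) := by
    have : ProperSpace (E →L[ℝ] E) := FiniteDimensional.proper ℝ _
    infer_instance
  have := h1.polishSpace
  have hfin : IsFiniteMeasure
      (Measure.hausdorffMeasure (2 * ((m : ℝ) - 2)) : Measure (TwoPlane W)) :=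
    ⟨by rw [← hm]; exact (TwoPlane.hausdorffMeasure_univ (by omega)).2⟩
  have hmem : ∀ A : stabilizingIsometries M, A.1 (φ 0) ∈ M := fun A => A.2.2.1 _ (H.mem 0).1
  refine (Measurable.measurable_comp_iff_of_surjective
    (f := fun A : stabilizingIsometries M => (⟨A.1 (φ 0), hmem A⟩ : M)) ?_ ?_).1 ?_
  · exact ((continuous_subtype_val.clm_apply continuous_const).subtype_mk hmem).measurable
  · rintro ⟨p, hp⟩
    obtain ⟨g, hg, rfl⟩ := H.transitive p hp
    obtain ⟨A, hA⟩ := exists_stabilizingIsometries hg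
    exact ⟨A, Subtype.ext (hA _)⟩
  · refine Measure.measurable_of_measurable_coe _ fun s hs => ?_
    have hb := measurable_bundleMap (M := M) ι (φ 0) hM
    have hmA : ∀ A : stabilizingIsometries M,
        Measurable fun S : TwoPlane W => bundleMap ι (φ 0) (A, S) := fun A =>
      hb.comp measurable_prodMk_left
    have h2 : ∀ A : stabilizingIsometries M,
        ((fun p : M => (fubiniStudyVolume m (tangentSpaceOf M p)).map (Prod.mk (p : E))) ∘
          fun A : stabilizingIsometries M => (⟨A.1 (φ 0), hmem A⟩ : M)) A s =
        (Measure.hausdorffMeasure (2 * ((m : ℝ) - 2)))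
          (Prod.mk A ⁻¹' (bundleMap (M := M) ι (φ 0) ⁻¹' s)) := by
      intro A
      rw [Function.comp_apply, H.fubiniStudyVolume_map hm2,
        Measure.map_apply (hmA A) hs]
      rfl
    simp only [h2]
    exact measurable_measure_prodMk_left (hb hs)

/-- By homogeneity, the distribution of the sectional curvature on the whole bundle is that on the
fibre over the base point. -/
theorem lintegral_sectionalCurvature (H : HomogeneousChart M φ ρ O ι B) (hM : IsCompact M)
    (hm : Module.finrank ℝ W = m) {a b : ℕ} (ha : 0 < a) (hb : 0 < b) (hab : m = 1 + a + b)
    (hK : IsQuarterPinchedBy a (gaussCurvature B)) :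
    AEMeasurable (sectionalCurvature m M) (grassmannVolume m M) ∧
    ∃ c : ENNReal, c ≠ 0 ∧ c ≠ ⊤ ∧ ∀ f : ℝ → ENNReal, Measurable f →
      ∫⁻ q, f (sectionalCurvature m M q) ∂grassmannVolume m M =
        c * ∫⁻ t in Ioo (0 : ℝ) 1, betaDensity a b t * f (1 + 3 * t) := by
  borelize W
  have hm2 : 2 ≤ m := by omega
  have hκ := H.aemeasurable_fibreMeasure hM hm hm2
  have hbm := measurable_bundleMap (M := M) ι (φ 0) hM
  have hG : MeasurableSet (grassmannBundle M) := (H.isCompact_grassmannBundle hM).measurableSet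
  have hfib : ∀ p ∈ M, ∃ A : stabilizingIsometries M,
      (fubiniStudyVolume m (tangentSpaceOf M p)).map (Prod.mk p) =
      (Measure.hausdorffMeasure (2 * ((m : ℝ) - 2))).map fun S => bundleMap ι (φ 0) (A, S) := by
    intro p hp
    obtain ⟨g, hg, rfl⟩ := H.transitive p hp
    obtain ⟨A, hA⟩ := exists_stabilizingIsometries hg
    exact ⟨A, by rw [← hA]; exact H.fubiniStudyVolume_map hm2 A⟩
  have hmA : ∀ A : stabilizingIsometries M,
      Measurable fun S : TwoPlane W => bundleMap ι (φ 0) (A, S) := fun A =>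
    hbm.comp measurable_prodMk_left
  have hnull : grassmannVolume m M (grassmannBundle M)ᶜ = 0 := by
    rw [grassmannVolume, Measure.bind_apply hG.compl hκ]
    rw [setLIntegral_congr_fun (g := fun _ => 0) hM.measurableSet, lintegral_zero]
    intro p hp
    obtain ⟨A, hA⟩ := hfib p hp
    simp only
    rw [hA, Measure.map_apply (hmA A) hG.compl]
    convert measure_empty (μ := (Measure.hausdorffMeasure (2 * ((m : ℝ) - 2)) :
      Measure (TwoPlane W)))
    ext S
    simp only [mem_preimage, mem_compl_iff, mem_empty_iff_false, iff_false, not_not]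
    rw [← H.range_bundleMap]
    exact mem_range_self _
  have hae : ∀ᵐ q ∂grassmannVolume m M, q ∈ grassmannBundle M := hnull
  have hsm : AEMeasurable (sectionalCurvature m M) (grassmannVolume m M) := by
    rw [← Measure.restrict_eq_self_of_ae_mem hae]
    exact aemeasurable_restrict_of_measurable_subtype hG (H.measurable_sectionalCurvature hm hM)
  refine ⟨hsm, ?_⟩
  -- The curvature as a function on the Grassmannian of the model tangent space.
  obtain ⟨A₀, hA₀⟩ := exists_stabilizingIsometries (g := LinearIsometryEquiv.refl ℝ E) (M := M)
    (by simp)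
  have hs := fun x y h => H.sectionalCurvature_bundleMap hm A₀ (x := x) (y := y) h
  obtain ⟨hs', c, hc0, hct, hc⟩ := lintegral_hausdorffMeasure_curvature hK
    (measurable_gaussCurvature B) (by omega) ha hb
    (s := fun S => sectionalCurvature m M (bundleMap ι (φ 0) (A₀, S))) hs
  have hsA : ∀ (A : stabilizingIsometries M) (S : TwoPlane W),
      sectionalCurvature m M (bundleMap ι (φ 0) (A, S)) =
        sectionalCurvature m M (bundleMap ι (φ 0) (A₀, S)) := by
    intro A S
    obtain ⟨x, y, h, rfl⟩ := S.exists_planeSpan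
    rw [H.sectionalCurvature_bundleMap hm, H.sectionalCurvature_bundleMap hm]
  obtain ⟨hpos, hfin⟩ := H.hausdorffMeasure_pos_lt_top hm hM
  refine ⟨c * Measure.hausdorffMeasure (m : ℝ) M, mul_ne_zero hc0 hpos.ne',
    ENNReal.mul_ne_top hct hfin.ne, fun f hf => ?_⟩
  have hfs : AEMeasurable (fun q => f (sectionalCurvature m M q)) (grassmannVolume m M) :=
    hf.comp_aemeasurable hsm
  rw [grassmannVolume, Measure.lintegral_bind hκ hfs]
  have hin : ∀ p ∈ M, ∫⁻ q, f (sectionalCurvature m M q)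
      ∂(fubiniStudyVolume m (tangentSpaceOf M p)).map (Prod.mk p) =
      c * ∫⁻ t in Ioo (0 : ℝ) 1, betaDensity a b t * f (1 + 3 * t) := by
    intro p hp
    obtain ⟨A, hA⟩ := hfib p hp
    -- The curvature is measurable only on the bundle, so it is replaced by its extension by zero.
    have hext : Measurable ((grassmannBundle M).indicator (sectionalCurvature m M)) :=
      measurable_of_restrict_of_restrict_compl hG
        (by
          convert H.measurable_sectionalCurvature hm hM using 1
          ext q
          exact indicator_of_mem q.2 _)
        (by
          convert measurable_const (a := (0 : ℝ)) using 1
          ext q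
          exact indicator_of_notMem q.2 _)
    have hmemA : ∀ S : TwoPlane W, bundleMap ι (φ 0) (A, S) ∈ grassmannBundle M := fun S => by
      rw [← H.range_bundleMap]; exact mem_range_self _
    rw [hA]
    have h1 : ∀ᵐ q ∂(Measure.hausdorffMeasure (2 * ((m : ℝ) - 2))).map
        (fun S : TwoPlane W => bundleMap ι (φ 0) (A, S)), f (sectionalCurvature m M q) =
        f ((grassmannBundle M).indicator (sectionalCurvature m M) q) := by
      have h2 : ∀ᵐ q ∂(Measure.hausdorffMeasure (2 * ((m : ℝ) - 2))).map
          (fun S : TwoPlane W => bundleMap ι (φ 0) (A, S)), q ∈ grassmannBundle M :=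
        (ae_map_iff (p := fun q => q ∈ grassmannBundle M) (hmA A).aemeasurable hG).2
          (Filter.Eventually.of_forall hmemA)
      filter_upwards [h2] with q hq
      rw [indicator_of_mem hq]
    rw [lintegral_congr_ae h1, lintegral_map (f := fun q => f ((grassmannBundle M).indicator
      (sectionalCurvature m M) q)) (hf.comp hext) (hmA A), ← hc f hf, hm]
    refine lintegral_congr fun S => ?_
    rw [indicator_of_mem (hmemA S), hsA]
  rw [setLIntegral_congr_fun hM.measurableSet hin, lintegral_const, Measure.restrict_apply_univ]
  ring

end HomogeneousChart

/-! ### Composition algebras -/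

/-- A real composition algebra whose norm is Euclidean, that is, comes from the scalar product.
Neither associativity nor commutativity is required; the examples of interest are `ℂ`, `ℍ` and the
octonions. -/
class EuclideanComposition (K : Type*) [NormedAddCommGroup K] [InnerProductSpace ℝ K] [Mul K]
    [One K] [Star K] : Prop where
  add_mul : ∀ a b c : K, (a + b) * c = a * c + b * c
  mul_add : ∀ a b c : K, a * (b + c) = a * b + a * c
  smul_mul : ∀ (r : ℝ) (a b : K), (r • a) * b = r • (a * b)
  mul_smul : ∀ (r : ℝ) (a b : K), a * (r • b) = r • (a * b)
  one_mul : ∀ a : K, 1 * a = a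
  mul_one : ∀ a : K, a * 1 = a
  norm_mul : ∀ a b : K, ‖a * b‖ = ‖a‖ * ‖b‖
  norm_one : ‖(1 : K)‖ = 1
  star_eq : ∀ a : K, star a = (2 * ⟪(1 : K), a⟫) • (1 : K) - a

namespace EuclideanComposition

variable {K : Type*} [NormedAddCommGroup K] [InnerProductSpace ℝ K] [Mul K] [One K] [Star K]
  [EuclideanComposition K]

/-- Multiplication as a bilinear map. -/
def mulBilin (K : Type*) [NormedAddCommGroup K] [InnerProductSpace ℝ K] [Mul K] [One K] [Star K]
    [EuclideanComposition K] : K →ₗ[ℝ] K →ₗ[ℝ] K :=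
  LinearMap.mk₂ ℝ (· * ·) add_mul smul_mul mul_add mul_smul

/-- Conjugation as a linear map. -/
def starLin (K : Type*) [NormedAddCommGroup K] [InnerProductSpace ℝ K] [Mul K] [One K] [Star K]
    [EuclideanComposition K] : K →ₗ[ℝ] K where
  toFun := star
  map_add' a b := by
    simp only [star_eq, inner_add_right]
    module
  map_smul' r a := by
    simp only [star_eq, inner_smul_right, RingHom.id_apply]
    module

theorem star_add (a b : K) : star (a + b) = star a + star b := (starLin K).map_add a b

theorem star_smul (r : ℝ) (a : K) : star (r • a) = r • star a := (starLin K).map_smul r a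

theorem sum_mul {α : Type*} (s : Finset α) (f : α → K) (b : K) :
    (∑ i ∈ s, f i) * b = ∑ i ∈ s, f i * b :=
  map_sum ((mulBilin K).flip b) f s

theorem mul_sum {α : Type*} (s : Finset α) (f : α → K) (b : K) :
    b * (∑ i ∈ s, f i) = ∑ i ∈ s, b * f i :=
  map_sum (mulBilin K b) f s

theorem star_sum {α : Type*} (s : Finset α) (f : α → K) :
    star (∑ i ∈ s, f i) = ∑ i ∈ s, star (f i) :=
  map_sum (starLin K) f s

theorem zero_mul (a : K) : 0 * a = 0 := by simpa using smul_mul (0 : ℝ) (0 : K) a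

theorem mul_zero (a : K) : a * 0 = 0 := by simpa using mul_smul (0 : ℝ) a (0 : K)

theorem sub_mul (a b c : K) : (a - b) * c = a * c - b * c := (mulBilin K).map_sub₂ a b c

theorem mul_sub (a b c : K) : a * (b - c) = a * b - a * c := map_sub (mulBilin K a) b c

theorem inner_one_one : ⟪(1 : K), 1⟫ = 1 := by
  rw [real_inner_self_eq_norm_sq, norm_one, one_pow]

theorem star_one : star (1 : K) = 1 := by
  rw [star_eq, inner_one_one]
  module

theorem star_zero : star (0 : K) = 0 := (starLin K).map_zero

theorem inner_one_star (a : K) : ⟪(1 : K), star a⟫ = ⟪(1 : K), a⟫ := by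
  rw [star_eq, inner_sub_right, inner_smul_right, inner_one_one]
  ring

theorem star_star (a : K) : star (star a) = a := by
  rw [star_eq (star a), inner_one_star, star_eq a]
  module

theorem inner_star_star (a b : K) : ⟪star a, star b⟫ = ⟪a, b⟫ := by
  rw [star_eq, star_eq]
  simp only [inner_sub_left, inner_sub_right, inner_smul_left, inner_smul_right, inner_one_one,
    RCLike.conj_to_real, real_inner_comm (1 : K) a]
  ring

theorem norm_star (a : K) : ‖star a‖ = ‖a‖ := by
  rw [← sq_eq_sq₀ (norm_nonneg _) (norm_nonneg _), ← real_inner_self_eq_norm_sq, inner_star_star,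
    real_inner_self_eq_norm_sq]

theorem inner_mul_mul_self (a b c : K) : ⟪a * b, a * c⟫ = ‖a‖ ^ 2 * ⟪b, c⟫ := by
  have h := norm_mul a (b + c)
  have h2 : ‖a * (b + c)‖ ^ 2 = ‖a‖ ^ 2 * ‖b + c‖ ^ 2 := by rw [h, mul_pow]
  rw [mul_add, norm_add_sq_real, norm_add_sq_real, norm_mul, norm_mul] at h2
  linarith

theorem inner_mul_self_mul (a b c : K) : ⟪a * b, c * b⟫ = ‖b‖ ^ 2 * ⟪a, c⟫ := by
  have h := norm_mul (a + c) b
  have h2 : ‖(a + c) * b‖ ^ 2 = ‖a + c‖ ^ 2 * ‖b‖ ^ 2 := by rw [h, mul_pow]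
  rw [add_mul, norm_add_sq_real, norm_add_sq_real, norm_mul, norm_mul] at h2
  linarith

/-- The polarized form of the multiplicativity of the norm. -/
theorem inner_mul_mul_add (a b c d : K) :
    ⟪a * b, c * d⟫ + ⟪a * d, c * b⟫ = 2 * ⟪a, c⟫ * ⟪b, d⟫ := by
  have h := inner_mul_self_mul a (b + d) c
  rw [mul_add, mul_add, inner_add_left, inner_add_right, inner_add_right, inner_mul_self_mul,
    inner_mul_self_mul, norm_add_sq_real] at h
  linarith

theorem inner_mul_left (a b c : K) : ⟪a * b, c⟫ = ⟪b, star a * c⟫ := by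
  have h := inner_mul_mul_add a b 1 c
  rw [one_mul, one_mul] at h
  rw [star_eq, sub_mul, smul_mul, one_mul, inner_sub_right, inner_smul_right,
    real_inner_comm a 1, real_inner_comm (a * c) b]
  linarith

theorem inner_mul_right (a b c : K) : ⟪a * b, c⟫ = ⟪a, c * star b⟫ := by
  have h := inner_mul_mul_add a b c 1
  rw [mul_one, mul_one] at h
  rw [star_eq, mul_sub, mul_smul, mul_one, inner_sub_right, inner_smul_right, real_inner_comm b 1]
  linarith

theorem star_mul_mul (a b : K) : star a * (a * b) = ‖a‖ ^ 2 • b := by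
  refine ext_inner_right ℝ fun c => ?_
  rw [inner_mul_left, star_star, inner_mul_mul_self, inner_smul_left]
  simp

theorem mul_mul_star (a b : K) : (a * b) * star b = ‖b‖ ^ 2 • a := by
  refine ext_inner_right ℝ fun c => ?_
  rw [inner_mul_right, star_star, inner_mul_self_mul, inner_smul_left]
  simp

theorem mul_star_mul (a b : K) : a * (star a * b) = ‖a‖ ^ 2 • b := by
  simpa [star_star, norm_star] using star_mul_mul (star a) b

theorem mul_star_mul_self (a b : K) : (a * star b) * b = ‖b‖ ^ 2 • a := by
  simpa [star_star, norm_star] using mul_mul_star a (star b)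

theorem mul_star_self (a : K) : a * star a = ‖a‖ ^ 2 • (1 : K) := by
  simpa [one_mul] using mul_mul_star 1 a

theorem star_mul_self (a : K) : star a * a = ‖a‖ ^ 2 • (1 : K) := by
  simpa [mul_one] using star_mul_mul a 1

theorem star_mul (a b : K) : star (a * b) = star b * star a := by
  refine ext_inner_right ℝ fun c => ?_
  rw [← inner_star_star, star_star, inner_mul_left]
  have h := inner_mul_right b c (star a)
  rw [← h, inner_mul_left, real_inner_comm]

/-- The linearized form of right alternativity. -/
theorem mul_mul_star_add (a b c : K) : (a * b) * star c + (a * c) * star b = (2 * ⟪b, c⟫) • a := by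
  have h := mul_mul_star a (b + c)
  rw [star_add, mul_add, mul_add, add_mul, add_mul, mul_mul_star, mul_mul_star, norm_add_sq_real] at h
  have h2 : (a * b) * star c + (a * c) * star b = (‖b‖ ^ 2 • a + a * c * star b +
      (a * b * star c + ‖c‖ ^ 2 • a)) - ‖b‖ ^ 2 • a - ‖c‖ ^ 2 • a := by abel
  rw [h2, h]
  module

/-- The product `(a b) (c a)` depends on `b` and `c` only through `b c`, as in the middle Moufang
identity. -/
theorem mul_mul_mul_eq (a b c : K) :
    (a * b) * (c * a) = (2 * ⟪a, star (b * c)⟫) • a - ‖a‖ ^ 2 • star (b * c) := by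
  refine ext_inner_right ℝ fun d => ?_
  have h1 := inner_mul_mul_add a b d (star a * star c)
  rw [inner_mul_right (a * b), star_mul c a]
  rw [mul_star_mul, ← inner_mul_left, inner_smul_left, RCLike.conj_to_real] at h1
  rw [inner_sub_left, inner_smul_left, inner_smul_left, star_mul, RCLike.conj_to_real,
    RCLike.conj_to_real, ← inner_mul_right a b, inner_mul_right (star c) (star b), star_star]
  linarith

/-- The middle Moufang identity. -/
theorem moufang_middle (a b c : K) : (a * b) * (c * a) = (a * (b * c)) * a := by
  have h := mul_mul_mul_eq a (b * c) 1
  rw [one_mul, mul_one] at h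
  rw [h, mul_mul_mul_eq]

/-- The right Moufang identity with the factor `a` cancelled against its conjugate. -/
theorem mul_star_mul_mul_mul (x y a : K) :
    (x * star a) * ((a * y) * a) = ‖a‖ ^ 2 • ((x * y) * a) := by
  have h := mul_mul_mul_eq a y 1
  rw [one_mul, mul_one] at h
  have h2 := mul_mul_star_add x (star a) y
  rw [star_star] at h2
  rw [h, mul_sub, mul_smul, mul_smul, mul_star_mul_self, eq_sub_of_add_eq' h2,
    ← inner_star_star a, star_star]
  module

end EuclideanComposition

/-! ### Rank one projections -/

namespace EuclideanComposition

theorem norm_sq_matrixSpace {K : Type} [NormedAddCommGroup K] {N : ℕ} (X : MatrixSpace K N) :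
    ‖X‖ ^ 2 = ∑ i, ∑ j, ‖X (i, j)‖ ^ 2 := by
  rw [PiLp.norm_sq_eq_of_L2, Fintype.sum_prod_type]

section RankOneProjections

variable {K : Type} [NormedAddCommGroup K] [InnerProductSpace ℝ K] [Mul K] [One K] [Star K]
  [EuclideanComposition K] {N : ℕ} {P : MatrixSpace K N}

theorem eq_smul_one_of_star_eq {a : K} (h : star a = a) :
    a = ⟪(1 : K), a⟫ • (1 : K) := by
  rw [star_eq] at h
  have h2 : (2 : ℝ) • a = (2 : ℝ) • (⟪(1 : K), a⟫ • (1 : K)) := by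
    rw [smul_smul, two_smul, eq_sub_iff_add_eq.1 h.symm]
  exact smul_right_injective K (two_ne_zero (α := ℝ)) h2

namespace rankOneProjections

theorem diag_eq (hP : P ∈ rankOneProjections K N) (k : Fin N) :
    P (k, k) = ⟪(1 : K), P (k, k)⟫ • (1 : K) :=
  eq_smul_one_of_star_eq (hP.1 k k)

theorem sum_norm_sq_col (hP : P ∈ rankOneProjections K N) (k : Fin N) :
    ∑ i, ‖P (i, k)‖ ^ 2 = ⟪(1 : K), P (k, k)⟫ := by
  rw [← hP.2.1 k k, inner_sum]
  refine Finset.sum_congr rfl fun i _ => ?_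
  rw [← hP.1 i k, star_mul_self, inner_smul_right, inner_one_one,
    _root_.mul_one]

theorem norm_eq_norm (hP : P ∈ rankOneProjections K N) (i j : Fin N) :
    ‖P (i, j)‖ = ‖P (j, i)‖ := by rw [← hP.1 j i, norm_star]

theorem diag_nonneg (hP : P ∈ rankOneProjections K N) (k : Fin N) : 0 ≤ ⟪(1 : K), P (k, k)⟫ := by
  rw [← sum_norm_sq_col hP]
  positivity

theorem sum_diag (hP : P ∈ rankOneProjections K N) : ∑ k, ⟪(1 : K), P (k, k)⟫ = 1 := by
  rw [← inner_sum, hP.2.2, inner_one_one]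

theorem sum_norm_sq (hP : P ∈ rankOneProjections K N) : ∑ i, ∑ j, ‖P (i, j)‖ ^ 2 = 1 := by
  rw [Finset.sum_comm, ← sum_diag hP]
  exact Finset.sum_congr rfl fun k _ => sum_norm_sq_col hP k

/-- The matrix `P` has rank one: all its `2 × 2`-minors that involve a diagonal entry vanish. The
sum of the squared norms of the minors involving the `k`-th diagonal entry can be evaluated without
associativity. -/
theorem diag_smul_eq (hP : P ∈ rankOneProjections K N) (i j k : Fin N) :
    ⟪(1 : K), P (k, k)⟫ • P (i, j) = P (i, k) * P (k, j) := by
  set r := ⟪(1 : K), P (k, k)⟫ with hr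
  have h1 : ∀ i, ∑ j, ⟪P (i, k) * P (k, j), P (i, j)⟫ = ‖P (i, k)‖ ^ 2 := by
    intro i
    rw [← real_inner_self_eq_norm_sq]
    have h := congrArg (fun a => ⟪P (i, k), a⟫) (hP.2.1 i k)
    simp only [inner_sum] at h
    rw [← h]
    refine Finset.sum_congr rfl fun j _ => ?_
    rw [inner_mul_right, hP.1]
  have h2 : ∑ i, ∑ j, ‖r • P (i, j) - P (i, k) * P (k, j)‖ ^ 2 = 0 := by
    have h3 : ∀ i j, ‖r • P (i, j) - P (i, k) * P (k, j)‖ ^ 2 = r ^ 2 * ‖P (i, j)‖ ^ 2 -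
        2 * r * ⟪P (i, k) * P (k, j), P (i, j)⟫ + ‖P (i, k)‖ ^ 2 * ‖P (j, k)‖ ^ 2 := by
      intro i j
      rw [norm_sub_sq_real, norm_smul, norm_mul, inner_smul_left, real_inner_comm, norm_eq_norm hP k j,
        mul_pow, mul_pow, Real.norm_eq_abs, sq_abs, RCLike.conj_to_real]
      ring
    simp only [h3, Finset.sum_add_distrib, Finset.sum_sub_distrib, ← Finset.mul_sum,
      ← Finset.sum_mul, sum_norm_sq hP, h1, sum_norm_sq_col hP, ← hr]
    ring
  rw [Finset.sum_eq_zero_iff_of_nonneg (fun i _ => by positivity)] at h2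
  have h4 := h2 i (Finset.mem_univ _)
  rw [Finset.sum_eq_zero_iff_of_nonneg (fun j _ => by positivity)] at h4
  have h5 := h4 j (Finset.mem_univ _)
  exact sub_eq_zero.1 (norm_eq_zero.1 (pow_eq_zero_iff two_ne_zero |>.1 h5))

end rankOneProjections

/-- The set is closed, and its elements have norm one since `‖P‖² = tr (P²) = tr P`. -/
theorem isCompact_rankOneProjections [FiniteDimensional ℝ K] :
    IsCompact (rankOneProjections K N) := by
  have : ProperSpace (MatrixSpace K N) := FiniteDimensional.proper ℝ _
  have hst : Continuous (star : K → K) := (starLin K).continuous_of_finiteDimensional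
  have hmul : ∀ f g : MatrixSpace K N → K, Continuous f → Continuous g →
      Continuous fun X => f X * g X := fun f g hf hg =>
    ((mulBilin K).toContinuousBilinearMap.continuous.comp hf).clm_apply hg
  have hcoord : ∀ p, Continuous fun X : MatrixSpace K N => X p := fun p => by fun_prop
  refine Metric.isCompact_of_isClosed_isBounded ?_ ?_
  · unfold rankOneProjections
    simp only [ofPred_and, ofPred_forall]
    refine (isClosed_iInter fun i => isClosed_iInter fun j =>
      isClosed_eq (hst.comp (hcoord _)) (hcoord _)).inter
      ((isClosed_iInter fun i => isClosed_iInter fun j =>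
        isClosed_eq (continuous_finsetSum _ fun k _ => hmul _ _ (hcoord _) (hcoord _))
          (hcoord _)).inter (isClosed_eq (continuous_finsetSum _ fun i _ => hcoord _)
            continuous_const))
  · refine (Metric.isBounded_iff_subset_closedBall 0).2 ⟨1, fun P hP => ?_⟩
    rw [mem_closedBall_zero_iff, ← sq_le_one_iff₀ (norm_nonneg _), norm_sq_matrixSpace,
      rankOneProjections.sum_norm_sq hP]

theorem isCompact_projectiveModel [FiniteDimensional ℝ K] : IsCompact (projectiveModel K N) :=
  isCompact_rankOneProjections.image (continuous_const_smul _)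

/-- The matrix with entries `u_i v̄_j`, as a bilinear map. -/
def outer (K : Type) [NormedAddCommGroup K] [InnerProductSpace ℝ K] [Mul K] [One K] [Star K]
    [EuclideanComposition K] (N : ℕ) :
    PiLp 2 (fun _ : Fin N => K) →ₗ[ℝ] PiLp 2 (fun _ : Fin N => K) →ₗ[ℝ] MatrixSpace K N :=
  LinearMap.mk₂ ℝ (fun u v => WithLp.toLp 2 fun p => u p.1 * star (v p.2))
    (fun u u' v => by ext p; simp [add_mul])
    (fun r u v => by ext p; simp [smul_mul])
    (fun u v v' => by ext p; simp [star_add, mul_add])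
    (fun r u v => by ext p; simp [star_smul, mul_smul])

theorem outer_apply (u v : PiLp 2 (fun _ : Fin N => K)) (i j : Fin N) :
    outer K N u v (i, j) = u i * star (v j) := rfl

/-- A substitute for associativity: products of the entries of the rank one matrices
`x_i x̄_j` behave as in an associative algebra. It holds in associative algebras, and in general
for two indices. -/
def IsTripleAssociative (K : Type) [NormedAddCommGroup K] [InnerProductSpace ℝ K] [Mul K] [Star K]
    (n : ℕ) : Prop :=
  ∀ (x : Fin n → K) (i j k : Fin n) (y : K),
    (x i * star (x j)) * ((x j * star (x k)) * y) = ‖x j‖ ^ 2 • ((x i * star (x k)) * y)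

theorem isTripleAssociative_of_assoc (h : ∀ a b c : K, (a * b) * c = a * (b * c)) (n : ℕ) :
    IsTripleAssociative K n := by
  intro x i j k y
  rw [h, h, h, star_mul_mul, mul_smul]

/-- Among three indices in a set of two elements, two coincide, so alternativity suffices. -/
theorem isTripleAssociative_two : IsTripleAssociative K 2 := by
  intro x i j k y
  have h : i = j ∨ j = k ∨ i = k := by omega
  rcases h with rfl | rfl | rfl
  · rw [mul_star_self, smul_mul, one_mul]
  · rw [mul_star_self, smul_mul, one_mul, mul_smul]
  · have h2 : x j * star (x i) = star (x i * star (x j)) := by rw [star_mul, star_star]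
    rw [h2, mul_star_mul, mul_star_self, smul_mul, one_mul, smul_smul, norm_mul,
      norm_star]
    ring_nf

/-- Multiples of `v v^*` are projections if one coordinate of `v` is one. -/
theorem smul_outer_mem_rankOneProjections {n : ℕ} (hT : IsTripleAssociative K n)
    {v : PiLp 2 (fun _ : Fin (n + 1) => K)} (hv : v 0 = 1) :
    (‖v‖ ^ 2)⁻¹ • outer K (n + 1) v v ∈ rankOneProjections K (n + 1) := by
  have hn : ‖v‖ ^ 2 = 1 + ∑ i : Fin n, ‖v i.succ‖ ^ 2 := by
    rw [PiLp.norm_sq_eq_of_L2, Fin.sum_univ_succ, hv, norm_one, one_pow]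
  have hn0 : ‖v‖ ^ 2 ≠ 0 := by rw [hn]; positivity
  have hassoc : ∀ i k j : Fin (n + 1), (v i * star (v k)) * (v k * star (v j)) =
      ‖v k‖ ^ 2 • (v i * star (v j)) := by
    intro i k j
    induction k using Fin.cases with
    | zero => rw [hv, star_one, mul_one, one_mul, norm_one, one_pow, one_smul]
    | succ k =>
      induction i using Fin.cases with
      | zero => rw [hv, one_mul, star_mul_mul, one_mul]
      | succ i =>
        induction j using Fin.cases with
        | zero => rw [hv, star_one, mul_one, mul_one, mul_star_mul_self]
        | succ j =>
          simpa [mul_one] using hT (fun i => v i.succ) i k j 1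
  refine ⟨fun i j => ?_, fun i j => ?_, ?_⟩
  · simp only [PiLp.smul_apply, outer_apply, star_smul, star_mul, star_star]
  · simp only [PiLp.smul_apply, outer_apply, smul_mul, mul_smul, hassoc, ← Finset.smul_sum,
      ← Finset.sum_smul]
    rw [← PiLp.norm_sq_eq_of_L2 _ v, inv_smul_smul₀ hn0]
  · simp only [PiLp.smul_apply, outer_apply, mul_star_self, ← Finset.smul_sum, ← Finset.sum_smul]
    rw [← PiLp.norm_sq_eq_of_L2 _ v, inv_smul_smul₀ hn0]

end RankOneProjections
end EuclideanComposition

/-! ### The affine chart -/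

section QuadraticQuotient

variable {W F : Type*} [NormedAddCommGroup W] [InnerProductSpace ℝ W] [NormedAddCommGroup F]
  [NormedSpace ℝ F] (e : F) (l : W →L[ℝ] F) (q : W →L[ℝ] W →L[ℝ] F)

/-- The map `y ↦ (e + l(y) + q(y, y)) / (1 + ‖y‖²)`, the form of an affine chart of a projective
space. -/
def quadraticQuotient (y : W) : F := (1 + ‖y‖ ^ 2)⁻¹ • (e + l y + q y y)

theorem contDiff_quadraticQuotient : ContDiff ℝ ∞ (quadraticQuotient e l q) := by
  have h : ContDiff ℝ ∞ fun y : W => (1 + ‖y‖ ^ 2)⁻¹ :=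
    (contDiff_const.add (contDiff_norm_sq ℝ)).inv fun y => by positivity
  exact h.smul ((contDiff_const.add l.contDiff).add (q.contDiff.clm_apply contDiff_id))

theorem hasFDerivAt_inv_one_add_norm_sq (y : W) :
    HasFDerivAt (fun y : W => (1 + ‖y‖ ^ 2)⁻¹)
      ((-((1 + ‖y‖ ^ 2) ^ 2)⁻¹) • ((2 : ℝ) • innerSL ℝ y)) y := by
  have h1 : HasFDerivAt (fun y : W => 1 + ‖y‖ ^ 2) ((2 : ℝ) • innerSL ℝ y) y := by
    simpa [ofNat_smul_eq_nsmul] using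
      (hasStrictFDerivAt_norm_sq y).hasFDerivAt.const_add (1 : ℝ)
  exact (hasDerivAt_inv (x := 1 + ‖y‖ ^ 2) (by positivity)).comp_hasFDerivAt y h1

theorem hasFDerivAt_numerator (y : W) :
    HasFDerivAt (fun y => e + l y + q y y) (l + (q y + q.flip y)) y := by
  have h1 := (q.hasFDerivAt (x := y)).clm_apply (hasFDerivAt_id y)
  have h2 := ((l.hasFDerivAt (x := y)).const_add e).add h1
  refine h2.congr_fderiv ?_
  ext v
  simp

theorem fderiv_quadraticQuotient (y v : W) :
    fderiv ℝ (quadraticQuotient e l q) y v =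
      (1 + ‖y‖ ^ 2)⁻¹ • (l v + (q y v + q v y)) +
        (-((1 + ‖y‖ ^ 2) ^ 2)⁻¹ * (2 * ⟪y, v⟫)) • (e + l y + q y y) := by
  have h := (hasFDerivAt_inv_one_add_norm_sq y).smul (hasFDerivAt_numerator e l q y)
  have h2 : fderiv ℝ (quadraticQuotient e l q) y = _ := h.fderiv
  rw [h2]
  simp

theorem fderiv_quadraticQuotient_zero : fderiv ℝ (quadraticQuotient e l q) 0 = l := by
  ext v
  rw [fderiv_quadraticQuotient]
  simp

theorem fderiv_fderiv_quadraticQuotient_zero (u v : W) :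
    fderiv ℝ (fun y => fderiv ℝ (quadraticQuotient e l q) y v) 0 u =
      (-2 * ⟪u, v⟫) • e + (q u v + q v u) := by
  simp only [fderiv_quadraticQuotient]
  have h1 : HasFDerivAt (fun y => l v + (q y v + q v y)) (q.flip v + q v) 0 := by
    refine ((((q.flip v).hasFDerivAt (x := 0)).add ((q v).hasFDerivAt (x := 0))).const_add
      (l v)).congr_fderiv rfl
  have h2 := (hasFDerivAt_inv_one_add_norm_sq (0 : W)).smul h1
  have h3 : HasFDerivAt (fun y : W => 2 * ⟪y, v⟫) ((2 : ℝ) • innerSL ℝ v) 0 := by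
    have : HasFDerivAt (fun y : W => ⟪v, y⟫) (innerSL ℝ v) 0 := (innerSL ℝ v).hasFDerivAt
    simp only [real_inner_comm v]
    exact this.const_mul 2
  have h4 : HasFDerivAt (fun y : W => -((1 + ‖y‖ ^ 2) ^ 2)⁻¹)
      (fderiv ℝ (fun y : W => -((1 + ‖y‖ ^ 2) ^ 2)⁻¹) 0) 0 := by
    have : ContDiff ℝ ∞ fun y : W => -((1 + ‖y‖ ^ 2) ^ 2)⁻¹ :=
      (((contDiff_const.add (contDiff_norm_sq ℝ)).pow 2).inv fun y => by positivity).neg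
    exact (this.differentiable (by simp) 0).hasFDerivAt
  have h5 := (h4.mul h3).smul (hasFDerivAt_numerator e l q 0)
  have h6 := (h2.add h5).fderiv
  have h7 : fderiv ℝ (fun y : W => (1 + ‖y‖ ^ 2)⁻¹ • (l v + (q y v + q v y)) +
        (-((1 + ‖y‖ ^ 2) ^ 2)⁻¹ * (2 * ⟪y, v⟫)) • (e + l y + q y y)) 0 = _ := h6
  rw [h7]
  simp [real_inner_comm u v]
  module

end QuadraticQuotient

theorem inner_matrixSpace {K : Type} [NormedAddCommGroup K] [InnerProductSpace ℝ K] {N : ℕ}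
    (X Y : MatrixSpace K N) : ⟪X, Y⟫ = ∑ i, ∑ j, ⟪X (i, j), Y (i, j)⟫ := by
  rw [PiLp.inner_apply, Fintype.sum_prod_type]

namespace EuclideanComposition

section Coordinates

/-- The first standard basis vector. -/
def baseVector (K : Type) [NormedAddCommGroup K] [One K] (n : ℕ) :
    PiLp 2 (fun _ : Fin (n + 1) => K) :=
  WithLp.toLp 2 (Fin.cons 1 0 : Fin (n + 1) → K)

variable {K : Type} [NormedAddCommGroup K] [One K] {n : ℕ}

@[simp] theorem baseVector_zero : baseVector K n 0 = 1 := rfl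

@[simp] theorem baseVector_succ (i : Fin n) : baseVector K n i.succ = 0 := rfl

end Coordinates

section Coordinates

variable {K : Type} [NormedAddCommGroup K] [InnerProductSpace ℝ K] {n : ℕ}

/-- Vectors with `n` coordinates as vectors with `n + 1` coordinates, the first of which is
zero. -/
def consZero (K : Type) [NormedAddCommGroup K] [InnerProductSpace ℝ K] (n : ℕ) :
    PiLp 2 (fun _ : Fin n => K) →ₗ[ℝ] PiLp 2 (fun _ : Fin (n + 1) => K) where
  toFun x := WithLp.toLp 2 (Fin.cons 0 x : Fin (n + 1) → K)
  map_add' x y := by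
    ext i
    induction i using Fin.cases <;> simp
  map_smul' r x := by
    ext i
    induction i using Fin.cases <;> simp

@[simp] theorem consZero_zero (x : PiLp 2 (fun _ : Fin n => K)) : consZero K n x 0 = 0 := rfl

@[simp] theorem consZero_succ (x : PiLp 2 (fun _ : Fin n => K)) (i : Fin n) :
    consZero K n x i.succ = x i := rfl

end Coordinates

variable {K : Type} [NormedAddCommGroup K] [InnerProductSpace ℝ K] [Mul K] [One K] [Star K]
  {n : ℕ} [EuclideanComposition K]

theorem norm_sq_baseVector_add (x : PiLp 2 (fun _ : Fin n => K)) :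
    ‖baseVector K n + consZero K n x‖ ^ 2 = 1 + ‖x‖ ^ 2 := by
  rw [PiLp.norm_sq_eq_of_L2, Fin.sum_univ_succ, PiLp.norm_sq_eq_of_L2]
  simp [norm_one]

/-- The base point `E₀₀ / √2` of the projective space. -/
def basePoint (K : Type) [NormedAddCommGroup K] [InnerProductSpace ℝ K] [Mul K] [One K] [Star K]
    [EuclideanComposition K] (n : ℕ) : MatrixSpace K (n + 1) :=
  (√2)⁻¹ • outer K (n + 1) (baseVector K n) (baseVector K n)

/-- The differential of the affine chart at the base point. -/
def chartLin (K : Type) [NormedAddCommGroup K] [InnerProductSpace ℝ K] [Mul K] [One K] [Star K]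
    [EuclideanComposition K] (n : ℕ) :
    PiLp 2 (fun _ : Fin n => K) →ₗ[ℝ] MatrixSpace K (n + 1) :=
  (√2)⁻¹ • ((outer K (n + 1) (baseVector K n)).comp (consZero K n) +
    ((outer K (n + 1)).flip (baseVector K n)).comp (consZero K n))

/-- The quadratic part of the affine chart at the base point. -/
def chartQuad (K : Type) [NormedAddCommGroup K] [InnerProductSpace ℝ K] [Mul K] [One K] [Star K]
    [EuclideanComposition K] (n : ℕ) :
    PiLp 2 (fun _ : Fin n => K) →ₗ[ℝ] PiLp 2 (fun _ : Fin n => K) →ₗ[ℝ] MatrixSpace K (n + 1) :=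
  (√2)⁻¹ • (outer K (n + 1)).compl₁₂ (consZero K n) (consZero K n)

theorem basePoint_apply (i j : Fin (n + 1)) :
    basePoint K n (i, j) = (√2)⁻¹ • (baseVector K n i * star (baseVector K n j)) := rfl

theorem chartLin_apply (x : PiLp 2 (fun _ : Fin n => K)) (i j : Fin (n + 1)) :
    chartLin K n x (i, j) = (√2)⁻¹ • (baseVector K n i * star (consZero K n x j) +
      consZero K n x i * star (baseVector K n j)) := rfl

theorem chartQuad_apply (x y : PiLp 2 (fun _ : Fin n => K)) (i j : Fin (n + 1)) :
    chartQuad K n x y (i, j) = (√2)⁻¹ • (consZero K n x i * star (consZero K n y j)) := rfl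

theorem norm_chartLin (x : PiLp 2 (fun _ : Fin n => K)) : ‖chartLin K n x‖ = ‖x‖ := by
  rw [← sq_eq_sq₀ (norm_nonneg _) (norm_nonneg _), norm_sq_matrixSpace, PiLp.norm_sq_eq_of_L2]
  simp only [Fin.sum_univ_succ, chartLin_apply, baseVector_zero, baseVector_succ, consZero_zero,
    consZero_succ, star_zero, star_one, mul_one, one_mul, mul_zero, zero_mul, norm_smul,
    mul_pow, norm_star, add_zero, zero_add, norm_zero, norm_inv, inv_pow,
    Real.norm_eq_abs, sq_abs, Real.sq_sqrt (zero_le_two), ← Finset.mul_sum]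
  norm_num
  ring

/-- The differential of the affine chart at the base point is an isometric embedding. -/
def chartIsometry (K : Type) [NormedAddCommGroup K] [InnerProductSpace ℝ K] [Mul K] [One K] [Star K]
    [EuclideanComposition K] (n : ℕ) :
    PiLp 2 (fun _ : Fin n => K) →ₗᵢ[ℝ] MatrixSpace K (n + 1) :=
  ⟨chartLin K n, norm_chartLin⟩

/-- The affine chart centred at the base point, with image the points whose first diagonal entry
does not vanish. -/
def affineChart (K : Type) [NormedAddCommGroup K] [InnerProductSpace ℝ K] [Mul K] [One K] [Star K]
    [EuclideanComposition K] [FiniteDimensional ℝ K] (n : ℕ) :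
    PiLp 2 (fun _ : Fin n => K) → MatrixSpace K (n + 1) :=
  quadraticQuotient (basePoint K n) (chartIsometry K n).toContinuousLinearMap
    (chartQuad K n).toContinuousBilinearMap

/-- The inverse of the affine chart. -/
def affineCoordinates (K : Type) [NormedAddCommGroup K] [InnerProductSpace ℝ K] [One K] (n : ℕ)
    (X : MatrixSpace K (n + 1)) : PiLp 2 (fun _ : Fin n => K) :=
  WithLp.toLp 2 fun i => ⟪(1 : K), X (0, 0)⟫⁻¹ • X (i.succ, 0)

/-- The second fundamental form of the projective space at the base point. -/
def chartSecond (K : Type) [NormedAddCommGroup K] [InnerProductSpace ℝ K] [Mul K] [One K] [Star K]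
    [EuclideanComposition K] (n : ℕ) :
    PiLp 2 (fun _ : Fin n => K) →ₗ[ℝ] PiLp 2 (fun _ : Fin n => K) →ₗ[ℝ] MatrixSpace K (n + 1) :=
  LinearMap.mk₂ ℝ (fun u v => (-2 * ⟪u, v⟫) • basePoint K n + (chartQuad K n u v + chartQuad K n v u))
    (fun u u' v => by simp only [inner_add_left, map_add, LinearMap.add_apply]; module)
    (fun r u v => by
      simp only [inner_smul_left, map_smul, LinearMap.smul_apply, RCLike.conj_to_real]; module)
    (fun u v v' => by simp only [inner_add_right, map_add, LinearMap.add_apply]; module)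
    (fun r u v => by simp only [inner_smul_right, map_smul, LinearMap.smul_apply]; module)

variable [FiniteDimensional ℝ K]

theorem affineChart_eq (x : PiLp 2 (fun _ : Fin n => K)) :
    affineChart K n x = (√2)⁻¹ • (‖baseVector K n + consZero K n x‖ ^ 2)⁻¹ •
      outer K (n + 1) (baseVector K n + consZero K n x) (baseVector K n + consZero K n x) := by
  rw [norm_sq_baseVector_add, smul_comm]
  change (1 + ‖x‖ ^ 2)⁻¹ • (basePoint K n + chartLin K n x + chartQuad K n x x) = _
  congr 1
  simp only [map_add, LinearMap.add_apply, smul_add, basePoint, chartLin, chartQuad,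
    LinearMap.smul_apply, LinearMap.comp_apply, LinearMap.flip_apply, LinearMap.compl₁₂_apply]
  abel

theorem affineChart_zero : affineChart K n 0 = basePoint K n := by
  simp [affineChart, quadraticQuotient]

theorem affineChart_zero_zero (x : PiLp 2 (fun _ : Fin n => K)) :
    affineChart K n x (0, 0) = ((√2)⁻¹ * (1 + ‖x‖ ^ 2)⁻¹) • (1 : K) := by
  rw [affineChart_eq, norm_sq_baseVector_add, smul_smul]
  simp [outer_apply, star_one, star_zero, mul_one, mul_zero]

theorem affineChart_succ_zero (x : PiLp 2 (fun _ : Fin n => K)) (i : Fin n) :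
    affineChart K n x (i.succ, 0) = ((√2)⁻¹ * (1 + ‖x‖ ^ 2)⁻¹) • x i := by
  rw [affineChart_eq, norm_sq_baseVector_add, smul_smul]
  simp [outer_apply, star_one, star_zero, mul_one, mul_zero]

theorem affineChart_affineCoordinates {X : MatrixSpace K (n + 1)}
    (hX : X ∈ projectiveModel K (n + 1))
    (h0 : ⟪(1 : K), X (0, 0)⟫ ≠ 0) : affineChart K n (affineCoordinates K n X) = X := by
  obtain ⟨P, hP, rfl⟩ := hX
  have h2 : (√2 : ℝ)⁻¹ ≠ 0 := by positivity
  set r := ⟪(1 : K), P (0, 0)⟫ with hr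
  have hr0 : r ≠ 0 := by
    intro h
    apply h0
    simp [inner_smul_right, ← hr, h]
  set v := baseVector K n + consZero K n (affineCoordinates K n ((√2 : ℝ)⁻¹ • P)) with hv
  have hvi : ∀ i, v i = r⁻¹ • P (i, 0) := by
    intro i
    induction i using Fin.cases with
    | zero =>
      rw [rankOneProjections.diag_eq hP, ← hr, inv_smul_smul₀ hr0]
      simp [hv]
    | succ i =>
      simp only [hv, affineCoordinates, PiLp.add_apply, baseVector_succ, consZero_succ, zero_add,
        PiLp.smul_apply, inner_smul_right, ← hr, smul_smul, mul_inv]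
      congr 1
      field_simp
  have hnv : ‖v‖ ^ 2 = r⁻¹ := by
    rw [PiLp.norm_sq_eq_of_L2]
    simp only [hvi, norm_smul, mul_pow, ← Finset.mul_sum, rankOneProjections.sum_norm_sq_col hP,
      ← hr, norm_inv, Real.norm_eq_abs, inv_pow, sq_abs]
    field_simp
  rw [affineChart_eq, ← hv, hnv, inv_inv]
  congr 1
  ext ⟨i, j⟩
  rw [PiLp.smul_apply, outer_apply, hvi, hvi, star_smul, smul_mul, mul_smul, hP.1,
    ← rankOneProjections.diag_smul_eq hP, ← hr, inv_smul_smul₀ hr0, smul_inv_smul₀ hr0]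

/-- Apart from transitivity, which needs a separate argument for the octonions, the affine chart
satisfies all requirements. -/
theorem homogeneousChart (hT : IsTripleAssociative K n)
    (htr : ∀ X ∈ projectiveModel K (n + 1), ∃ g : MatrixSpace K (n + 1) ≃ₗᵢ[ℝ] MatrixSpace K (n + 1),
      g '' projectiveModel K (n + 1) = projectiveModel K (n + 1) ∧ g (basePoint K n) = X) :
    HomogeneousChart (projectiveModel K (n + 1)) (affineChart K n) (affineCoordinates K n)
      {X | ⟪(1 : K), X (0, 0)⟫ ≠ 0} (chartIsometry K n) (chartSecond K n) where
  isOpen := isOpen_ne_fun (by fun_prop) continuous_const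
  contDiff := contDiff_quadraticQuotient _ _ _
  contDiffOn := by
    have h1 : ContDiff ℝ ∞ fun X : MatrixSpace K (n + 1) => ⟪(1 : K), X (0, 0)⟫ :=
      contDiff_const.inner ℝ (by fun_prop)
    refine (PiLp.contDiff_toLp).comp_contDiffOn (contDiffOn_pi.2 fun i => ?_)
    exact (h1.contDiffOn.inv fun X hX => hX).smul (by fun_prop)
  mem x := by
    refine ⟨?_, ?_⟩
    · rw [affineChart_eq]
      exact mem_image_of_mem _ (smul_outer_mem_rankOneProjections hT (by simp))
    · simp only [mem_ofPred_eq, affineChart_zero_zero, inner_smul_right, inner_one_one]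
      positivity
  left_inv x := by
    ext i
    simp only [affineCoordinates, affineChart_zero_zero, affineChart_succ_zero, inner_smul_right,
      inner_one_one, _root_.mul_one]
    exact inv_smul_smul₀ (by positivity) _
  right_inv X hX := affineChart_affineCoordinates hX.1 hX.2
  transitive X hX := by
    rw [affineChart_zero]
    exact htr X hX
  fderiv_zero := fderiv_quadraticQuotient_zero _ _ _
  fderiv_fderiv_zero u v := fderiv_fderiv_quadraticQuotient_zero _ _ _ u v
  normal u v w := by
    change ⟪(-2 * ⟪u, v⟫) • basePoint K n + (chartQuad K n u v + chartQuad K n v u),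
      chartLin K n w⟫ = 0
    simp only [inner_matrixSpace, Fin.sum_univ_succ, chartLin_apply, PiLp.add_apply, PiLp.smul_apply,
      basePoint_apply, chartQuad_apply, baseVector_zero, baseVector_succ, consZero_zero,
      consZero_succ, star_zero, star_one, mul_one, one_mul, mul_zero, zero_mul, smul_zero, add_zero,
      zero_add, inner_zero_left, inner_zero_right, Finset.sum_const_zero]

end EuclideanComposition

/-! ### The curvature of a projective space -/

namespace EuclideanComposition

variable {K : Type} [NormedAddCommGroup K] [InnerProductSpace ℝ K] [Mul K] [One K] [Star K]
  {n : ℕ} [EuclideanComposition K]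

/-- The operator `y ↦ x (x^* y)` of a vector `x`, bracketed as `(x x^*) y`. Up to the factor `‖x‖²`
it is the orthogonal projection onto the line spanned by `x` over `K`. -/
def lineOperator (x : PiLp 2 (fun _ : Fin n => K)) :
    PiLp 2 (fun _ : Fin n => K) →ₗ[ℝ] PiLp 2 (fun _ : Fin n => K) where
  toFun y := WithLp.toLp 2 fun i => ∑ j, (x i * star (x j)) * y j
  map_add' y z := by
    ext i
    simp [mul_add, Finset.sum_add_distrib]
  map_smul' r y := by
    ext i
    simp [mul_smul, Finset.smul_sum]

theorem lineOperator_apply (x y : PiLp 2 (fun _ : Fin n => K)) (i : Fin n) :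
    lineOperator x y i = ∑ j, (x i * star (x j)) * y j := rfl

theorem lineOperator_self (x : PiLp 2 (fun _ : Fin n => K)) :
    lineOperator x x = ‖x‖ ^ 2 • x := by
  ext i
  rw [lineOperator_apply, PiLp.smul_apply, PiLp.norm_sq_eq_of_L2, Finset.sum_smul]
  exact Finset.sum_congr rfl fun j _ => mul_star_mul_self _ _

theorem inner_lineOperator (x y z : PiLp 2 (fun _ : Fin n => K)) :
    ⟪lineOperator x y, z⟫ = ⟪y, lineOperator x z⟫ := by
  simp only [PiLp.inner_apply, lineOperator_apply, sum_inner, inner_sum]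
  rw [Finset.sum_comm]
  refine Finset.sum_congr rfl fun i _ => Finset.sum_congr rfl fun j _ => ?_
  rw [inner_mul_left, star_mul, star_star]

theorem lineOperator_lineOperator (hT : IsTripleAssociative K n)
    (x y : PiLp 2 (fun _ : Fin n => K)) :
    lineOperator x (lineOperator x y) = ‖x‖ ^ 2 • lineOperator x y := by
  ext i
  simp only [lineOperator_apply, PiLp.smul_apply, mul_sum]
  rw [PiLp.norm_sq_eq_of_L2, Finset.sum_smul]
  refine Finset.sum_congr rfl fun j _ => ?_
  rw [Finset.smul_sum]
  exact Finset.sum_congr rfl fun k _ => hT x i j k (y k)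

/-- The line over `K` spanned by a nonzero vector has the dimension of `K`. -/
theorem finrank_range_lineOperator (hT : IsTripleAssociative K n)
    {x : PiLp 2 (fun _ : Fin n => K)} (hx : x ≠ 0) :
    Module.finrank ℝ (LinearMap.range (lineOperator x)) = Module.finrank ℝ K := by
  classical
  obtain ⟨j, hj⟩ : ∃ j, x j ≠ 0 := by
    by_contra! h
    exact hx (PiLp.ext h)
  let T : K →ₗ[ℝ] PiLp 2 (fun _ : Fin n => K) :=
    { toFun := fun c => WithLp.toLp 2 fun i => (x i * star (x j)) * c
      map_add' := fun c d => by ext i; simp [mul_add]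
      map_smul' := fun r c => by ext i; simp [mul_smul] }
  have hTi : ∀ c i, T c i = (x i * star (x j)) * c := fun c i => rfl
  have hnj : ‖x j‖ ^ 2 ≠ 0 := by
    have : 0 < ‖x j‖ := norm_pos_iff.2 hj
    positivity
  have hinj : Function.Injective T := by
    rw [← LinearMap.ker_eq_bot, LinearMap.ker_eq_bot']
    intro c hc
    have := congrArg (fun y => y j) hc
    simp only [hTi, mul_star_self, smul_mul, one_mul, PiLp.zero_apply] at this
    exact (smul_eq_zero.1 this).resolve_left hnj
  have hrange : LinearMap.range T = LinearMap.range (lineOperator x) := by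
    apply le_antisymm
    · rintro _ ⟨c, rfl⟩
      refine ⟨WithLp.toLp 2 (Pi.single j c), ?_⟩
      ext i
      rw [lineOperator_apply, hTi, Finset.sum_eq_single j]
      · simp
      · intro k _ hk
        simp [hk, mul_zero]
      · simp
    · rintro _ ⟨y, rfl⟩
      refine ⟨(‖x j‖ ^ 2)⁻¹ • lineOperator x y j, ?_⟩
      ext i
      rw [hTi, mul_smul, lineOperator_apply, lineOperator_apply, mul_sum, Finset.smul_sum]
      refine Finset.sum_congr rfl fun k _ => ?_
      rw [hT x i j k, inv_smul_smul₀ hnj]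
  rw [← hrange, LinearMap.finrank_range_of_inj hinj]

theorem inner_chartQuad (u v u' v' : PiLp 2 (fun _ : Fin n => K)) :
    ⟪chartQuad K n u v, chartQuad K n u' v'⟫ =
      1 / 2 * ∑ i, ∑ j, ⟪u i * star (v j), u' i * star (v' j)⟫ := by
  rw [inner_matrixSpace]
  simp only [Fin.sum_univ_succ, chartQuad_apply, consZero_zero,
    consZero_succ, star_zero, mul_zero, zero_mul, zero_add,
    inner_zero_left, Finset.sum_const_zero, inner_smul_left, inner_smul_right,
    ← Finset.mul_sum, RCLike.conj_to_real]
  rw [← _root_.mul_assoc, ← mul_inv, Real.mul_self_sqrt zero_le_two]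
  norm_num

theorem inner_basePoint_chartQuad (u v : PiLp 2 (fun _ : Fin n => K)) :
    ⟪basePoint K n, chartQuad K n u v⟫ = 0 := by
  rw [inner_matrixSpace]
  simp only [Fin.sum_univ_succ, chartQuad_apply, basePoint_apply, consZero_zero, baseVector_succ,
    consZero_succ, star_zero, mul_zero, smul_zero, zero_add,
    inner_zero_left, inner_zero_right, Finset.sum_const_zero]

theorem inner_basePoint_self : ⟪basePoint K n, basePoint K n⟫ = 1 / 2 := by
  rw [inner_matrixSpace]
  simp only [Fin.sum_univ_succ, basePoint_apply, baseVector_zero, baseVector_succ,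
    star_zero, star_one, mul_zero, mul_one,
    inner_zero_left, inner_smul_left, inner_smul_right, inner_one_one,
    RCLike.conj_to_real, _root_.mul_one]
  rw [← mul_inv, Real.mul_self_sqrt zero_le_two]
  norm_num

theorem inner_chartSecond (u v u' v' : PiLp 2 (fun _ : Fin n => K)) :
    ⟪chartSecond K n u v, chartSecond K n u' v'⟫ = 2 * ⟪u, v⟫ * ⟪u', v'⟫ +
      ⟪chartQuad K n u v + chartQuad K n v u, chartQuad K n u' v' + chartQuad K n v' u'⟫ := by
  change ⟪(-2 * ⟪u, v⟫) • basePoint K n + (chartQuad K n u v + chartQuad K n v u),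
    (-2 * ⟪u', v'⟫) • basePoint K n + (chartQuad K n u' v' + chartQuad K n v' u')⟫ = _
  have h : ∀ u v : PiLp 2 (fun _ : Fin n => K), ⟪chartQuad K n u v, basePoint K n⟫ = 0 :=
    fun u v => by rw [real_inner_comm, inner_basePoint_chartQuad]
  simp only [inner_add_left, inner_add_right, inner_smul_left, inner_smul_right, h,
    inner_basePoint_chartQuad, inner_basePoint_self, RCLike.conj_to_real]
  ring

/-- The numerator of the sectional curvature of a projective space. -/
theorem gramDet_mul_gaussCurvature {x y : PiLp 2 (fun _ : Fin n => K)} (h : gramDet x y ≠ 0) :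
    gramDet x y * HomogeneousChart.gaussCurvature (chartSecond K n) x y =
      ‖x‖ ^ 2 * ‖y‖ ^ 2 + 3 * ⟪lineOperator x y, y⟫ - 4 * ⟪x, y⟫ ^ 2 := by
  rw [HomogeneousChart.gaussCurvature, mul_div_cancel₀ _ h, inner_chartSecond, inner_chartSecond]
  have hsq : ∀ z : PiLp 2 (fun _ : Fin n => K), ‖z‖ ^ 2 = ∑ i, ‖z i‖ ^ 2 :=
    fun z => PiLp.norm_sq_eq_of_L2 _ z
  -- The three types of products of entries that occur in the norms of the second fundamental form.
  have h1 : ∑ i, ∑ j, ⟪x i * star (x j), y i * star (y j)⟫ = ⟪lineOperator x y, y⟫ := by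
    simp only [PiLp.inner_apply, lineOperator_apply, sum_inner]
    refine Finset.sum_congr rfl fun i _ => Finset.sum_congr rfl fun j _ => ?_
    rw [← inner_mul_right]
  have h2 : ∀ x y : PiLp 2 (fun _ : Fin n => K),
      ∑ i, ∑ j, ⟪x i * star (y j), x i * star (y j)⟫ = ‖x‖ ^ 2 * ‖y‖ ^ 2 := by
    intro x y
    rw [hsq, hsq, Finset.sum_mul_sum]
    refine Finset.sum_congr rfl fun i _ => Finset.sum_congr rfl fun j _ => ?_
    rw [real_inner_self_eq_norm_sq, norm_mul, norm_star, mul_pow]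
  have h3 : ∑ i, ∑ j, ⟪x i * star (y j), y i * star (x j)⟫ =
      2 * ⟪x, y⟫ ^ 2 - ⟪lineOperator x y, y⟫ := by
    rw [← h1, eq_sub_iff_add_eq, ← Finset.sum_add_distrib, sq, PiLp.inner_apply,
      Finset.sum_mul_sum, Finset.mul_sum]
    refine Finset.sum_congr rfl fun i _ => ?_
    rw [← Finset.sum_add_distrib, Finset.mul_sum]
    refine Finset.sum_congr rfl fun j _ => ?_
    rw [inner_mul_mul_add, inner_star_star, real_inner_comm (x j)]
    ring
  have h4 : ∑ i, ∑ j, ⟪y i * star (x j), x i * star (y j)⟫ =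
      2 * ⟪x, y⟫ ^ 2 - ⟪lineOperator x y, y⟫ := by
    rw [← h3]
    exact Finset.sum_congr rfl fun i _ => Finset.sum_congr rfl fun j _ => real_inner_comm _ _
  simp only [inner_add_left, inner_add_right, inner_chartQuad, h1, h2, h3, h4]
  rw [real_inner_self_eq_norm_sq, real_inner_self_eq_norm_sq]
  ring

variable [FiniteDimensional ℝ K]

theorem norm_sq_starProjection_lineOperator (hT : IsTripleAssociative K n)
    {x : PiLp 2 (fun _ : Fin n => K)} (hx : x ≠ 0) (y : PiLp 2 (fun _ : Fin n => K)) :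
    ‖x‖ ^ 2 * ‖(LinearMap.range (lineOperator x)).starProjection y‖ ^ 2 =
      ⟪lineOperator x y, y⟫ := by
  have hx0 : ‖x‖ ^ 2 ≠ 0 := by
    have : 0 < ‖x‖ := norm_pos_iff.2 hx
    positivity
  have hP : (LinearMap.range (lineOperator x)).starProjection y =
      (‖x‖ ^ 2)⁻¹ • lineOperator x y := by
    refine Submodule.eq_starProjection_of_mem_of_inner_eq_zero
      (Submodule.smul_mem _ _ (LinearMap.mem_range_self _ _)) ?_
    rintro _ ⟨z, rfl⟩
    rw [← inner_lineOperator, map_sub, map_smul, lineOperator_lineOperator hT,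
      inv_smul_smul₀ hx0, sub_self, inner_zero_left]
  rw [hP, norm_smul, mul_pow, ← real_inner_self_eq_norm_sq (lineOperator x y), inner_lineOperator,
    lineOperator_lineOperator hT, inner_smul_right, ← inner_lineOperator, norm_inv, norm_pow,
    norm_norm, inv_pow]
  field_simp

/-- The subspace belonging to `x` is the line over `K` spanned by `x`. -/
theorem isQuarterPinchedBy (hT : IsTripleAssociative K n) {a : ℕ}
    (ha : Module.finrank ℝ K = a + 1) :
    IsQuarterPinchedBy a (HomogeneousChart.gaussCurvature (chartSecond K n)) := by
  intro x hx
  have hx0 : ‖x‖ ^ 2 ≠ 0 := by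
    have : 0 < ‖x‖ := norm_pos_iff.2 hx
    positivity
  refine ⟨LinearMap.range (lineOperator x), ⟨(‖x‖ ^ 2)⁻¹ • x, ?_⟩,
    (finrank_range_lineOperator hT hx).trans ha, fun y hy => ?_⟩
  · rw [map_smul, lineOperator_self, inv_smul_smul₀ hx0]
  · rw [gramDet_mul_gaussCurvature hy, ← norm_sq_starProjection_lineOperator hT hx]
    ring

end EuclideanComposition

/-- All values between `1` and `4` are attained, and no others. -/
theorem IsQuarterPinchedBy.image_eq_Icc {W : Type*} [NormedAddCommGroup W] [InnerProductSpace ℝ W]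
    [FiniteDimensional ℝ W] {a b : ℕ} {K : W → W → ℝ} (hK : IsQuarterPinchedBy a K)
    (hW : Module.finrank ℝ W = 1 + a + b) (ha : 0 < a) (hb : 0 < b) :
    {s | ∃ x y, gramDet x y ≠ 0 ∧ K x y = s} = Icc 1 4 := by
  ext s
  constructor
  · rintro ⟨x, y, h, rfl⟩
    have hx : x ≠ 0 := by
      rintro rfl
      simp [gramDet] at h
    obtain ⟨D, hxD, -, hD⟩ := hK x hx
    have h1 := hD y h
    have hpos : 0 < gramDet x y := lt_of_le_of_ne (gramDet_nonneg x y) (Ne.symm h)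
    have h2 : ‖D.starProjection y‖ ≤ ‖y‖ := D.norm_starProjection_apply_le y
    have h3 : ⟪x, y⟫ = ⟪x, D.starProjection y⟫ := by
      rw [← Submodule.inner_starProjection_left_eq_right,
        Submodule.starProjection_eq_self_iff.2 hxD]
    have h4 : ⟪x, D.starProjection y⟫ ^ 2 ≤ ‖x‖ ^ 2 * ‖D.starProjection y‖ ^ 2 := by
      rw [← mul_pow, ← sq_abs]
      exact pow_le_pow_left₀ (abs_nonneg _) (abs_real_inner_le_norm _ _) 2
    have hg : gramDet x y = ‖x‖ ^ 2 * ‖y‖ ^ 2 - ⟪x, y⟫ ^ 2 := by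
      rw [gramDet, real_inner_self_eq_norm_sq, real_inner_self_eq_norm_sq]
    have h5 : ‖D.starProjection y‖ ^ 2 ≤ ‖y‖ ^ 2 := pow_le_pow_left₀ (norm_nonneg _) h2 2
    have h6 : ‖x‖ ^ 2 * ‖D.starProjection y‖ ^ 2 ≤ ‖x‖ ^ 2 * ‖y‖ ^ 2 :=
      mul_le_mul_of_nonneg_left h5 (by positivity)
    constructor
    · refine le_of_mul_le_mul_left ?_ hpos
      rw [h1, hg]
      rw [h3] at *
      linarith
    · refine le_of_mul_le_mul_left ?_ hpos
      rw [h1, hg]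
      linarith
  · rintro ⟨h1, h4⟩
    have : Nontrivial W := Module.nontrivial_of_finrank_pos (R := ℝ) (by omega)
    obtain ⟨x, hx⟩ := exists_ne (0 : W)
    obtain ⟨D₁, D₂, -, -, -, hd1, hd2, hD⟩ := hK.exists_orthogonal hW hx
    have : Nontrivial D₁ := Module.nontrivial_of_finrank_pos (R := ℝ) (by omega)
    have : Nontrivial D₂ := Module.nontrivial_of_finrank_pos (R := ℝ) (by omega)
    obtain ⟨y, hy⟩ := exists_norm_eq D₁ (Real.sqrt_nonneg ((s - 1) / 3))
    obtain ⟨z, hz⟩ := exists_norm_eq D₂ (Real.sqrt_nonneg ((4 - s) / 3))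
    have hy2 : ‖(y : W)‖ ^ 2 = (s - 1) / 3 := by
      rw [Submodule.norm_coe, hy, Real.sq_sqrt (by linarith)]
    have hz2 : ‖(z : W)‖ ^ 2 = (4 - s) / 3 := by
      rw [Submodule.norm_coe, hz, Real.sq_sqrt (by linarith)]
    have hsum : ‖(y : W)‖ ^ 2 + ‖(z : W)‖ ^ 2 = 1 := by rw [hy2, hz2]; ring
    obtain ⟨h5, h6⟩ := hD 0 y z y.2 z.2
    refine ⟨x, (0 : ℝ) • x + y + z, ?_, ?_⟩
    · rw [h5, hsum, mul_one]
      have : 0 < ‖x‖ := norm_pos_iff.2 hx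
      positivity
    · rw [h6 (by rw [hsum]; exact one_pos), hsum, hy2]
      ring

/-! ### Transitivity in the associative case -/

/-- A linear isometry that maps a compact set into itself maps it onto itself, since some iterate
of it almost fixes any given point. -/
theorem LinearIsometryEquiv.image_eq_of_mapsTo {E : Type*} [NormedAddCommGroup E]
    [NormedSpace ℝ E] {M : Set E} (hM : IsCompact M) (g : E ≃ₗᵢ[ℝ] E) (hg : ∀ p ∈ M, g p ∈ M) :
    g '' M = M := by
  refine Subset.antisymm (by rintro _ ⟨p, hp, rfl⟩; exact hg p hp) fun x hx => ?_
  have hmem : ∀ k, g^[k] x ∈ M := fun k => by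
    induction k with
    | zero => exact hx
    | succ k ih => rw [Function.iterate_succ_apply']; exact hg _ ih
  have hdist : ∀ k l, dist (g^[k] x) (g^[k + l] x) = dist x (g^[l] x) := fun k l => by
    induction k with
    | zero => simp
    | succ k ih =>
      rw [Nat.succ_add, Function.iterate_succ_apply', Function.iterate_succ_apply', g.dist_map, ih]
  rw [← (hM.image g.continuous).isClosed.closure_eq, Metric.mem_closure_iff]
  intro ε hε
  obtain ⟨y, -, ψ, hψ, hlim⟩ := hM.tendsto_subseq hmem
  obtain ⟨k, hk⟩ := Metric.cauchySeq_iff'.1 hlim.cauchySeq ε hε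
  have h1 := hk (k + 1) (by omega)
  have h2 : ψ k < ψ (k + 1) := hψ (by omega)
  obtain ⟨l, hl⟩ := Nat.exists_eq_add_of_lt h2
  refine ⟨g^[l + 1] x, ⟨g^[l] x, hmem l, (Function.iterate_succ_apply' _ _ _).symm⟩, ?_⟩
  rw [← hdist (ψ k), ← add_assoc, ← hl, dist_comm]
  exact h1

namespace EuclideanComposition

/-- Every unit vector is a row of an orthogonal matrix: reflect a basis vector to it. -/
theorem exists_orthogonal_row (k : Fin N) {v : Fin N → ℝ} (hv : ∑ i, v i ^ 2 = 1) :
    ∃ R : Fin N → Fin N → ℝ, (∀ a c, ∑ i, R i a * R i c = if a = c then 1 else 0) ∧ R k = v := by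
  let e := EuclideanSpace.basisFun (Fin N) ℝ
  let u : EuclideanSpace ℝ (Fin N) := WithLp.toLp 2 v
  have hu : ‖e k‖ = ‖u‖ := by
    rw [e.norm_eq_one, EuclideanSpace.norm_eq]
    simp [u, hv]
  let h := Submodule.reflection (Submodule.span ℝ {e k - u})ᗮ
  have hk : h (e k) = u := Submodule.reflection_sub hu
  refine ⟨fun i a => h (e i) a, fun a c => ?_, by
    funext a
    change h (e k) a = v a
    rw [hk]⟩
  have h1 := (e.map h).sum_inner_mul_inner (e a) (e c)
  have h2 : ∀ i b, h (e i) b = ⟪e b, (e.map h) i⟫ := fun i b => by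
    rw [OrthonormalBasis.map_apply]
    exact (EuclideanSpace.basisFun_inner _ _ _ _).symm
  have h3 : ⟪e a, e c⟫ = if a = c then (1 : ℝ) else 0 := e.inner_eq_ite a c
  rw [← h3, ← h1]
  refine Finset.sum_congr rfl fun i _ => ?_
  change h (e i) a * h (e i) c = _
  rw [h2, h2, real_inner_comm (e c)]

section RealOrthogonal

variable {K : Type} [NormedAddCommGroup K] [InnerProductSpace ℝ K] {N : ℕ} {R : Fin N → Fin N → ℝ}

theorem exists_linearIsometryEquiv [FiniteDimensional ℝ K]
    (f : MatrixSpace K N →ₗ[ℝ] MatrixSpace K N) (hf : ∀ X, ‖f X‖ = ‖X‖) :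
    ∃ g : MatrixSpace K N ≃ₗᵢ[ℝ] MatrixSpace K N, ∀ X, g X = f X :=
  ⟨LinearIsometry.toLinearIsometryEquiv ⟨f, hf⟩ rfl, fun _ => rfl⟩

/-- Bilinear expressions are invariant under orthogonal substitutions. -/
theorem sum_bilinear_orthogonal {G : Type*} [AddCommGroup G] [Module ℝ G] (f : K →ₗ[ℝ] K →ₗ[ℝ] G)
    (hR : ∀ a c, ∑ i, R i a * R i c = if a = c then 1 else 0) (u w : Fin N → K) :
    ∑ i, f (∑ a, R i a • u a) (∑ c, R i c • w c) = ∑ a, f (u a) (w a) := by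
  simp only [map_sum, LinearMap.sum_apply, map_smul, LinearMap.smul_apply]
  rw [Finset.sum_comm]
  have h : ∀ c, ∑ i, R i c • ∑ a, R i a • f (u a) (w c) = f (u c) (w c) := by
    intro c
    simp only [Finset.smul_sum, smul_smul]
    rw [Finset.sum_comm]
    simp only [← Finset.sum_smul, hR]
    simp
  exact Finset.sum_congr rfl fun c _ => h c

/-- The matrix `R X Rᵀ`. -/
def conjLin (K : Type) [NormedAddCommGroup K] [InnerProductSpace ℝ K] (R : Fin N → Fin N → ℝ) :
    MatrixSpace K N →ₗ[ℝ] MatrixSpace K N where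
  toFun X := WithLp.toLp 2 fun p => ∑ a, R p.1 a • ∑ b, R p.2 b • X (a, b)
  map_add' X Y := by
    ext p
    simp [Finset.sum_add_distrib]
  map_smul' r X := by
    ext p
    simp only [PiLp.smul_apply, RingHom.id_apply, Finset.smul_sum, smul_smul]
    exact Finset.sum_congr rfl fun a _ => Finset.sum_congr rfl fun b _ => by congr 1; ring

theorem conjLin_apply (X : MatrixSpace K N) (i j : Fin N) :
    conjLin K R X (i, j) = ∑ a, R i a • ∑ b, R j b • X (a, b) := rfl

theorem norm_conjLin (hR : ∀ a c, ∑ i, R i a * R i c = if a = c then 1 else 0)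
    (X : MatrixSpace K N) : ‖conjLin K R X‖ = ‖X‖ := by
  have h : ∀ u : Fin N → K, ∑ i, ‖∑ a, R i a • u a‖ ^ 2 = ∑ a, ‖u a‖ ^ 2 := fun u => by
    simpa only [innerₗ_apply_apply, real_inner_self_eq_norm_sq] using
      sum_bilinear_orthogonal (innerₗ K) hR u u
  rw [← sq_eq_sq₀ (norm_nonneg _) (norm_nonneg _), norm_sq_matrixSpace, norm_sq_matrixSpace,
    Finset.sum_comm]
  simp only [conjLin_apply, h]
  rw [Finset.sum_comm]
  simp only [h]

end RealOrthogonal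

section Congruence

variable {K : Type} [NormedAddCommGroup K] [InnerProductSpace ℝ K] [Mul K] [One K] [Star K] {N : ℕ}

/-- Some isometry of the space of matrices that preserves the projective space maps `P` to `Q`. -/
def IsCongruent (P Q : MatrixSpace K N) : Prop :=
  ∃ g : MatrixSpace K N ≃ₗᵢ[ℝ] MatrixSpace K N,
    (∀ X ∈ rankOneProjections K N, g X ∈ rankOneProjections K N) ∧ g P = Q

theorem IsCongruent.trans {P Q R : MatrixSpace K N} (h1 : IsCongruent P Q) (h2 : IsCongruent Q R) :
    IsCongruent P R := by
  obtain ⟨g, hg, rfl⟩ := h1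
  obtain ⟨g', hg', rfl⟩ := h2
  exact ⟨g.trans g', fun X hX => hg' _ (hg X hX), rfl⟩

theorem IsCongruent.mem {P Q : MatrixSpace K N} (h : IsCongruent P Q)
    (hP : P ∈ rankOneProjections K N) : Q ∈ rankOneProjections K N := by
  obtain ⟨g, hg, rfl⟩ := h
  exact hg P hP

end Congruence

variable {K : Type} [NormedAddCommGroup K] [InnerProductSpace ℝ K] [Mul K] [One K] [Star K]
  [EuclideanComposition K] {N : ℕ}

section Orthogonal

variable {R : Fin N → Fin N → ℝ}

theorem conjLin_mem (hR : ∀ a c, ∑ i, R i a * R i c = if a = c then 1 else 0)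
    {X : MatrixSpace K N} (hX : X ∈ rankOneProjections K N) :
    conjLin K R X ∈ rankOneProjections K N := by
  refine ⟨fun i j => ?_, fun i j => ?_, ?_⟩
  · simp only [conjLin_apply, star_sum, star_smul, hX.1, Finset.smul_sum]
    rw [Finset.sum_comm]
    refine Finset.sum_congr rfl fun a _ => Finset.sum_congr rfl fun b _ => ?_
    rw [smul_smul, smul_smul, _root_.mul_comm]
  · have h1 : ∀ k, conjLin K R X (i, k) * conjLin K R X (k, j) =
        ∑ a, R i a • ((∑ b, R k b • X (a, b)) * conjLin K R X (k, j)) := by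
      intro k
      rw [conjLin_apply X i k, sum_mul]
      exact Finset.sum_congr rfl fun a _ => smul_mul _ _ _
    simp only [h1]
    rw [Finset.sum_comm, conjLin_apply]
    refine Finset.sum_congr rfl fun a _ => ?_
    rw [← Finset.smul_sum]
    congr 1
    have h := sum_bilinear_orthogonal (mulBilin K) hR (fun b => X (a, b))
      (fun c => ∑ b, R j b • X (c, b))
    refine Eq.trans h ?_
    change ∑ b, X (a, b) * ∑ d, R j d • X (b, d) = _
    simp only [mul_sum, mul_smul]
    rw [Finset.sum_comm]
    refine Finset.sum_congr rfl fun d _ => ?_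
    rw [← Finset.smul_sum, hX.2.1]
  · simp only [conjLin_apply, Finset.smul_sum, smul_smul]
    rw [← hX.2.2, Finset.sum_comm]
    refine Finset.sum_congr rfl fun a _ => ?_
    rw [Finset.sum_comm]
    simp only [← Finset.sum_smul, hR]
    simp

theorem isCongruent_conjLin [FiniteDimensional ℝ K]
    (hR : ∀ a c, ∑ i, R i a * R i c = if a = c then 1 else 0) (P : MatrixSpace K N) :
    IsCongruent P (conjLin K R P) := by
  obtain ⟨g, hg⟩ := exists_linearIsometryEquiv (conjLin K R) (norm_conjLin hR)
  exact ⟨g, fun X hX => by rw [hg]; exact conjLin_mem hR hX, hg P⟩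

end Orthogonal

section Transitivity

variable {n : ℕ} {P : MatrixSpace K (n + 1)}

/-- A point of the projective space is the base point if its first diagonal entry is one. -/
theorem eq_outer_of_diag_eq_one (hP : P ∈ rankOneProjections K (n + 1))
    (h : ⟪(1 : K), P (0, 0)⟫ = 1) : P = outer K (n + 1) (baseVector K n) (baseVector K n) := by
  have h0 : P (0, 0) = 1 := by rw [rankOneProjections.diag_eq hP, h, one_smul]
  have hcol : ∀ i : Fin n, P (i.succ, 0) = 0 := by
    have h1 := rankOneProjections.sum_norm_sq_col hP 0
    rw [Fin.sum_univ_succ, h0, norm_one, inner_one_one, one_pow, add_eq_left,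
      Finset.sum_eq_zero_iff_of_nonneg (fun i _ => by positivity)] at h1
    intro i
    simpa using h1 i (Finset.mem_univ _)
  have hcol' : ∀ i, P (i, 0) = baseVector K n i := by
    intro i
    induction i using Fin.cases with
    | zero => exact h0
    | succ i => exact hcol i
  ext ⟨i, j⟩
  have h2 := rankOneProjections.diag_smul_eq hP i j 0
  rw [h, one_smul, ← hP.1 j 0, hcol', hcol'] at h2
  exact h2

variable [FiniteDimensional ℝ K]

/-- A real point of the projective space is congruent to the base point. -/
theorem isCongruent_of_real (hP : P ∈ rankOneProjections K (n + 1)) {v : Fin (n + 1) → ℝ}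
    (hv : ∑ i, v i ^ 2 = 1) (hPv : ∀ i j, P (i, j) = (v i * v j) • (1 : K)) :
    IsCongruent P (outer K (n + 1) (baseVector K n) (baseVector K n)) := by
  obtain ⟨R, hR, hRv⟩ := exists_orthogonal_row 0 hv
  have h := isCongruent_conjLin hR P
  rwa [eq_outer_of_diag_eq_one (h.mem hP)] at h
  have h1 : conjLin K R P (0, 0) = ((∑ i, v i ^ 2) * ∑ i, v i ^ 2) • (1 : K) := by
    rw [conjLin_apply, Finset.sum_mul_sum, Finset.sum_smul]
    simp only [hPv, hRv, Finset.smul_sum, smul_smul, Finset.sum_smul]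
    refine Finset.sum_congr rfl fun a _ => Finset.sum_congr rfl fun b _ => ?_
    congr 1
    ring
  rw [h1, hv, _root_.mul_one, one_smul, inner_one_one]

theorem exists_equiv_of_isCongruent
    (h : ∀ P ∈ rankOneProjections K (n + 1),
      IsCongruent P (outer K (n + 1) (baseVector K n) (baseVector K n)))
    (X : MatrixSpace K (n + 1)) (hX : X ∈ projectiveModel K (n + 1)) :
    ∃ g : MatrixSpace K (n + 1) ≃ₗᵢ[ℝ] MatrixSpace K (n + 1),
      g '' projectiveModel K (n + 1) = projectiveModel K (n + 1) ∧ g (basePoint K n) = X := by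
  obtain ⟨P, hP, rfl⟩ := hX
  obtain ⟨g, hg, hgP⟩ := h P hP
  have hM : g '' projectiveModel K (n + 1) = projectiveModel K (n + 1) := by
    refine g.image_eq_of_mapsTo isCompact_projectiveModel ?_
    rintro _ ⟨Q, hQ, rfl⟩
    exact ⟨g Q, hg Q hQ, by simp⟩
  refine ⟨g.symm, symm_image_eq hM, ?_⟩
  rw [basePoint, ← hgP]
  simp

/-- The geodesic symmetry at the base point changes the signs of the entries of the first row and
of the first column, except for the diagonal entry. -/
theorem exists_symmetry (K : Type) [NormedAddCommGroup K] [InnerProductSpace ℝ K] [Mul K] [One K]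
    [Star K] [EuclideanComposition K] [FiniteDimensional ℝ K] (n : ℕ) :
    ∃ σ : MatrixSpace K (n + 1) ≃ₗᵢ[ℝ] MatrixSpace K (n + 1),
      σ '' projectiveModel K (n + 1) = projectiveModel K (n + 1) ∧ σ (basePoint K n) = basePoint K n ∧
        ∀ x, σ (chartIsometry K n x) = -chartIsometry K n x := by
  let s : Fin (n + 1) → ℝ := Fin.cons (-1) 1
  have hs : ∀ i, s i * s i = 1 := fun i => by
    induction i using Fin.cases <;> simp [s]
  let R : Fin (n + 1) → Fin (n + 1) → ℝ := fun i j => if i = j then s i else 0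
  have hR : ∀ a c, ∑ i, R i a * R i c = if a = c then 1 else 0 := by
    intro a c
    by_cases h : a = c
    · subst h; simp [R, hs]
    · simpa [R, h] using fun h2 => absurd h2.symm h
  have hRX : ∀ (X : MatrixSpace K (n + 1)) i j, conjLin K R X (i, j) = (s i * s j) • X (i, j) := by
    intro X i j
    rw [conjLin_apply]
    simp [R, smul_smul]
  obtain ⟨σ, hσ⟩ := exists_linearIsometryEquiv (conjLin K R) (norm_conjLin hR)
  refine ⟨σ, ?_, ?_, fun x => ?_⟩
  · refine σ.image_eq_of_mapsTo isCompact_projectiveModel ?_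
    rintro _ ⟨Q, hQ, rfl⟩
    exact ⟨σ Q, by rw [hσ]; exact conjLin_mem hR hQ, by simp⟩
  · ext ⟨i, j⟩
    rw [hσ, hRX, basePoint_apply]
    induction i using Fin.cases <;> induction j using Fin.cases <;>
      simp [s, star_zero, zero_mul, mul_zero]
  · ext ⟨i, j⟩
    change σ (chartLin K n x) (i, j) = -chartLin K n x (i, j)
    rw [hσ, hRX, chartLin_apply]
    induction i using Fin.cases <;> induction j using Fin.cases <;>
      simp [s, star_zero, zero_mul, mul_zero]

/-- Over an associative algebra, a diagonal unitary matrix makes the entries real. -/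
theorem isCongruent_of_assoc (hassoc : ∀ a b c : K, (a * b) * c = a * (b * c))
    (hP : P ∈ rankOneProjections K (n + 1)) :
    IsCongruent P (outer K (n + 1) (baseVector K n) (baseVector K n)) := by
  classical
  obtain ⟨k, hk⟩ : ∃ k, ⟪(1 : K), P (k, k)⟫ ≠ 0 := by
    by_contra! h
    have := rankOneProjections.sum_diag hP
    simp [h] at this
  set r := ⟪(1 : K), P (k, k)⟫ with hr
  have hr0 : 0 < r := lt_of_le_of_ne (rankOneProjections.diag_nonneg hP k) (Ne.symm hk)
  let c : Fin (n + 1) → K := fun i => if P (i, k) = 0 then 1 else ‖P (i, k)‖⁻¹ • star (P (i, k))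
  have hc : ∀ i, ‖c i‖ = 1 := by
    intro i
    by_cases h : P (i, k) = 0
    · simp [c, h, norm_one]
    · simp [c, h, norm_smul, norm_star]
  have hcP : ∀ i, c i * P (i, k) = ‖P (i, k)‖ • (1 : K) := by
    intro i
    by_cases h : P (i, k) = 0
    · simp [c, h, mul_zero]
    · have h2 : ‖P (i, k)‖ ≠ 0 := norm_ne_zero_iff.2 h
      simp only [c, h, if_false, smul_mul, star_mul_self, smul_smul]
      congr 1
      field_simp
  let f : MatrixSpace K (n + 1) →ₗ[ℝ] MatrixSpace K (n + 1) :=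
    { toFun := fun X => WithLp.toLp 2 fun p => (c p.1 * X p) * star (c p.2)
      map_add' := fun X Y => by ext p; simp [mul_add, add_mul]
      map_smul' := fun t X => by ext p; simp [mul_smul, smul_mul] }
  have hfX : ∀ X i j, f X (i, j) = (c i * X (i, j)) * star (c j) := fun X i j => rfl
  obtain ⟨g, hg⟩ := exists_linearIsometryEquiv f fun X => by
    rw [← sq_eq_sq₀ (norm_nonneg _) (norm_nonneg _), norm_sq_matrixSpace, norm_sq_matrixSpace]
    simp [hfX, norm_mul, norm_star, hc]
  have hfm : ∀ X ∈ rankOneProjections K (n + 1), f X ∈ rankOneProjections K (n + 1) := by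
    intro X hX
    refine ⟨fun i j => ?_, fun i j => ?_, ?_⟩
    · rw [hfX, hfX, star_mul, star_mul, star_star, hX.1, hassoc]
    · have h : ∀ l, f X (i, l) * f X (l, j) = (c i * (X (i, l) * X (l, j))) * star (c j) := by
        intro l
        rw [hfX, hfX, hassoc (c l), hassoc (c i * X (i, l)), star_mul_mul, hc, one_pow, one_smul,
          ← hassoc, ← hassoc]
      simp only [h]
      rw [← sum_mul, ← mul_sum, hX.2.1, hfX]
    · have h : ∀ i, f X (i, i) = X (i, i) := by
        intro i
        rw [hfX, rankOneProjections.diag_eq hX, mul_smul, mul_one, smul_mul, mul_star_self, hc,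
          one_pow, one_smul]
      simp only [h]
      exact hX.2.2
  have hfP : f P ∈ rankOneProjections K (n + 1) := hfm P hP
  refine IsCongruent.trans (Q := f P) ⟨g, fun X hX => by rw [hg]; exact hfm X hX, hg P⟩ ?_
  refine isCongruent_of_real hfP (v := fun i => (√r)⁻¹ * ‖P (i, k)‖) ?_ fun i j => ?_
  · simp only [mul_pow, ← Finset.mul_sum, rankOneProjections.sum_norm_sq_col hP, ← hr, inv_pow,
      Real.sq_sqrt hr0.le]
    exact inv_mul_cancel₀ hk
  · have h1 : r • f P (i, j) = (‖P (i, k)‖ * ‖P (j, k)‖) • (1 : K) := by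
      rw [hfX, ← smul_mul, ← mul_smul, hr, rankOneProjections.diag_smul_eq hP, ← hassoc, hcP,
        hassoc, ← hP.1 j k, ← star_mul, hcP, star_smul, star_one, smul_mul, mul_smul, one_mul,
        smul_smul]
    have h2 : f P (i, j) = r⁻¹ • r • f P (i, j) := by rw [inv_smul_smul₀ hk]
    rw [h2, h1, smul_smul]
    congr 1
    have h3 : r⁻¹ = (√r)⁻¹ * (√r)⁻¹ := by rw [← mul_inv, Real.mul_self_sqrt hr0.le]
    rw [h3]
    ring

end Transitivity

end EuclideanComposition

namespace EuclideanComposition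

variable {K : Type} [NormedAddCommGroup K] [InnerProductSpace ℝ K] [Mul K] [One K] [Star K]
  [EuclideanComposition K]

/-! ### Transitivity on the octonionic projective plane -/

/-- The substitute, over a non-associative algebra, for the conjugation of a `3 × 3`-matrix by the
diagonal matrix with the entries `1`, `ā`, `a`: by the Moufang identities it is
compatible with the multiplication of Hermitian matrices with real diagonal. -/
def phaseLin (a : K) : MatrixSpace K 3 →ₗ[ℝ] MatrixSpace K 3 where
  toFun X := WithLp.toLp 2 fun p =>
    ![![X (0, 0), X (0, 1) * a, X (0, 2) * star a],
      ![star a * X (1, 0), X (1, 1), (star a * X (1, 2)) * star a],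
      ![a * X (2, 0), (a * X (2, 1)) * a, X (2, 2)]] p.1 p.2
  map_add' X Y := by
    ext ⟨i, j⟩
    fin_cases i <;> fin_cases j <;> simp [add_mul, mul_add]
  map_smul' r X := by
    ext ⟨i, j⟩
    fin_cases i <;> fin_cases j <;> simp [smul_mul, mul_smul]

theorem phaseLin_apply (a : K) (X : MatrixSpace K 3) (i j : Fin 3) : phaseLin a X (i, j) =
    ![![X (0, 0), X (0, 1) * a, X (0, 2) * star a],
      ![star a * X (1, 0), X (1, 1), (star a * X (1, 2)) * star a],
      ![a * X (2, 0), (a * X (2, 1)) * a, X (2, 2)]] i j := rfl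

theorem norm_phaseLin_apply {a : K} (ha : ‖a‖ = 1) (X : MatrixSpace K 3) (i j : Fin 3) :
    ‖phaseLin a X (i, j)‖ = ‖X (i, j)‖ := by
  rw [phaseLin_apply]
  fin_cases i <;> fin_cases j <;> simp [norm_mul, norm_star, ha]

theorem phaseLin_diag (a : K) (X : MatrixSpace K 3) (i : Fin 3) :
    phaseLin a X (i, i) = X (i, i) := by
  rw [phaseLin_apply]
  fin_cases i <;> rfl

/-- The off-diagonal entries of the idempotent equation follow from the Moufang identities for `a`. -/
theorem phaseLin_mem {a : K} (ha : ‖a‖ = 1) {X : MatrixSpace K 3}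
    (hX : X ∈ rankOneProjections K 3) : phaseLin a X ∈ rankOneProjections K 3 := by
  have hflex : ∀ b x : K, b * (x * b) = (b * x) * b := fun b x => by
    have h := moufang_middle b 1 x
    rwa [mul_one, one_mul] at h
  have hherm : ∀ i j, star (phaseLin a X (i, j)) = phaseLin a X (j, i) := by
    intro i j
    rw [phaseLin_apply, phaseLin_apply]
    fin_cases i <;> fin_cases j <;> simp [star_mul, star_star, hX.1, hflex]
  have hswap : ∀ i j, ∑ k, phaseLin a X (i, k) * phaseLin a X (k, j) = phaseLin a X (i, j) →
      ∑ k, phaseLin a X (j, k) * phaseLin a X (k, i) = phaseLin a X (j, i) := by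
    intro i j h
    have h2 := congrArg star h
    simpa only [star_sum, star_mul, hherm] using h2
  have hsum : ∀ i j, X (i, 0) * X (0, j) + X (i, 1) * X (1, j) + X (i, 2) * X (2, j) = X (i, j) :=
    fun i j => by rw [← hX.2.1 i j, Fin.sum_univ_three]
  have hreal : ∀ (i : Fin 3) (x y : K), X (i, i) * (x * y) = (X (i, i) * x) * y := by
    intro i x y
    rw [rankOneProjections.diag_eq hX, smul_mul, smul_mul, one_mul, one_mul, smul_mul]
  have hcomm : ∀ (i : Fin 3) (x : K), x * X (i, i) = X (i, i) * x := by
    intro i x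
    rw [rankOneProjections.diag_eq hX, smul_mul, mul_smul, one_mul, mul_one]
  have h01 : (X (0, 2) * star a) * ((a * X (2, 1)) * a) = (X (0, 2) * X (2, 1)) * a := by
    rw [mul_star_mul_mul_mul, ha, one_pow, one_smul]
  have h02 : (X (0, 1) * a) * ((star a * X (1, 2)) * star a) = (X (0, 1) * X (1, 2)) * star a := by
    have h := mul_star_mul_mul_mul (X (0, 1)) (X (1, 2)) (star a)
    rwa [star_star, norm_star, ha, one_pow, one_smul] at h
  have h12 : (star a * X (1, 0)) * (X (0, 2) * star a) =
      (star a * (X (1, 0) * X (0, 2))) * star a := moufang_middle _ _ _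
  have i01 : ∑ k, phaseLin a X (0, k) * phaseLin a X (k, 1) = phaseLin a X (0, 1) := by
    rw [Fin.sum_univ_three]
    change X (0, 0) * (X (0, 1) * a) + (X (0, 1) * a) * X (1, 1) +
      (X (0, 2) * star a) * ((a * X (2, 1)) * a) = X (0, 1) * a
    rw [h01, hcomm, hreal, hreal, ← add_mul, ← add_mul, ← hcomm 1, hsum]
  have i02 : ∑ k, phaseLin a X (0, k) * phaseLin a X (k, 2) = phaseLin a X (0, 2) := by
    rw [Fin.sum_univ_three]
    change X (0, 0) * (X (0, 2) * star a) + (X (0, 1) * a) * ((star a * X (1, 2)) * star a) +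
      (X (0, 2) * star a) * X (2, 2) = X (0, 2) * star a
    rw [h02, hcomm, hreal, hreal, ← add_mul, ← add_mul, ← hcomm 2, hsum]
  have i12 : ∑ k, phaseLin a X (1, k) * phaseLin a X (k, 2) = phaseLin a X (1, 2) := by
    rw [Fin.sum_univ_three]
    change (star a * X (1, 0)) * (X (0, 2) * star a) + X (1, 1) * ((star a * X (1, 2)) * star a) +
      ((star a * X (1, 2)) * star a) * X (2, 2) = (star a * X (1, 2)) * star a
    have hc : ∀ i, star a * (X (i, i) * X (1, 2)) = X (i, i) * (star a * X (1, 2)) := by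
      intro i
      rw [rankOneProjections.diag_eq hX, smul_mul, mul_smul, smul_mul, one_mul, one_mul]
    rw [h12, hcomm, hreal 1 (star a * X (1, 2)), hreal 2 (star a * X (1, 2)), ← hc, ← hc, ← add_mul, ← mul_add, ← add_mul, ← mul_add,
      ← hcomm 2, hsum]
  have idiag : ∀ i, ∑ k, phaseLin a X (i, k) * phaseLin a X (k, i) = phaseLin a X (i, i) := by
    intro i
    rw [phaseLin_diag, ← hX.2.1 i i]
    refine Finset.sum_congr rfl fun k _ => ?_
    rw [← hherm i k, ← hX.1 i k, mul_star_self, mul_star_self, norm_phaseLin_apply ha]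
  refine ⟨hherm, fun i j => ?_, by simpa only [phaseLin_diag] using hX.2.2⟩
  fin_cases i <;> fin_cases j
  exacts [idiag 0, i01, i02, hswap 0 1 i01, idiag 1, i12, hswap 0 2 i02, hswap 1 2 i12, idiag 2]

variable [FiniteDimensional ℝ K]

theorem isCongruent_phaseLin {a : K} (ha : ‖a‖ = 1) (P : MatrixSpace K 3) :
    IsCongruent P (phaseLin a P) := by
  obtain ⟨g, hg⟩ := exists_linearIsometryEquiv (phaseLin a) fun X => by
    rw [← sq_eq_sq₀ (norm_nonneg _) (norm_nonneg _), norm_sq_matrixSpace, norm_sq_matrixSpace]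
    simp only [norm_phaseLin_apply ha]
  exact ⟨g, fun X hX => by rw [hg]; exact phaseLin_mem ha hX, hg P⟩

/-- After the entry `P₀₁` has been made real, a rotation of the first two coordinates makes the
second diagonal entry zero. -/
theorem exists_isCongruent_diag_eq_zero {P : MatrixSpace K 3} (hP : P ∈ rankOneProjections K 3) :
    ∃ Q, IsCongruent P Q ∧ Q (1, 1) = 0 ∧ Q (2, 2) = P (2, 2) := by
  obtain ⟨a, ha, haP⟩ : ∃ a : K, ‖a‖ = 1 ∧ P (0, 1) * a = ‖P (0, 1)‖ • (1 : K) := by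
    by_cases h : P (0, 1) = 0
    · exact ⟨1, norm_one, by simp [h, zero_mul]⟩
    · have h2 : ‖P (0, 1)‖ ≠ 0 := norm_ne_zero_iff.2 h
      refine ⟨‖P (0, 1)‖⁻¹ • star (P (0, 1)), by simp [norm_smul, norm_star, h], ?_⟩
      rw [mul_smul, mul_star_self, smul_smul]
      congr 1
      field_simp
  have hPX := isCongruent_phaseLin ha P
  set X := phaseLin a P with hXdef
  have hX := hPX.mem hP
  have hX2 : X (2, 2) = P (2, 2) := phaseLin_diag a P 2
  set s := ‖P (0, 1)‖ with hs
  have hX01 : X (0, 1) = s • (1 : K) := haP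
  have hX10 : X (1, 0) = s • (1 : K) := by rw [← hX.1 0 1, hX01, star_smul, star_one]
  set p := ⟪(1 : K), X (0, 0)⟫ with hp
  set q := ⟪(1 : K), X (1, 1)⟫ with hq
  have hX00 : X (0, 0) = p • (1 : K) := rankOneProjections.diag_eq hX 0
  have hX11 : X (1, 1) = q • (1 : K) := rankOneProjections.diag_eq hX 1
  have hpq : s * s = p * q := by
    have h := rankOneProjections.diag_smul_eq hX 1 1 0
    rw [← hp, hX11, hX10, hX01, smul_mul, one_mul, smul_smul, smul_smul] at h
    have h2 := congrArg (fun z => ⟪(1 : K), z⟫) h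
    simp only [inner_smul_right, inner_one_one] at h2
    linarith
  by_cases hq0 : q = 0
  · exact ⟨X, hPX, by rw [hX11, hq0, zero_smul], hX2⟩
  have hd : 0 < q ^ 2 + s ^ 2 := by positivity
  set d := √(q ^ 2 + s ^ 2) with hdd
  have hd0 : d ≠ 0 := (Real.sqrt_pos.2 hd).ne'
  have hd2 : d ^ 2 = q ^ 2 + s ^ 2 := Real.sq_sqrt hd.le
  let R : Fin 3 → Fin 3 → ℝ := ![![s / d, q / d, 0], ![q / d, -s / d, 0], ![0, 0, 1]]
  have hR : ∀ a c, ∑ i, R i a * R i c = if a = c then 1 else 0 := by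
    have e1 : s / d * (s / d) + q / d * (q / d) = 1 := by field_simp; linarith
    have e2 : q / d * (q / d) + -s / d * (-s / d) = 1 := by field_simp; linarith
    have e3 : s / d * (q / d) + q / d * (-s / d) = 0 := by field_simp; ring
    have e4 : q / d * (s / d) + -s / d * (q / d) = 0 := by field_simp; ring
    intro a c
    rw [Fin.sum_univ_three]
    fin_cases a <;> fin_cases c <;> simp [R, e1, e2, e3, e4]
  refine ⟨conjLin K R X, hPX.trans (isCongruent_conjLin hR X), ?_, ?_⟩
  · rw [conjLin_apply]
    simp only [Fin.sum_univ_three]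
    change (q / d) • ((q / d) • X (0, 0) + (-s / d) • X (0, 1) + (0 : ℝ) • X (0, 2)) +
      (-s / d) • ((q / d) • X (1, 0) + (-s / d) • X (1, 1) + (0 : ℝ) • X (1, 2)) +
      (0 : ℝ) • ((q / d) • X (2, 0) + (-s / d) • X (2, 1) + (0 : ℝ) • X (2, 2)) = 0
    rw [hX00, hX01, hX10, hX11]
    have h : (q / d) * ((q / d) * p + (-s / d) * s) + (-s / d) * ((q / d) * s + (-s / d) * q) = 0 := by
      field_simp
      linear_combination (-q : ℝ) * hpq
    refine Eq.trans ?_ ((congrArg (· • (1 : K)) h).trans (zero_smul ℝ _))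
    module
  · rw [← hX2, conjLin_apply]
    simp only [Fin.sum_univ_three]
    simp [R]

/-- In dimension two no associativity is needed. -/
theorem isCongruent_of_three {P : MatrixSpace K 3} (hP : P ∈ rankOneProjections K 3) :
    IsCongruent P (outer K 3 (baseVector K 2) (baseVector K 2)) := by
  obtain ⟨Q, hPQ, hQ1, -⟩ := exists_isCongruent_diag_eq_zero hP
  let R : Fin 3 → Fin 3 → ℝ := fun i j => if Equiv.swap 1 2 i = j then 1 else 0
  have hR : ∀ a c, ∑ i, R i a * R i c = if a = c then 1 else 0 := by
    intro a c
    have h : ∀ i, R i a * R i c = if i = Equiv.swap 1 2 a then (if a = c then 1 else 0) else 0 := by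
      intro i
      simp only [R, Equiv.swap_apply_eq_iff]
      by_cases h1 : i = Equiv.swap 1 2 a
      · subst h1; simp
      · simp [h1]
    simp [h]
  have hPS := hPQ.trans (isCongruent_conjLin hR Q)
  obtain ⟨T, hST, hT1, hT2⟩ := exists_isCongruent_diag_eq_zero (hPS.mem hP)
  have hS2 : conjLin K R Q (2, 2) = Q (1, 1) := by
    rw [conjLin_apply]
    simp [R]
  rw [hS2, hQ1] at hT2
  have hPT := hPS.trans hST
  have h := rankOneProjections.sum_diag (hPT.mem hP)
  rw [Fin.sum_univ_three, hT1, hT2, inner_zero_right, add_zero, add_zero] at h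
  rwa [eq_outer_of_diag_eq_one (hPT.mem hP) h] at hPT

end EuclideanComposition

/-! ### The complex numbers, the quaternions and the octonions -/

instance : EuclideanComposition ℂ where
  add_mul := add_mul
  mul_add := mul_add
  smul_mul := smul_mul_assoc
  mul_smul := fun r a b => mul_smul_comm r a b
  one_mul := one_mul
  mul_one := mul_one
  norm_mul := norm_mul
  norm_one := norm_one
  star_eq a := by
    apply Complex.ext
    · simp [Complex.inner]
      ring
    · simp [Complex.inner]

instance : EuclideanComposition ℍ[ℝ] where
  add_mul := add_mul
  mul_add := mul_add
  smul_mul := smul_mul_assoc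
  mul_smul := fun r a b => mul_smul_comm r a b
  one_mul := one_mul
  mul_one := mul_one
  norm_mul := norm_mul
  norm_one := norm_one
  star_eq a := by
    rw [Quaternion.inner_def]
    ext <;> simp
    ring

namespace Octonion

theorem ext {x y : Octonion} (h1 : x.fst = y.fst) (h2 : x.snd = y.snd) : x = y :=
  WithLp.ofLp_injective 2 (Prod.ext h1 h2)

theorem fst_add (x y : Octonion) : (x + y).fst = x.fst + y.fst := rfl
theorem snd_add (x y : Octonion) : (x + y).snd = x.snd + y.snd := rfl
theorem fst_sub (x y : Octonion) : (x - y).fst = x.fst - y.fst := rfl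
theorem snd_sub (x y : Octonion) : (x - y).snd = x.snd - y.snd := rfl
theorem fst_smul (r : ℝ) (x : Octonion) : (r • x).fst = r • x.fst := rfl
theorem snd_smul (r : ℝ) (x : Octonion) : (r • x).snd = r • x.snd := rfl
theorem fst_one : (1 : Octonion).fst = 1 := rfl
theorem snd_one : (1 : Octonion).snd = 0 := rfl
theorem fst_star (x : Octonion) : (star x).fst = star x.fst := rfl
theorem snd_star (x : Octonion) : (star x).snd = -x.snd := rfl
theorem fst_mul (x y : Octonion) : (x * y).fst = x.fst * y.fst - star y.snd * x.snd := rfl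
theorem snd_mul (x y : Octonion) : (x * y).snd = y.snd * x.fst + x.snd * star y.fst := rfl

theorem inner_eq (x y : Octonion) : ⟪x, y⟫ = ⟪x.fst, y.fst⟫ + ⟪x.snd, y.snd⟫ :=
  WithLp.prod_inner_apply (𝕜 := ℝ) (E := ℍ[ℝ]) (F := ℍ[ℝ]) x y

theorem norm_sq_eq (x : Octonion) : ‖x‖ ^ 2 = ‖x.fst‖ ^ 2 + ‖x.snd‖ ^ 2 := by
  rw [← real_inner_self_eq_norm_sq, inner_eq, real_inner_self_eq_norm_sq,
    real_inner_self_eq_norm_sq]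

instance : EuclideanComposition Octonion where
  add_mul a b c := by
    apply Octonion.ext <;> simp only [fst_add, snd_add, fst_mul, snd_mul, mul_add, add_mul] <;> abel
  mul_add a b c := by
    apply Octonion.ext <;>
      simp only [fst_add, snd_add, fst_mul, snd_mul, mul_add, add_mul, star_add] <;> abel
  smul_mul r a b := by
    apply Octonion.ext <;>
      simp only [fst_smul, snd_smul, fst_mul, snd_mul, smul_mul_assoc, mul_smul_comm, smul_sub,
        smul_add]
  mul_smul r a b := by
    apply Octonion.ext <;>
      simp only [fst_smul, snd_smul, fst_mul, snd_mul, smul_mul_assoc, mul_smul_comm, smul_sub,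
        smul_add, EuclideanComposition.star_smul]
  one_mul a := by
    apply Octonion.ext <;> simp [fst_mul, snd_mul, fst_one, snd_one]
  mul_one a := by
    apply Octonion.ext <;> simp [fst_mul, snd_mul, fst_one, snd_one]
  norm_mul a b := by
    rw [← sq_eq_sq₀ (norm_nonneg _) (by positivity), mul_pow, norm_sq_eq, norm_sq_eq, norm_sq_eq,
      fst_mul, snd_mul, norm_sub_sq_real, norm_add_sq_real]
    have h : ⟪b.snd * a.fst, a.snd * star b.fst⟫ = ⟪a.fst * b.fst, star b.snd * a.snd⟫ := by
      rw [← EuclideanComposition.inner_mul_right, mul_assoc, EuclideanComposition.inner_mul_left]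
    rw [h, norm_mul, norm_mul, norm_mul, norm_mul, norm_star, norm_star]
    ring
  norm_one := by
    rw [← sq_eq_sq₀ (norm_nonneg _) zero_le_one, norm_sq_eq, fst_one, snd_one]
    simp
  star_eq a := by
    apply Octonion.ext
    · rw [fst_star, fst_sub, fst_smul, inner_eq, fst_one, snd_one, inner_zero_left, add_zero,
        EuclideanComposition.star_eq]
    · rw [snd_star, snd_sub, snd_smul, snd_one, smul_zero, zero_sub]

theorem finrank_eq : Module.finrank ℝ Octonion = 7 + 1 := by
  have h : Module.finrank ℝ Octonion = Module.finrank ℝ (ℍ[ℝ] × ℍ[ℝ]) :=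
    (WithLp.linearEquiv 2 ℝ (ℍ[ℝ] × ℍ[ℝ])).finrank_eq
  rw [h, Module.finrank_prod, Quaternion.finrank_eq_four]

end Octonion

theorem finrank_piLp (K : Type) [NormedAddCommGroup K] [InnerProductSpace ℝ K]
    [FiniteDimensional ℝ K] (n : ℕ) :
    Module.finrank ℝ (PiLp 2 fun _ : Fin n => K) = n * Module.finrank ℝ K := by
  rw [(WithLp.linearEquiv 2 ℝ (Fin n → K)).finrank_eq, Module.finrank_pi_fintype]
  simp

/-! ### The beta distribution -/

theorem Ring.succ_mul_choose_succ (x : ℝ) (n : ℕ) :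
    ((n : ℝ) + 1) * Ring.choose x (n + 1) = Ring.choose x n * (x - n) := by
  have h := Ring.choose_smul_choose x (Nat.le_add_right n 1)
  rw [Nat.choose_succ_self_right, Nat.add_sub_cancel_left, Ring.choose_one_right, nsmul_eq_mul] at h
  exact_mod_cast h

theorem Real.Gamma_add_natCast {x : ℝ} (hx : 0 < x) (n : ℕ) :
    Real.Gamma (x + n) = (-1) ^ n * n.factorial * Ring.choose (-x) n * Real.Gamma x := by
  induction n with
  | zero => simp
  | succ n ih =>
    have h := Ring.succ_mul_choose_succ (-x) n
    rw [Nat.cast_succ, ← add_assoc, Real.Gamma_add_one (by positivity), ih, Nat.factorial_succ]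
    push_cast
    linear_combination ((-1) ^ n * n.factorial * Real.Gamma x) * h

theorem Ring.choose_neg_ne_zero {x : ℝ} (hx : 0 < x) (n : ℕ) : Ring.choose (-x) n ≠ 0 := by
  intro h
  have h2 := Real.Gamma_add_natCast hx n
  rw [h, mul_zero, zero_mul] at h2
  exact (Real.Gamma_pos_of_pos (by positivity : 0 < x + n)).ne' h2

namespace ProbabilityTheory

/-- The normalizing constant of the beta density with an integral second parameter. -/
theorem one_div_beta_add_one {α : ℝ} (hα : 0 < α) (N : ℕ) :
    1 / beta α (N + 1) = α * Ring.choose (α + N) N := by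
  have h1 : Real.Gamma (α + (N + 1)) =
      N.factorial * Ring.choose (α + N) N * (α * Real.Gamma α) := by
    have h := Real.Gamma_add_natCast (by positivity : 0 < α + 1) N
    rw [Ring.choose_neg, Real.Gamma_add_one hα.ne'] at h
    have h2 : ((Int.negOnePow N • Ring.choose (α + 1 + N - 1) N : ℝ)) =
        (-1) ^ N * Ring.choose (α + N) N := by
      rw [show α + 1 + N - 1 = α + N by ring, Int.negOnePow_def, Units.smul_def]
      simp
    rw [h2] at h
    rw [show α + (N + 1) = α + 1 + N by ring, h]
    have h3 : ((-1 : ℝ) ^ N) * (-1) ^ N = 1 := by rw [← mul_pow]; simp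
    linear_combination (N.factorial * Ring.choose (α + N) N * (α * Real.Gamma α)) * h3
  rw [beta, h1, Real.Gamma_nat_eq_factorial]
  have := (Real.Gamma_pos_of_pos hα).ne'
  have h2 : (N.factorial : ℝ) ≠ 0 := by positivity
  field_simp

/-- The moments of the beta distribution. -/
theorem choose_mul_beta_add_natCast {α β : ℝ} (hα : 0 < α) (hβ : 0 < β) {r k : ℕ} (hr : r ≤ k) :
    k.choose r * (beta (α + r) (β + (k - r : ℕ)) / beta α β) =
      Ring.choose (-α) r * Ring.choose (-β) (k - r) / Ring.choose (-(α + β)) k := by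
  have h1 : α + r + (β + (k - r : ℕ)) = α + β + k := by
    rw [Nat.cast_sub hr]
    ring
  rw [beta, beta, h1, Real.Gamma_add_natCast hα, Real.Gamma_add_natCast hβ,
    Real.Gamma_add_natCast (add_pos hα hβ)]
  have e1 := (Real.Gamma_pos_of_pos hα).ne'
  have e2 := (Real.Gamma_pos_of_pos hβ).ne'
  have e3 := (Real.Gamma_pos_of_pos (add_pos hα hβ)).ne'
  have e4 := Ring.choose_neg_ne_zero (add_pos hα hβ) k
  have e5 : (k.factorial : ℝ) ≠ 0 := by positivity
  have e6 : ((-1 : ℝ)) ^ k ≠ 0 := by simp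
  have e7 : (k.choose r : ℝ) * r.factorial * (k - r).factorial = k.factorial := by
    exact_mod_cast Nat.choose_mul_factorial_mul_factorial hr
  have e8 : (-1 : ℝ) ^ r * (-1) ^ (k - r) = (-1) ^ k := by rw [← pow_add]; congr 1; omega
  field_simp
  rw [← e7, ← e8]
  ring

variable {α β : ℝ}

theorem betaPDFReal_nonneg (hα : 0 < α) (hβ : 0 < β) (t : ℝ) : 0 ≤ betaPDFReal α β t := by
  by_cases h : 0 < t ∧ t < 1
  · exact (betaPDFReal_pos h.1 h.2 hα hβ).le
  · rw [betaPDFReal, if_neg h]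

theorem integral_betaPDFReal (hα : 0 < α) (hβ : 0 < β) : ∫ t, betaPDFReal α β t = 1 := by
  rw [integral_eq_lintegral_of_nonneg_ae (ae_of_all _ (betaPDFReal_nonneg hα hβ))
    (measurable_betaPDFReal α β).aestronglyMeasurable]
  exact congrArg ENNReal.toReal (lintegral_betaPDF_eq_one hα hβ)

theorem integrable_betaPDFReal (hα : 0 < α) (hβ : 0 < β) : Integrable (betaPDFReal α β) := by
  refine Integrable.of_integral_ne_zero ?_
  rw [integral_betaPDFReal hα hβ]
  exact one_ne_zero

theorem integral_betaMeasure (hα : 0 < α) (hβ : 0 < β) (f : ℝ → ℝ) :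
    ∫ t, f t ∂betaMeasure α β = ∫ t, betaPDFReal α β t * f t := by
  refine (integral_withDensity_eq_integral_smul (measurable_betaPDFReal α β).real_toNNReal f).trans ?_
  refine integral_congr_ae (ae_of_all _ fun t => ?_)
  simp only [NNReal.smul_def, Real.coe_toNNReal _ (betaPDFReal_nonneg hα hβ t), smul_eq_mul]

theorem betaPDFReal_mul_pow_mul_pow (hα : 0 < α) (hβ : 0 < β) (r s : ℕ) (t : ℝ) :
    betaPDFReal α β t * (t ^ r * (1 - t) ^ s) =
      beta (α + r) (β + s) / beta α β * betaPDFReal (α + r) (β + s) t := by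
  unfold betaPDFReal
  split_ifs with h
  · have e1 := (beta_pos (by positivity : 0 < α + r) (by positivity : 0 < β + s)).ne'
    have e2 : t ^ (α + r - 1) = t ^ (α - 1) * t ^ r := by
      rw [← Real.rpow_natCast, ← Real.rpow_add h.1]
      congr 1
      ring
    have e3 : (1 - t) ^ (β + s - 1) = (1 - t) ^ (β - 1) * (1 - t) ^ s := by
      rw [← Real.rpow_natCast, ← Real.rpow_add (sub_pos.2 h.2)]
      congr 1
      ring
    rw [e2, e3]
    field_simp
  · ring

/-- Expand `1 + 3t = 4t + (1 - t)`. -/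
theorem integral_one_add_pow_betaMeasure (hα : 0 < α) (hβ : 0 < β) (k : ℕ) :
    ∫ t, (1 + 3 * t) ^ k ∂betaMeasure α β = ∑ r ∈ Finset.range (k + 1), 4 ^ r *
      (Ring.choose (-α) r * Ring.choose (-β) (k - r) / Ring.choose (-(α + β)) k) := by
  rw [integral_betaMeasure hα hβ]
  have h : ∀ t, betaPDFReal α β t * (1 + 3 * t) ^ k = ∑ r ∈ Finset.range (k + 1),
      (4 ^ r * k.choose r * (beta (α + r) (β + (k - r : ℕ)) / beta α β)) *
        betaPDFReal (α + r) (β + (k - r : ℕ)) t := by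
    intro t
    rw [show 1 + 3 * t = 4 * t + (1 - t) by ring, add_pow, Finset.mul_sum]
    refine Finset.sum_congr rfl fun r _ => ?_
    rw [mul_assoc (4 ^ r * (k.choose r : ℝ)), ← betaPDFReal_mul_pow_mul_pow hα hβ]
    ring
  simp only [h]
  rw [integral_finsetSum _ fun r _ =>
    (integrable_betaPDFReal (by positivity) (by positivity)).const_mul _]
  refine Finset.sum_congr rfl fun r hr => ?_
  rw [integral_const_mul, integral_betaPDFReal (by positivity) (by positivity), mul_one, mul_assoc,
    choose_mul_beta_add_natCast hα hβ (by simpa [Nat.lt_succ_iff] using hr)]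

theorem lintegral_betaMeasure (hα : 0 < α) (hβ : 0 < β) {f : ℝ → ENNReal} (hf : Measurable f) :
    ∫⁻ t, f t ∂betaMeasure α β = ENNReal.ofReal (1 / beta α β) *
      ∫⁻ t in Ioo (0 : ℝ) 1, ENNReal.ofReal (t ^ (α - 1) * (1 - t) ^ (β - 1)) * f t := by
  have hm : Measurable (betaPDF α β) := (measurable_betaPDFReal α β).ennreal_ofReal
  rw [betaMeasure, lintegral_withDensity_eq_lintegral_mul _ hm hf,
    ← lintegral_const_mul' _ _ ENNReal.ofReal_ne_top, ← lintegral_indicator measurableSet_Ioo]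
  refine lintegral_congr fun t => ?_
  by_cases ht : t ∈ Ioo (0 : ℝ) 1
  · rw [indicator_of_mem ht, Pi.mul_apply, betaPDF_of_pos_lt_one ht.1 ht.2, mul_assoc,
      ENNReal.ofReal_mul (one_div_pos.2 (beta_pos hα hβ)).le, mul_assoc]
  · have ht' : ¬(0 < t ∧ t < 1) := ht
    rw [indicator_of_notMem ht, Pi.mul_apply, betaPDF_eq, if_neg ht', ENNReal.ofReal_zero, zero_mul]

end ProbabilityTheory

open ProbabilityTheory

/-- The distribution of `1 + 3t`, where `t` has the beta distribution with the parameters `α`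
and `β`: the distribution of the sectional curvature of the projective spaces. -/
def curvatureLaw (α β : ℝ) : Measure ℝ := (betaMeasure α β).map fun t => 1 + 3 * t

theorem isProbabilityMeasure_curvatureLaw {α β : ℝ} (hα : 0 < α) (hβ : 0 < β) :
    IsProbabilityMeasure (curvatureLaw α β) := by
  have := isProbabilityMeasureBeta hα hβ
  exact Measure.isProbabilityMeasure_map (by fun_prop)

theorem integral_pow_curvatureLaw {α β : ℝ} (hα : 0 < α) (hβ : 0 < β) (k : ℕ) :
    ∫ s, s ^ k ∂curvatureLaw α β = ∑ r ∈ Finset.range (k + 1), 4 ^ r *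
      (Ring.choose (-α) r * Ring.choose (-β) (k - r) / Ring.choose (-(α + β)) k) := by
  rw [curvatureLaw, integral_map (by fun_prop) (by fun_prop), integral_one_add_pow_betaMeasure hα hβ]

theorem curvatureLaw_eq_withDensity {α β : ℝ} (hα : 0 < α) (hβ : 0 < β) :
    curvatureLaw α β = (volume.restrict (Ioo (1 : ℝ) 4)).withDensity fun s =>
      ((1 / (3 * beta α β) * (((s - 1) / 3) ^ (α - 1) * ((4 - s) / 3) ^ (β - 1))).toNNReal :
        ENNReal) := by
  refine Measure.ext_of_lintegral _ fun f hf => ?_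
  have hB := beta_pos hα hβ
  have himg : (fun t : ℝ => 1 + 3 * t) '' Ioo 0 1 = Ioo 1 4 := by
    ext s
    constructor
    · rintro ⟨t, ht, rfl⟩
      exact ⟨by linarith [ht.1], by linarith [ht.2]⟩
    · intro hs
      exact ⟨(s - 1) / 3, ⟨by linarith [hs.1], by linarith [hs.2]⟩, by ring⟩
  rw [curvatureLaw, lintegral_map hf (by fun_prop), lintegral_betaMeasure hα hβ (by fun_prop),
    lintegral_withDensity_eq_lintegral_mul _ (by fun_prop) hf, ← himg,
    lintegral_image_eq_lintegral_abs_deriv_mul (f' := fun _ => 3) measurableSet_Ioo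
      (fun t _ => by simpa using (((hasDerivAt_id t).const_mul 3).const_add 1).hasDerivWithinAt)
      (fun x _ y _ h => by simpa using h), ← lintegral_const_mul' _ _ ENNReal.ofReal_ne_top]
  refine setLIntegral_congr_fun measurableSet_Ioo fun t ht => ?_
  have h1 : (1 + 3 * t - 1) / 3 = t := by ring
  have h2 : (4 - (1 + 3 * t)) / 3 = 1 - t := by ring
  simp only [Pi.mul_apply, h1, h2]
  rw [← mul_assoc, ← mul_assoc, ← ENNReal.ofReal_mul (by positivity)]
  congr 1
  change _ = _ * ENNReal.ofReal _
  rw [← ENNReal.ofReal_mul (by positivity)]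
  congr 1
  rw [abs_of_pos (by norm_num)]
  field_simp

/-- Integrals against the distribution of the curvature, for a function that is not assumed to be
measurable. -/
theorem integrable_curvatureLaw {α β : ℝ} (hα : 0 < α) (hβ : 0 < β) {w F : ℝ → ℝ}
    (hw : ∀ s ∈ Ioo (1 : ℝ) 4, w s = ((s - 1) / 3) ^ (α - 1) * ((4 - s) / 3) ^ (β - 1))
    (hF : IntegrableOn (fun s => w s * F s) (Icc 1 4)) :
    Integrable F (curvatureLaw α β) ∧
      ∫ s, F s ∂curvatureLaw α β = 1 / (3 * beta α β) * ∫ s in (1 : ℝ)..4, w s * F s := by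
  have hB := beta_pos hα hβ
  have hd : Measurable fun s : ℝ =>
      (1 / (3 * beta α β) * (((s - 1) / 3) ^ (α - 1) * ((4 - s) / 3) ^ (β - 1))).toNNReal := by
    fun_prop
  have h : ∀ s ∈ Ioo (1 : ℝ) 4,
      (1 / (3 * beta α β) * (((s - 1) / 3) ^ (α - 1) * ((4 - s) / 3) ^ (β - 1))).toNNReal • F s =
        1 / (3 * beta α β) * (w s * F s) := by
    intro s hs
    have h1 : 0 < s - 1 := sub_pos.2 hs.1
    have h2 : 0 < 4 - s := sub_pos.2 hs.2
    rw [NNReal.smul_def, Real.coe_toNNReal _ (by positivity), hw s hs, smul_eq_mul, mul_assoc]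
  have hF2 : IntegrableOn (fun s => 1 / (3 * beta α β) * (w s * F s)) (Ioo 1 4) :=
    (hF.mono_set Ioo_subset_Icc_self).const_mul _
  rw [curvatureLaw_eq_withDensity hα hβ]
  constructor
  · rw [integrable_withDensity_iff_integrable_smul hd]
    exact hF2.congr_fun (fun s hs => (h s hs).symm) measurableSet_Ioo
  · rw [integral_withDensity_eq_integral_smul hd, setIntegral_congr_fun measurableSet_Ioo h,
      integral_const_mul, intervalIntegral.integral_of_le (by norm_num),
      integral_Ioc_eq_integral_Ioo]

section Distribution

variable {Ω : Type*} [MeasurableSpace Ω] {μ : Measure Ω} {κ : Ω → ℝ} {a b : ℕ} {c : ENNReal}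

theorem exists_map_eq_smul_curvatureLaw (ha : 0 < a) (hb : 0 < b) (hκ : AEMeasurable κ μ)
    (hc0 : c ≠ 0) (hc : c ≠ ⊤) (h : ∀ f : ℝ → ENNReal, Measurable f →
      ∫⁻ q, f (κ q) ∂μ = c * ∫⁻ t in Ioo (0 : ℝ) 1, betaDensity a b t * f (1 + 3 * t)) :
    ∃ C : ENNReal, C ≠ 0 ∧ C ≠ ⊤ ∧ μ.map κ = C • curvatureLaw (a / 2) (b / 2) := by
  have ha' : (0 : ℝ) < a / 2 := by positivity
  have hb' : (0 : ℝ) < b / 2 := by positivity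
  have hB := beta_pos ha' hb'
  refine ⟨c * ENNReal.ofReal (beta (a / 2) (b / 2)), mul_ne_zero hc0 (by simpa using hB),
    ENNReal.mul_ne_top hc ENNReal.ofReal_ne_top, Measure.ext_of_lintegral _ fun f hf => ?_⟩
  rw [lintegral_map' hf.aemeasurable hκ, h f hf, lintegral_smul_measure, curvatureLaw,
    lintegral_map hf (by fun_prop), lintegral_betaMeasure ha' hb' (by fun_prop), smul_eq_mul,
    mul_assoc, ← mul_assoc (ENNReal.ofReal (beta _ _)), ← ENNReal.ofReal_mul hB.le,
    mul_one_div_cancel hB.ne', ENNReal.ofReal_one, one_mul]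
  rfl

/-- If the distribution of `κ` is proportional to a probability measure, then the averages of
functions of `κ` are the integrals against this probability measure. -/
theorem average_eq_integral {ν : Measure ℝ} [IsProbabilityMeasure ν] (hκ : AEMeasurable κ μ)
    (hc0 : c ≠ 0) (hc : c ≠ ⊤) (h : μ.map κ = c • ν) {F : ℝ → ℝ} (hF : AEStronglyMeasurable F ν) :
    1 / μ.real univ * ∫ q, F (κ q) ∂μ = ∫ s, F s ∂ν := by
  have hF2 : AEStronglyMeasurable F (μ.map κ) := by
    rw [h]
    exact hF.smul_measure c
  have h1 : μ.real univ = c.toReal := by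
    rw [measureReal_def, ← preimage_univ (f := κ), ← Measure.map_apply_of_aemeasurable hκ .univ, h,
      Measure.smul_apply, measure_univ, smul_eq_mul, mul_one]
  rw [← integral_map hκ hF2, h, integral_smul_measure, h1, smul_eq_mul, ← mul_assoc,
    one_div_mul_cancel (ENNReal.toReal_ne_zero.2 ⟨hc0, hc⟩), one_mul]

end Distribution

/-! ### The sectional curvature of the projective spaces -/

open ProbabilityTheory in
/-- The theorem for a projective space of dimension `n` over a composition algebra of dimension
`a + 1`, in which the rank one projections are congruent. The orthogonal complement of a
"projective line" in a tangent space has dimension `b = 2 (N + 1)`. -/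
theorem EuclideanComposition.sectionalCurvature_projectiveModel {K : Type} [NormedAddCommGroup K]
    [InnerProductSpace ℝ K] [Mul K] [One K] [Star K] [EuclideanComposition K]
    [FiniteDimensional ℝ K] [MeasurableSpace K] [BorelSpace K] {n a N m : ℕ} {α β : ℝ} {w : ℝ → ℝ}
    (ha : Module.finrank ℝ K = a + 1) (hm : m = n * (a + 1)) (hmN : m = 1 + a + 2 * (N + 1))
    (ha0 : 0 < a) (hα : α = a / 2) (hβ : β = N + 1) (hT : IsTripleAssociative K n)
    (hC : ∀ P ∈ rankOneProjections K (n + 1),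
      IsCongruent P (outer K (n + 1) (baseVector K n) (baseVector K n)))
    (hw : ∀ s ∈ Ioo (1 : ℝ) 4, w s = ((s - 1) / 3) ^ (α - 1) * ((4 - s) / 3) ^ N) :
    IsCompactSubmanifold m (projectiveModel K (n + 1)) ∧
    IsSymmetricSubmanifold (projectiveModel K (n + 1)) ∧
    sectionalCurvature m (projectiveModel K (n + 1)) '' grassmannBundle (projectiveModel K (n + 1))
      = Icc 1 4 ∧
    (∀ F : ℝ → ℝ, IntegrableOn (fun s => w s * F s) (Icc 1 4) →
      Integrable (fun q => F (sectionalCurvature m (projectiveModel K (n + 1)) q))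
        (grassmannVolume m (projectiveModel K (n + 1))) ∧
      sectionalAverage m (projectiveModel K (n + 1)) F =
        α / 3 * Ring.choose (α + N) N * ∫ s in (1 : ℝ)..4, w s * F s) ∧
    ∀ k : ℕ, sectionalAverage m (projectiveModel K (n + 1)) (fun s => s ^ k) =
      ∑ r ∈ Finset.range (k + 1), 4 ^ r *
        (Ring.choose (-α) r * Ring.choose (-β) (k - r) / Ring.choose (-(α + β)) k) := by
  have H := homogeneousChart hT (exists_equiv_of_isCongruent hC)
  have hM : IsCompact (projectiveModel K (n + 1)) := isCompact_projectiveModel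
  have hW : Module.finrank ℝ (PiLp 2 fun _ : Fin n => K) = m := by rw [finrank_piLp, ha, hm]
  have hK := isQuarterPinchedBy (n := n) hT ha
  have hb0 : 0 < 2 * (N + 1) := by positivity
  have hα0 : 0 < α := by rw [hα]; positivity
  have hβ0 : 0 < β := by rw [hβ]; positivity
  obtain ⟨hsec, c, hc0, hc, hlaw⟩ := H.lintegral_sectionalCurvature hM hW ha0 hb0 hmN hK
  obtain ⟨C, hC0, hCtop, hmap⟩ := exists_map_eq_smul_curvatureLaw ha0 hb0 hsec hc0 hc hlaw
  have hβ' : ((2 * (N + 1) : ℕ) : ℝ) / 2 = β := by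
    rw [hβ]
    push_cast
    ring
  rw [← hα, hβ'] at hmap
  have := isProbabilityMeasure_curvatureLaw hα0 hβ0
  refine ⟨H.isCompactSubmanifold hW hM, ?_, ?_, fun F hF => ?_, fun k => ?_⟩
  · obtain ⟨σ, h1, h2, h3⟩ := exists_symmetry K n
    exact H.isSymmetricSubmanifold h1 (by rw [affineChart_zero, h2]) h3
  · rw [H.sectionalCurvature_image hW, hK.image_eq_Icc (hW.trans hmN) ha0 hb0]
  · have hw' : ∀ s ∈ Ioo (1 : ℝ) 4,
        w s = ((s - 1) / 3) ^ (α - 1) * ((4 - s) / 3) ^ (β - 1) := fun s hs => by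
      rw [hw s hs, hβ, add_sub_cancel_right, Real.rpow_natCast]
    obtain ⟨h1, h2⟩ := integrable_curvatureLaw hα0 hβ0 hw' hF
    constructor
    · have h3 : Integrable F ((grassmannVolume m (projectiveModel K (n + 1))).map
          (sectionalCurvature m (projectiveModel K (n + 1)))) := by
        rw [hmap]
        exact h1.smul_measure hCtop
      exact h3.comp_aemeasurable hsec
    · refine (average_eq_integral hsec hC0 hCtop hmap h1.aestronglyMeasurable).trans ?_
      have h3 := one_div_beta_add_one hα0 N
      rw [← hβ] at h3
      rw [h2, mul_comm 3, ← div_div, h3]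
      ring
  · rw [← integral_pow_curvatureLaw hα0 hβ0]
    exact average_eq_integral (F := fun s => s ^ k) hsec hC0 hCtop hmap
      (Measurable.aestronglyMeasurable (by fun_prop))

theorem inv_sqrt_eq_rpow {x : ℝ} (hx : 0 < x) : (√x)⁻¹ = x ^ (1 / 2 - 1 : ℝ) := by
  rw [Real.sqrt_eq_rpow, ← Real.rpow_neg hx.le]
  norm_num

theorem sqrt_pow_five_eq_rpow {x : ℝ} (hx : 0 < x) : √x ^ 5 = x ^ (7 / 2 - 1 : ℝ) := by
  rw [Real.sqrt_eq_rpow, ← Real.rpow_natCast, ← Real.rpow_mul hx.le]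
  norm_num

theorem corollary3p1 :
    -- complex projective spaces
    (∀ n : ℕ, 2 ≤ n →
      IsCompactSubmanifold (2 * n) (complexProjectiveSpace n) ∧
      IsSymmetricSubmanifold (complexProjectiveSpace n) ∧
      sectionalCurvature (2 * n) (complexProjectiveSpace n) ''
        grassmannBundle (complexProjectiveSpace n) = Icc 1 4 ∧
      (∀ F : ℝ → ℝ,
        IntegrableOn (fun s => (√((s - 1) / 3))⁻¹ * ((4 - s) / 3) ^ (n - 2) * F s) (Icc 1 4) →
        Integrable (fun q => F (sectionalCurvature (2 * n) (complexProjectiveSpace n) q))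
          (grassmannVolume (2 * n) (complexProjectiveSpace n)) ∧
        sectionalAverage (2 * n) (complexProjectiveSpace n) F =
          1 / 6 * Ring.choose ((n : ℝ) - 3 / 2) (n - 2) *
            ∫ s in (1 : ℝ)..4, (√((s - 1) / 3))⁻¹ * ((4 - s) / 3) ^ (n - 2) * F s) ∧
      (∀ k : ℕ, sectionalAverage (2 * n) (complexProjectiveSpace n) (fun s => s ^ k) =
        ∑ r ∈ Finset.range (k + 1), 4 ^ r *
          (Ring.choose (-1 / 2 : ℝ) r * Ring.choose (-(2 * (n : ℝ) - 2) / 2) (k - r) /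
            Ring.choose (-(2 * (n : ℝ) - 1) / 2) k))) ∧
    -- quaternionic projective spaces
    (∀ n : ℕ, 2 ≤ n →
      IsCompactSubmanifold (4 * n) (quaternionicProjectiveSpace n) ∧
      IsSymmetricSubmanifold (quaternionicProjectiveSpace n) ∧
      sectionalCurvature (4 * n) (quaternionicProjectiveSpace n) ''
        grassmannBundle (quaternionicProjectiveSpace n) = Icc 1 4 ∧
      (∀ F : ℝ → ℝ,
        IntegrableOn (fun s => √((s - 1) / 3) * ((4 - s) / 3) ^ (2 * n - 3) * F s) (Icc 1 4) →
        Integrable (fun q => F (sectionalCurvature (4 * n) (quaternionicProjectiveSpace n) q))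
          (grassmannVolume (4 * n) (quaternionicProjectiveSpace n)) ∧
        sectionalAverage (4 * n) (quaternionicProjectiveSpace n) F =
          3 / 6 * Ring.choose (2 * (n : ℝ) - 3 / 2) (2 * n - 3) *
            ∫ s in (1 : ℝ)..4, √((s - 1) / 3) * ((4 - s) / 3) ^ (2 * n - 3) * F s) ∧
      (∀ k : ℕ, sectionalAverage (4 * n) (quaternionicProjectiveSpace n) (fun s => s ^ k) =
        ∑ r ∈ Finset.range (k + 1), 4 ^ r *
          (Ring.choose (-3 / 2 : ℝ) r * Ring.choose (-(4 * (n : ℝ) - 4) / 2) (k - r) /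
            Ring.choose (-(4 * (n : ℝ) - 1) / 2) k))) ∧
    -- the Cayley projective plane
    (IsCompactSubmanifold 16 cayleyPlane ∧
      IsSymmetricSubmanifold cayleyPlane ∧
      sectionalCurvature 16 cayleyPlane '' grassmannBundle cayleyPlane = Icc 1 4 ∧
      (∀ F : ℝ → ℝ,
        IntegrableOn (fun s => √((s - 1) / 3) ^ 5 * ((4 - s) / 3) ^ 3 * F s) (Icc 1 4) →
        Integrable (fun q => F (sectionalCurvature 16 cayleyPlane q))
          (grassmannVolume 16 cayleyPlane) ∧
        sectionalAverage 16 cayleyPlane F =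
          7 / 6 * Ring.choose (13 / 2 : ℝ) 3 *
            ∫ s in (1 : ℝ)..4, √((s - 1) / 3) ^ 5 * ((4 - s) / 3) ^ 3 * F s) ∧
      (∀ k : ℕ, sectionalAverage 16 cayleyPlane (fun s => s ^ k) =
        ∑ r ∈ Finset.range (k + 1), 4 ^ r *
          (Ring.choose (-7 / 2 : ℝ) r * Ring.choose (-8 / 2 : ℝ) (k - r) /
            Ring.choose (-15 / 2 : ℝ) k))) := by
  refine ⟨fun n hn => ?_, fun n hn => ?_, ?_⟩
  · obtain ⟨N, rfl⟩ := Nat.exists_eq_add_of_le hn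
    have hassoc : ∀ a b c : ℂ, (a * b) * c = a * (b * c) := mul_assoc
    have h := EuclideanComposition.sectionalCurvature_projectiveModel (K := ℂ) (n := 2 + N)
      (a := 1) (N := N) (m := 2 * (2 + N)) (α := 1 / 2) (β := N + 1)
      (w := fun s => (√((s - 1) / 3))⁻¹ * ((4 - s) / 3) ^ N) Complex.finrank_real_complex
      (by ring) (by ring) one_pos (by norm_num) rfl
      (EuclideanComposition.isTripleAssociative_of_assoc hassoc _)
      (fun P hP => EuclideanComposition.isCongruent_of_assoc hassoc hP)
      (fun s hs => by
        rw [inv_sqrt_eq_rpow (by linarith [hs.1])])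
    have e1 : ((2 + N : ℕ) : ℝ) - 3 / 2 = 1 / 2 + N := by push_cast; ring
    have e2 : -(2 * ((2 + N : ℕ) : ℝ) - 2) / 2 = -(N + 1) := by push_cast; ring
    have e3 : -(2 * ((2 + N : ℕ) : ℝ) - 1) / 2 = -(1 / 2 + (N + 1)) := by push_cast; ring
    rw [e1, e2, e3, Nat.add_sub_cancel_left, neg_div, show (1 : ℝ) / 6 = 1 / 2 / 3 by norm_num]
    exact h
  · obtain ⟨N, rfl⟩ := Nat.exists_eq_add_of_le hn
    have hassoc : ∀ a b c : ℍ[ℝ], (a * b) * c = a * (b * c) := mul_assoc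
    have h := EuclideanComposition.sectionalCurvature_projectiveModel (K := ℍ[ℝ]) (n := 2 + N)
      (a := 3) (N := 2 * N + 1) (m := 4 * (2 + N)) (α := 3 / 2) (β := (2 * N + 1 : ℕ) + 1)
      (w := fun s => √((s - 1) / 3) * ((4 - s) / 3) ^ (2 * N + 1)) Quaternion.finrank_eq_four
      (by ring) (by ring) three_pos (by norm_num) rfl
      (EuclideanComposition.isTripleAssociative_of_assoc hassoc _)
      (fun P hP => EuclideanComposition.isCongruent_of_assoc hassoc hP)
      (fun s hs => by
        rw [Real.sqrt_eq_rpow, show (3 : ℝ) / 2 - 1 = 1 / 2 by norm_num])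
    have e1 : 2 * ((2 + N : ℕ) : ℝ) - 3 / 2 = 3 / 2 + (2 * N + 1 : ℕ) := by push_cast; ring
    have e2 : -(4 * ((2 + N : ℕ) : ℝ) - 4) / 2 = -((2 * N + 1 : ℕ) + 1) := by push_cast; ring
    have e3 : -(4 * ((2 + N : ℕ) : ℝ) - 1) / 2 = -(3 / 2 + ((2 * N + 1 : ℕ) + 1)) := by
      push_cast
      ring
    have e4 : 2 * (2 + N) - 3 = 2 * N + 1 := by omega
    rw [e1, e2, e3, e4, neg_div, show (3 : ℝ) / 6 = 3 / 2 / 3 by norm_num]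
    exact h
  · have h := EuclideanComposition.sectionalCurvature_projectiveModel (K := Octonion) (n := 2)
      (a := 7) (N := 3) (m := 16) (α := 7 / 2) (β := (3 : ℕ) + 1)
      (w := fun s => √((s - 1) / 3) ^ 5 * ((4 - s) / 3) ^ 3) Octonion.finrank_eq
      (by norm_num) (by norm_num) (by norm_num) (by norm_num) rfl
      EuclideanComposition.isTripleAssociative_two
      (fun P hP => EuclideanComposition.isCongruent_of_three hP)
      (fun s hs => by
        rw [sqrt_pow_five_eq_rpow (by linarith [hs.1])])
    have e1 : (13 : ℝ) / 2 = 7 / 2 + (3 : ℕ) := by norm_num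
    have e2 : (-8 : ℝ) / 2 = -((3 : ℕ) + 1) := by norm_num
    have e3 : (-15 : ℝ) / 2 = -(7 / 2 + ((3 : ℕ) + 1)) := by norm_num
    rw [e1, e2, e3, neg_div, show (7 : ℝ) / 6 = 7 / 2 / 3 by norm_num]
    exact h

end
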